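/- **Setting.** An *object* is a closed simply connected region in the plane bounded by a simple closed curve. Let $\mathsf F=\{f_1,\dots,f_n\}$, $n\ge 1$, be objects with weights $w_i>0$, in general position: the boundaries of two different objects meet in finitely many points, each of which lies on the boundary of the union of the two objects (as is the case for proper crossings). The *vertices* $\mathcal V(\mathsf F)$ are the points that lie on the boundaries of two different objects, and the *union complexity* of $X\subseteq\mathsf F$ is the number of arcs on the boundary of $\bigcup X$, i.e. the number of connected components of this boundary after removal of the vertices of $X$. A set of objects is *independent* if its members are pairwise disjoint, and $\mathrm{opt}$ is the maximum weight of an independent subset of $\mathsf F$. A function $U$ is *well behaved with constant $c$* if, for arguments $r\ge 1$, $U(r)$ and $U(r)/r$ are non-decreasing and $U(xr)\le c\,U(r)$ for $1\le x\le 2$. We say that $\mathsf F$ has union complexity $O(U)$ with constant $K>0$ if every nonempty $X\subseteq \mathsf F$ has union complexity at most $K\,U(|X|)$. *LP relaxation:* maximize $\sum_i w_ix_i$ subject to $0\le x_i\le 1$, $\sum_{i:\,p\in f_i}x_i\le 1$ for all $p\in\mathcal V(\mathsf F)$, and $\sum_{j:\,f_i\subsetneq f_j}x_j\le 1$ for all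 $i$. The *resistance* of $f_i$ in $H\subseteq\mathsf F$ is the sum of $x_j$ over all $f_j\in H\setminus\{f_i\}$ with $f_i\cap f_j\neq\emptyset$. A *resistance order* $\pi_1,\dots,\pi_n$ is obtained by repeatedly extracting an object of minimum resistance within the set of remaining objects. The *rounding with parameter $\tau$* makes each object a candidate independently with probability $x_i/\tau$, scans the objects in the order $\pi_n,\dots,\pi_1$, and selects a candidate if it is disjoint from all objects selected before. *Machine model:* a real RAM with exact real arithmetic and comparisons, addition and subtraction of natural-number indices, arrays, coin flips with a computed bias, and the following constant-time primitives: do $f_i,f_j$ intersect; is $f_i\subseteq f_j$; the number of intersection points of the boundaries of $f_i,f_j$; does the $t$-th such point (in an arbitrary fixed enumeration) lie in $f_l$. **Theorem.** There are a randomized algorithm, a deterministic algorithm and an exponent $d$ such that for all $c$ and $K>0$ there are constants $A,\delta>0$ such that for every function $U$ that is well behaved with constant $c$ there is a constant $C$ for which the following holds for every set $\mathsf F$ of $n\ge1$ weighted objects in the plane, in general position, with union complexity $O(U)$ with constant $K$. 1. If $x$ is an optimal solution of the LP relaxation, with value $\mathrm{Opt}$ and $\mathcal E=\sum_i x_i$,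 then $\mathrm{Opt}\ge\mathrm{opt}$, and for every resistance order and $\tau=A\,U(\mathcal E)/\mathcal E$, all $x_i/\tau$ lie in $[0,1]$, and the rounding always returns an independent set, of expected weight at least $\delta\,\frac{n}{U(n)}\,\mathrm{Opt}$. 2. The randomized algorithm always halts within $C n^3$ steps and outputs an independent set, whose expected weight is at least $\delta\,\frac{n}{U(n)}\,\mathrm{opt}$. 3. The deterministic algorithm halts within $C n^d$ steps and outputs an independent set of weight at least $\delta\,\frac{n}{U(n)}\,\mathrm{opt}$. -/

import Mathlib

/-! ### Planar objects, arrangements and union complexity -/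

/-- The Euclidean plane. -/
abbrev Plane : Type := EuclideanSpace ℝ (Fin 2)

/-- A closed simply connected region bounded by a simple closed curve: a compact set which is the
closure of its connected interior, has connected complement, and whose boundary is the image of the
circle under an injective continuous map. -/
structure IsJordanRegion (f : Set Plane) : Prop where
  isCompact : IsCompact f
  closure_interior : closure (interior f) = f
  isConnected_interior : IsConnected (interior f)
  isConnected_compl : IsConnected fᶜ
  boundary : ∃ γ : Circle → Plane, Continuous γ ∧ Function.Injective γ ∧ Set.range γ = frontier f

/-- The vertices of the arrangement of the objects `F i`, `i ∈ X`: the points that lie on the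
boundaries of two different objects. -/
def arrVertices {n : ℕ} (F : Fin n → Set Plane) (X : Finset (Fin n)) : Set Plane :=
  {p | ∃ i ∈ X, ∃ j ∈ X, i ≠ j ∧ p ∈ frontier (F i) ∧ p ∈ frontier (F j)}

/-- The union of the objects `F i`, `i ∈ X`. -/
def unionOf {n : ℕ} (F : Fin n → Set Plane) (X : Finset (Fin n)) : Set Plane :=
  ⋃ i ∈ X, F i

/-- The union complexity of the objects `F i`, `i ∈ X`: the number of arcs on the boundary of the
union, that is, the number of connected pieces into which the vertices of the arrangement cut
the boundary of the union. -/
noncomputable def unionComplexity {n : ℕ} (F : Fin n → Set Plane) (X : Finset (Fin n)) : ℕ∞ :=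
  ENat.card (ConnectedComponents ↥(frontier (unionOf F X) \ arrVertices F X))

/-- A well-behaved bound: `U` is monotone, `U r / r` is non-decreasing, and
`U (x r) ≤ c U r` for `1 ≤ x ≤ 2` (all for arguments that are at least `1`). -/
structure WellBehaved (c : ℝ) (U : ℝ → ℝ) : Prop where
  mono : MonotoneOn U (Set.Ici 1)
  ratio_mono : MonotoneOn (fun r => U r / r) (Set.Ici 1)
  doubling : ∀ r x : ℝ, 1 ≤ r → 1 ≤ x → x ≤ 2 → U (x * r) ≤ c * U r

/-- An input: `n` weighted objects in the plane, in general position, together with a list of the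
finitely many intersection points of the boundaries of each pair of objects (in arbitrary order).

General position is used only in this weak form: two boundaries meet in finitely many points,
and each of these is on the boundary of the union of the two objects (as it is where the
boundaries cross properly). -/
structure WeightedObjects (n : ℕ) where
  obj : Fin n → Set Plane
  weight : Fin n → ℝ
  crossings : Fin n → Fin n → List Plane
  isJordanRegion : ∀ i, IsJordanRegion (obj i)
  weight_pos : ∀ i, 0 < weight i
  frontier_inter_finite : ∀ i j, i ≠ j → (frontier (obj i) ∩ frontier (obj j)).Finite
  frontier_inter_subset : ∀ i j, i ≠ j →
    frontier (obj i) ∩ frontier (obj j) ⊆ frontier (obj i ∪ obj j)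
  nodup_crossings : ∀ i j, i ≠ j → (crossings i j).Nodup
  mem_crossings : ∀ i j, i ≠ j →
    ∀ p, p ∈ crossings i j ↔ p ∈ frontier (obj i) ∩ frontier (obj j)

/-- Any `m ≥ 1` of the objects have union complexity at most `K * U m`. -/
def WeightedObjects.UnionComplexityLE {n : ℕ} (F : WeightedObjects n) (K : ℝ) (U : ℝ → ℝ) : Prop :=
  ∀ X : Finset (Fin n), X.Nonempty → unionComplexity F.obj X ≤ (⌊K * U X.card⌋₊ : ℕ∞)

/-- No two different objects of `S` intersect. -/
def WeightedObjects.Independent {n : ℕ} (F : WeightedObjects n) (S : Finset (Fin n)) : Prop :=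
  ∀ i ∈ S, ∀ j ∈ S, i ≠ j → Disjoint (F.obj i) (F.obj j)

/-- Total weight of a set of objects. -/
def WeightedObjects.totalWeight {n : ℕ} (F : WeightedObjects n) (S : Finset (Fin n)) : ℝ :=
  ∑ i ∈ S, F.weight i

/-- The maximum weight of an independent set (a maximum over a finite nonempty family). -/
noncomputable def WeightedObjects.opt {n : ℕ} (F : WeightedObjects n) : ℝ :=
  ⨆ S : {S : Finset (Fin n) // F.Independent S}, F.totalWeight S.1

/-! ### The LP relaxation and its rounding in reverse resistance order -/

open Classical in
/-- Feasibility for the LP relaxation, with one constraint for each vertex of the arrangement and,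
to cope with nested objects, one constraint for the objects that contain a given one. -/
structure WeightedObjects.LPFeasible {n : ℕ} (F : WeightedObjects n) (x : Fin n → ℝ) : Prop where
  nonneg : ∀ i, 0 ≤ x i
  le_one : ∀ i, x i ≤ 1
  vertex : ∀ p ∈ arrVertices F.obj Finset.univ, ∑ i with p ∈ F.obj i, x i ≤ 1
  nested : ∀ i, ∑ j with F.obj i ⊂ F.obj j, x j ≤ 1

/-- Objective value of the LP. -/
def WeightedObjects.lpValue {n : ℕ} (F : WeightedObjects n) (x : Fin n → ℝ) : ℝ :=
  ∑ i, F.weight i * x i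

/-- `x` is an optimal solution of the LP. -/
def WeightedObjects.LPOptimal {n : ℕ} (F : WeightedObjects n) (x : Fin n → ℝ) : Prop :=
  F.LPFeasible x ∧ ∀ y, F.LPFeasible y → F.lpValue y ≤ F.lpValue x

open Classical in
/-- The resistance of object `i` within the set `H`: the sum of the values of the other objects
of `H` that intersect it. -/
noncomputable def WeightedObjects.resistance {n : ℕ} (F : WeightedObjects n) (x : Fin n → ℝ)
    (H : Finset (Fin n)) (i : Fin n) : ℝ :=
  ∑ j ∈ H with j ≠ i ∧ (F.obj i ∩ F.obj j).Nonempty, x j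

/-- `π 0, π 1, …` is obtained by repeatedly extracting an object of minimum resistance among the
objects that remain. -/
def WeightedObjects.ResistanceOrder {n : ℕ} (F : WeightedObjects n) (x : Fin n → ℝ)
    (π : Equiv.Perm (Fin n)) : Prop :=
  ∀ k l : Fin n, k ≤ l →
    F.resistance x ((Finset.Ici k).image π) (π k) ≤ F.resistance x ((Finset.Ici k).image π) (π l)

open Classical in
/-- Scan the objects in the reverse of the order `π`; a candidate (an element of `C`) is added to
the current set when it is disjoint from all objects added before. -/
noncomputable def WeightedObjects.greedy {n : ℕ} (F : WeightedObjects n) (π : Equiv.Perm (Fin n))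
    (C : Finset (Fin n)) : Finset (Fin n) :=
  (List.ofFn π).reverse.foldl
    (fun I i => if i ∈ C ∧ ∀ j ∈ I, Disjoint (F.obj i) (F.obj j) then insert i I else I) ∅

/-- The expected weight of the set returned by the rounding, when each object `i` is a candidate
with probability `q i`, independently of the others. -/
noncomputable def WeightedObjects.expectedRounding {n : ℕ} (F : WeightedObjects n)
    (π : Equiv.Perm (Fin n)) (q : Fin n → ℝ) : ℝ :=
  ∑ C : Finset (Fin n),
    ((∏ i ∈ C, q i) * ∏ i ∈ Cᶜ, (1 - q i)) * F.totalWeight (F.greedy π C)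

/-! ### A randomized real RAM with geometric primitives

Programs are written in a small imperative language over natural numbers (used as indices, with
addition and subtraction only, so that no computing power is hidden in large integers) and exact
real numbers (with the field operations and comparisons, no rounding). Memory consists of scalar
variables and one-dimensional arrays. The objects are accessed only through constant-time
primitives that involve a bounded number of objects. -/

/-- Expressions for natural numbers. `numCrossings i j` is the number of points in which the
boundaries of objects `i` and `j` intersect. -/
inductive NExpr : Type
  | const (k : ℕ)
  | var (x : ℕ)
  | arr (a : ℕ) (idx : NExpr)
  | add (e₁ e₂ : NExpr)
  | sub (e₁ e₂ : NExpr)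
  | numCrossings (i j : NExpr)

/-- Expressions for real numbers. -/
inductive RExpr : Type
  | const (q : ℚ)
  | var (x : ℕ)
  | arr (a : ℕ) (idx : NExpr)
  | ofNat (e : NExpr)
  | add (e₁ e₂ : RExpr)
  | sub (e₁ e₂ : RExpr)
  | mul (e₁ e₂ : RExpr)
  | div (e₁ e₂ : RExpr)

/-- Tests. `intersects i j`: objects `i` and `j` intersect; `contained i j`: object `i` is a
subset of object `j`; `crossingMem i j t l`: the `t`-th intersection point of the boundaries of
objects `i` and `j` lies in object `l`. -/
inductive BExpr : Type
  | natLt (e₁ e₂ : NExpr)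
  | realLt (e₁ e₂ : RExpr)
  | not (b : BExpr)
  | and (b₁ b₂ : BExpr)
  | intersects (i j : NExpr)
  | contained (i j : NExpr)
  | crossingMem (i j t l : NExpr)

/-- Commands. `flip x p` sets the natural variable `x` to `1` with probability `p` (truncated to
the unit interval) and to `0` otherwise. -/
inductive Cmd : Type
  | skip
  | setN (x : ℕ) (e : NExpr)
  | setR (x : ℕ) (e : RExpr)
  | storeN (a : ℕ) (idx : NExpr) (e : NExpr)
  | storeR (a : ℕ) (idx : NExpr) (e : RExpr)
  | flip (x : ℕ) (p : RExpr)
  | seq (c₁ c₂ : Cmd)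
  | ite (b : BExpr) (c₁ c₂ : Cmd)
  | loop (b : BExpr) (c : Cmd)

/-- A program is deterministic if it never flips a coin. -/
def Cmd.Deterministic : Cmd → Prop
  | flip _ _ => False
  | seq c₁ c₂ => c₁.Deterministic ∧ c₂.Deterministic
  | ite _ c₁ c₂ => c₁.Deterministic ∧ c₂.Deterministic
  | loop _ c => c.Deterministic
  | _ => True

/-- Memory: natural and real variables, natural and real arrays. -/
structure Mem where
  nvar : ℕ → ℕ
  rvar : ℕ → ℝ
  narr : ℕ → ℕ → ℕ
  rarr : ℕ → ℕ → ℝ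

/-- Value of an expression for a natural number. -/
def NExpr.eval {n : ℕ} (F : WeightedObjects n) (s : Mem) : NExpr → ℕ
  | const k => k
  | var x => s.nvar x
  | arr a idx => s.narr a (idx.eval F s)
  | add e₁ e₂ => e₁.eval F s + e₂.eval F s
  | sub e₁ e₂ => e₁.eval F s - e₂.eval F s
  | numCrossings i j =>
      if h : i.eval F s < n ∧ j.eval F s < n then
        (F.crossings ⟨i.eval F s, h.1⟩ ⟨j.eval F s, h.2⟩).length
      else 0

/-- Value of an expression for a real number. -/
noncomputable def RExpr.eval {n : ℕ} (F : WeightedObjects n) (s : Mem) : RExpr → ℝ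
  | const q => (q : ℝ)
  | var x => s.rvar x
  | arr a idx => s.rarr a (idx.eval F s)
  | ofNat e => (e.eval F s : ℝ)
  | add e₁ e₂ => e₁.eval F s + e₂.eval F s
  | sub e₁ e₂ => e₁.eval F s - e₂.eval F s
  | mul e₁ e₂ => e₁.eval F s * e₂.eval F s
  | div e₁ e₂ => e₁.eval F s / e₂.eval F s

/-- Truth of a test; geometric tests with an index out of range fail. -/
def BExpr.holds {n : ℕ} (F : WeightedObjects n) (s : Mem) : BExpr → Prop
  | natLt e₁ e₂ => e₁.eval F s < e₂.eval F s
  | realLt e₁ e₂ => e₁.eval F s < e₂.eval F s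
  | not b => ¬ b.holds F s
  | and b₁ b₂ => b₁.holds F s ∧ b₂.holds F s
  | intersects i j => ∃ (hi : i.eval F s < n) (hj : j.eval F s < n),
      (F.obj ⟨i.eval F s, hi⟩ ∩ F.obj ⟨j.eval F s, hj⟩).Nonempty
  | contained i j => ∃ (hi : i.eval F s < n) (hj : j.eval F s < n),
      F.obj ⟨i.eval F s, hi⟩ ⊆ F.obj ⟨j.eval F s, hj⟩
  | crossingMem i j t l =>
      ∃ (hi : i.eval F s < n) (hj : j.eval F s < n) (hl : l.eval F s < n),
        ∃ p, (F.crossings ⟨i.eval F s, hi⟩ ⟨j.eval F s, hj⟩)[t.eval F s]? = some p ∧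
          p ∈ F.obj ⟨l.eval F s, hl⟩

/-- A coin that comes up `true` with probability `p`, truncated to the unit interval. -/
noncomputable def coin (p : ℝ) : PMF Bool :=
  PMF.ofFintype (fun b => cond b (ENNReal.ofReal (min p 1)) (1 - ENNReal.ofReal (min p 1)))
    (by simp)

/-- A configuration: the stack of commands that remain to be executed, and the memory. -/
abbrev Config : Type := List Cmd × Mem

open Classical in
/-- One step of the machine. Each step performs a number of elementary operations that is bounded
in terms of the (fixed) program. -/
noncomputable def step {n : ℕ} (F : WeightedObjects n) : Config → PMF Config
  | ([], s) => PMF.pure ([], s)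
  | (.skip :: k, s) => PMF.pure (k, s)
  | (.setN x e :: k, s) =>
      PMF.pure (k, { s with nvar := Function.update s.nvar x (e.eval F s) })
  | (.setR x e :: k, s) =>
      PMF.pure (k, { s with rvar := Function.update s.rvar x (e.eval F s) })
  | (.storeN a idx e :: k, s) =>
      let row := Function.update (s.narr a) (idx.eval F s) (e.eval F s)
      PMF.pure (k, { s with narr := Function.update s.narr a row })
  | (.storeR a idx e :: k, s) =>
      let row := Function.update (s.rarr a) (idx.eval F s) (e.eval F s)
      PMF.pure (k, { s with rarr := Function.update s.rarr a row })
  | (.flip x p :: k, s) =>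
      (coin (p.eval F s)).map fun b =>
        (k, { s with nvar := Function.update s.nvar x (if b = true then 1 else 0) })
  | (.seq c₁ c₂ :: k, s) => PMF.pure (c₁ :: c₂ :: k, s)
  | (.ite b c₁ c₂ :: k, s) => PMF.pure (if b.holds F s then (c₁ :: k, s) else (c₂ :: k, s))
  | (.loop b c :: k, s) => PMF.pure (if b.holds F s then (c :: .loop b c :: k, s) else (k, s))

/-- Distribution of the configuration after `t` steps. -/
noncomputable def runFor {n : ℕ} (F : WeightedObjects n) : ℕ → Config → PMF Config
  | 0, cfg => PMF.pure cfg
  | t + 1, cfg => (step F cfg).bind (runFor F t)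

open Classical in
/-- Initial memory: natural variable `0` holds `n`, real array `0` holds the weights, and
everything else is zero. -/
noncomputable def initMem {n : ℕ} (F : WeightedObjects n) : Mem where
  nvar := fun x => if x = 0 then n else 0
  rvar := fun _ => 0
  narr := fun _ _ => 0
  rarr := fun a i => if h : a = 0 ∧ i < n then F.weight ⟨i, h.2⟩ else 0

/-- Distribution of the configuration reached by the program `P` on the input `F` in `t` steps. -/
noncomputable def execute {n : ℕ} (P : Cmd) (F : WeightedObjects n) (t : ℕ) : PMF Config :=
  runFor F t ([P], initMem F)

/-- The set of objects encoded in the memory: natural array `0` is its indicator. -/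
def outputSet (n : ℕ) (cfg : Config) : Finset (Fin n) :=
  Finset.univ.filter fun i => cfg.2.narr 0 i ≠ 0

/-- Whatever the coins show, `P` halts on `F` within `t` steps, with an independent set as its
output. -/
def ComputesIndependentSet {n : ℕ} (P : Cmd) (F : WeightedObjects n) (t : ℕ) : Prop :=
  ∀ cfg ∈ (execute P F t).support, cfg.1 = [] ∧ F.Independent (outputSet n cfg)

/-- Expected weight of the output of `P` on `F` after `t` steps. -/
noncomputable def expectedOutput {n : ℕ} (P : Cmd) (F : WeightedObjects n) (t : ℕ) : ℝ :=
  ∑ S : Finset (Fin n), ((execute P F t).map (outputSet n) S).toReal * F.totalWeight S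

/-! ### Topology of Jordan regions -/

/-! The core is Clarkson–Shor sampling, applied to a fractional solution. Let `z` be a fractional
packing of total value `E ≥ 1`. For each pair of objects with crossing boundaries choose a crossing
point that is covered with total value at most 1, and sample each object `i` with probability `z i /
2`. With probability at least `z i * z j / 8` both objects of the pair are sampled and no third
sampled object covers the point; by general position the point then lies on the boundary of the
union of the sample. A union of complexity `N` has at most `2 * N` vertices on its boundary
(`ncard_vertices_le`). Since `U` grows polynomially while the sample size has exponential moments,
the expected number of such pairs is O(U(E)), and so is the sum of `z i * z j` over crossing pairs
(`FractionalPacking.sum_crossing_le`). Objects that intersect without crossing are nested, and the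
nesting constraints bound their share by `2 * E`, which is also O(U(E)). Thus the resistance,
averaged with weights `z`, is O(U(E)/E). As U(r)/r is non-decreasing, every set of objects contains
one with resistance that small (`FractionalPacking.exists_resistance_le`).

Along a resistance order all resistances are therefore at most `τ / 2`. By the union bound a
candidate survives the reverse scan with probability at least 1/2, which gives expected weight at
least `Opt / (2 * τ)` (`le_expectedRounding`).

Both algorithms are the same program, which flips no coins. It solves a weakened LP, with one row
for each ordered pair of indices, up to a constant factor by multiplicative weights: O(log n) phases
raise integer multiplicities, and each raise doubles the weights of the rows involved
(`MwuInvariant`). The randomized rounding is replaced by a local ratio argument along the resistance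
order (`localRatio_le`), which loses the factor `1 + ρ`, with `ρ` the resistance bound. There are
O(n log n) raises and n² rows; a logarithm is saved by grouping the rows into blocks of logarithmic
size and tabulating the sums of row weights over all subsets of a block, so that a cost is one
lookup per block. Rebuilding the tables is amortized against the loads (`totalRaiseTime_le`). The
program is verified in a calculus, `Halts`, whose postconditions also see the number of steps. -/

theorem Plane.one_lt_rank : 1 < Module.rank ℝ Plane := by
  rw [← Module.finrank_eq_rank, finrank_euclideanSpace, Fintype.card_fin]
  norm_num

/-- Polar coordinates: the set is the image of the unit sphere times an interval, and the sphere is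
connected because the dimension exceeds one. -/
theorem Plane.isPreconnected_punctured_ball (p : Plane) (ε : ℝ) :
    IsPreconnected (Metric.ball p ε \ {p}) := by
  have h : Metric.ball p ε \ {p} =
      (fun ut : Plane × ℝ => p + ut.2 • ut.1) '' (Metric.sphere (0 : Plane) 1 ×ˢ Set.Ioo 0 ε) := by
    ext q
    simp only [Set.mem_sdiff, Metric.mem_ball, Set.mem_singleton_iff, Set.mem_image, Set.mem_prod,
      mem_sphere_zero_iff_norm, Set.mem_Ioo, Prod.exists]
    constructor
    · rintro ⟨hq, hne⟩
      have h0 : q - p ≠ 0 := sub_ne_zero.2 hne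
      refine ⟨‖q - p‖⁻¹ • (q - p), ‖q - p‖, ⟨?_, norm_pos_iff.2 h0, by rwa [← dist_eq_norm]⟩, ?_⟩
      · rw [norm_smul, norm_inv, norm_norm, inv_mul_cancel₀ (norm_ne_zero_iff.2 h0)]
      · rw [smul_smul, mul_inv_cancel₀ (norm_ne_zero_iff.2 h0), one_smul]; abel
    · rintro ⟨u, t, ⟨hu, ht, ht'⟩, rfl⟩
      have hn : ‖t • u‖ = t := by rw [norm_smul, hu, mul_one, Real.norm_of_nonneg ht.le]
      refine ⟨by rw [dist_eq_norm, add_sub_cancel_left, hn]; exact ht', fun h => ?_⟩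
      have : t • u = 0 := by simpa using h
      rw [this, norm_zero] at hn
      exact ht.ne hn
  rw [h]
  exact ((isPreconnected_sphere Plane.one_lt_rank 0 1).prod isPreconnected_Ioo).image _
    (by fun_prop)

/-- A preconnected set that avoids the frontier of `A` lies in the interior of `A` or in the
complement of its closure. -/
theorem IsPreconnected.subset_interior_or_disjoint {X : Type*} [TopologicalSpace X] {s A : Set X}
    (hs : IsPreconnected s) (h : Disjoint s (frontier A)) :
    s ⊆ interior A ∨ s ⊆ (closure A)ᶜ := by
  have hcov : s ⊆ interior A ∪ (closure A)ᶜ := by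
    intro x hx
    by_cases hA : x ∈ closure A
    · exact Or.inl (by_contra fun hi => h.le_bot ⟨hx, hA, hi⟩)
    · exact Or.inr hA
  have hdisj : Disjoint (interior A) (closure A)ᶜ :=
    Set.disjoint_left.2 fun x hx hx' => hx' (subset_closure (interior_subset hx))
  exact IsPreconnected.subset_or_subset isOpen_interior isClosed_closure.isOpen_compl hdisj hcov hs

namespace IsJordanRegion

variable {f g : Set Plane}

theorem isClosed (hf : IsJordanRegion f) : IsClosed f := hf.isCompact.isClosed

theorem nonempty (hf : IsJordanRegion f) : f.Nonempty :=
  hf.isConnected_interior.nonempty.mono interior_subset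

theorem isPreconnected (hf : IsJordanRegion f) : IsPreconnected f :=
  hf.closure_interior ▸ hf.isConnected_interior.isPreconnected.closure

theorem isPreconnected_frontier (hf : IsJordanRegion f) : IsPreconnected (frontier f) := by
  obtain ⟨γ, hγ, -, hr⟩ := hf.boundary
  have : ConnectedSpace Circle := by
    have h := (isPreconnected_univ (α := ℝ)).image Circle.exp Circle.exp.continuous.continuousOn
    rw [Set.image_univ, Circle.exp_surjective.range_eq] at h
    exact { isPreconnected_univ := h, toNonempty := inferInstance }
  rw [← hr]
  exact isPreconnected_range hγ

/-- Rules out that two different objects coincide, since boundaries of different objects share only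
finitely many points. -/
theorem frontier_infinite (hf : IsJordanRegion f) : (frontier f).Infinite := by
  obtain ⟨γ, -, hi, hr⟩ := hf.boundary
  rw [← hr]
  have : Infinite Circle := by
    have h : Set.InjOn Circle.exp (Set.Icc 0 1) := Circle.exp_injOn_Icc (by
      have := Real.pi_gt_three; linarith)
    have h' : (Set.Icc (0 : ℝ) 1).Infinite := Set.Icc_infinite one_pos
    exact Set.infinite_univ_iff.1 ((h'.image h).mono (Set.subset_univ _))
  exact Set.infinite_range_of_injective hi

/-- Jordan regions that intersect without a common boundary point are nested. -/
theorem subset_or_subset (hf : IsJordanRegion f) (hg : IsJordanRegion g) (hfg : (f ∩ g).Nonempty)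
    (h : frontier f ∩ frontier g = ∅) : f ⊆ g ∨ g ⊆ f := by
  have hd : Disjoint (frontier g) (frontier f) :=
    (Set.disjoint_iff_inter_eq_empty.2 h).symm
  rcases hg.isPreconnected_frontier.subset_interior_or_disjoint hd with h1 | h1
  · right
    have h2 : Disjoint fᶜ (frontier g) :=
      Set.disjoint_left.2 fun x hx hx' => hx (interior_subset (h1 hx'))
    rcases hf.isConnected_compl.isPreconnected.subset_interior_or_disjoint h2 with h3 | h3
    -- If the complement of `f` lay inside `g`, two compact sets would cover the plane.
    · exfalso
      have hc : (f ∪ g) = Set.univ := by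
        ext x
        by_cases hx : x ∈ f
        · simp [hx]
        · simp [interior_subset (h3 hx)]
      have hcomp : IsCompact (Set.univ : Set Plane) := hc ▸ hf.isCompact.union hg.isCompact
      exact noncompact_univ Plane hcomp
    · intro x hx
      by_contra hxf
      exact h3 hxf (subset_closure hx)
  · have h2 : Disjoint f (frontier g) :=
      Set.disjoint_left.2 fun x hx hx' => h1 hx' (subset_closure hx)
    rcases hf.isPreconnected.subset_interior_or_disjoint h2 with h3 | h3
    · exact Or.inl (h3.trans interior_subset)
    · obtain ⟨x, hxf, hxg⟩ := hfg
      exact absurd (subset_closure hxg) (h3 hxf)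

end IsJordanRegion

/-! ### Connected subsets of the circle -/

/-- A preconnected set covered by three closed sets, pairwise meeting outside of it, lies in one
of them. -/
theorem IsPreconnected.subset_of_three_closed {X : Type*} [TopologicalSpace X] {s A B C : Set X}
    (hs : IsPreconnected s) (hA : IsClosed A) (hB : IsClosed B) (hC : IsClosed C)
    (hcov : s ⊆ A ∪ B ∪ C) (hAB : s ∩ (A ∩ B) = ∅) (hAC : s ∩ (A ∩ C) = ∅)
    (hBC : s ∩ (B ∩ C) = ∅) : s ⊆ A ∨ s ⊆ B ∨ s ⊆ C := by
  have key := isPreconnected_closed_iff.1 hs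
  have h1 : s ⊆ A ∪ B ∨ s ⊆ C := by
    by_contra hcon
    simp only [not_or, Set.not_subset] at hcon
    obtain ⟨⟨x, hx, hx'⟩, y, hy, hy'⟩ := hcon
    obtain ⟨z, hz, hz1, hz2⟩ := key (A ∪ B) C (hA.union hB) hC hcov
      ⟨y, hy, (hcov hy).resolve_right hy'⟩ ⟨x, hx, (hcov hx).resolve_left hx'⟩
    rcases hz1 with h | h
    · exact Set.eq_empty_iff_forall_notMem.1 hAC z ⟨hz, h, hz2⟩
    · exact Set.eq_empty_iff_forall_notMem.1 hBC z ⟨hz, h, hz2⟩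
  rcases h1 with h1 | h1
  · by_contra hcon
    simp only [not_or, Set.not_subset] at hcon
    obtain ⟨⟨x, hx, hx'⟩, ⟨y, hy, hy'⟩, -⟩ := hcon
    obtain ⟨z, hz, hz1, hz2⟩ := key A B hA hB h1
      ⟨y, hy, (h1 hy).resolve_right hy'⟩ ⟨x, hx, (h1 hx).resolve_left hx'⟩
    exact Set.eq_empty_iff_forall_notMem.1 hAB z ⟨hz, hz1, hz2⟩
  · exact Or.inr (Or.inr h1)

/-- Three different points cannot all be limit points, but no members, of a connected subset of the
circle. -/
theorem Circle.not_three_boundary_points {S : Set Circle} (hS : IsPreconnected S) {a b d : Circle}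
    (hab : a ≠ b) (had : a ≠ d) (hbd : b ≠ d) (ha : a ∈ closure S \ S) (hb : b ∈ closure S \ S)
    (hd : d ∈ closure S \ S) : False := by
  have hpi := Real.two_pi_pos
  -- Parametrize the circle so that `a` sits at both ends of the interval. The other two points cut
  -- it into three closed arcs that meet only at points outside `S`, so `S` lies in one of them. The
  -- closure of `S` then lies in that arc as well, but each arc misses one of the three points.
  set φ : ℝ → Circle := fun t => a * Circle.exp t with hφ
  have hφc : Continuous φ := by
    have := Circle.exp.continuous
    fun_prop
  have hsurj : ∀ z : Circle, ∃ t, 0 ≤ t ∧ t < 2 * Real.pi ∧ φ t = z := by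
    intro z
    obtain ⟨t, ht⟩ := Circle.exp_surjective (a⁻¹ * z)
    refine ⟨toIcoMod hpi 0 t, (toIcoMod_mem_Ico hpi 0 t).1, ?_, ?_⟩
    · simpa using (toIcoMod_mem_Ico hpi 0 t).2
    · have : Circle.exp (toIcoMod hpi 0 t) = Circle.exp t := by
        rw [Circle.exp_eq_exp]
        refine ⟨-toIcoDiv hpi 0 t, ?_⟩
        have h := toIcoMod_add_toIcoDiv_zsmul hpi 0 t
        rw [zsmul_eq_mul] at h
        push_cast
        linarith
      simp [hφ, this, ht]
  have hinj : Set.InjOn φ (Set.Ico 0 (2 * Real.pi)) := fun s hs t ht hst =>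
    Circle.exp_injOn_Ico (by simp) hs ht (mul_left_cancel hst)
  have hφ0 : φ 0 = a := by simp [hφ]
  have hφ1 : φ (2 * Real.pi) = a := by simp [hφ]
  have main : ∀ t u : ℝ, 0 < t → t < u → u < 2 * Real.pi → φ t ∈ closure S \ S →
      φ u ∈ closure S \ S → False := by
    intro t u ht htu hu hft hfu
    have hcl : ∀ x y : ℝ, IsClosed (φ '' Set.Icc x y) := fun x y =>
      (isCompact_Icc.image hφc).isClosed
    have hval : ∀ x ∈ Set.Icc 0 (2 * Real.pi), φ x ∈ S → 0 < x ∧ x < 2 * Real.pi := by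
      intro x hx hxS
      refine ⟨lt_of_le_of_ne hx.1 ?_, lt_of_le_of_ne hx.2 ?_⟩
      · rintro rfl; exact ha.2 (hφ0 ▸ hxS)
      · rintro rfl; exact ha.2 (hφ1 ▸ hxS)
    have hmeet : ∀ x y x' y' v : ℝ, 0 ≤ x → y ≤ x' → y' ≤ 2 * Real.pi →
        (∀ r, x ≤ r → r ≤ y → x' ≤ r → r ≤ y' → r = v) → φ v ∉ S →
        S ∩ (φ '' Set.Icc x y ∩ φ '' Set.Icc x' y') = ∅ := by
      intro x y x' y' v hx hyx hy hv hvS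
      rw [Set.eq_empty_iff_forall_notMem]
      rintro z ⟨hz, ⟨r, hr, rfl⟩, ⟨r', hr', he⟩⟩
      by_cases hxy : x' ≤ y'
      · by_cases hxy' : x ≤ y
        · have h1 := hval r ⟨hx.trans hr.1, by linarith [hr.2]⟩ hz
          have h2 := hval r' ⟨by linarith [hr'.1], by linarith [hr'.2]⟩ (he ▸ hz)
          have : r' = r := hinj ⟨h2.1.le, h2.2⟩ ⟨h1.1.le, h1.2⟩ he
          subst this
          exact hvS (hv r' hr.1 hr.2 hr'.1 hr'.2 ▸ hz)
        · exact hxy' (hr.1.trans hr.2)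
      · exact hxy (hr'.1.trans hr'.2)
    have hcov : S ⊆ φ '' Set.Icc 0 t ∪ φ '' Set.Icc t u ∪ φ '' Set.Icc u (2 * Real.pi) := by
      intro z _
      obtain ⟨r, hr0, hr1, rfl⟩ := hsurj z
      rcases le_total r t with h | h
      · exact Or.inl (Or.inl ⟨r, ⟨hr0, h⟩, rfl⟩)
      · rcases le_total r u with h' | h'
        · exact Or.inl (Or.inr ⟨r, ⟨h, h'⟩, rfl⟩)
        · exact Or.inr ⟨r, ⟨h', hr1.le⟩, rfl⟩
    rcases hS.subset_of_three_closed (hcl 0 t) (hcl t u) (hcl u _) hcov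
      (hmeet 0 t t u t le_rfl le_rfl hu.le (fun r _ h h' _ => le_antisymm h h') hft.2)
      (hmeet 0 t u _ t le_rfl htu.le le_rfl (fun r _ h h' _ => by linarith) hft.2)
      (hmeet t u u _ u ht.le le_rfl le_rfl (fun r _ h h' _ => le_antisymm h h') hfu.2)
      with h | h | h
    · obtain ⟨r, hr, he⟩ := closure_minimal h (hcl _ _) hfu.1
      have : r = u := hinj ⟨hr.1, by linarith [hr.2]⟩ ⟨by linarith, hu⟩ he
      linarith [hr.2]
    · obtain ⟨r, hr, he⟩ := closure_minimal h (hcl _ _) ha.1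
      have : r = 0 := hinj ⟨by linarith [hr.1], by linarith [hr.2]⟩ ⟨le_rfl, hpi⟩
        (he.trans hφ0.symm)
      linarith [hr.1]
    · obtain ⟨r, hr, he⟩ := closure_minimal h (hcl _ _) hft.1
      rcases lt_or_eq_of_le hr.2 with h' | h'
      · have : r = t := hinj ⟨by linarith [hr.1], h'⟩ ⟨by linarith, by linarith⟩ he
        linarith [hr.1]
      · rw [h', hφ1, ← hφ0] at he
        have : (0 : ℝ) = t := hinj ⟨le_rfl, hpi⟩ ⟨by linarith, by linarith⟩ he
        linarith
  obtain ⟨t, ht0, ht1, rfl⟩ := hsurj b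
  obtain ⟨u, hu0, hu1, rfl⟩ := hsurj d
  have ht : 0 < t := lt_of_le_of_ne ht0 (by rintro rfl; exact hab hφ0.symm)
  have hu : 0 < u := lt_of_le_of_ne hu0 (by rintro rfl; exact had hφ0.symm)
  rcases lt_trichotomy t u with h | h | h
  · exact main t u ht h hu1 hb hd
  · exact hbd (by rw [h])
  · exact main u t hu h ht1 hd hb

/-! ### Vertices on the boundary of the union -/

namespace WeightedObjects

variable {n : ℕ} (F : WeightedObjects n)

theorem isClosed_unionOf (X : Finset (Fin n)) : IsClosed (unionOf F.obj X) :=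
  X.finite_toSet.isClosed_biUnion fun i _ => (F.isJordanRegion i).isClosed

theorem arrVertices_finite (X : Finset (Fin n)) : (arrVertices F.obj X).Finite := by
  have h : arrVertices F.obj X ⊆
      ⋃ ij ∈ {ij : Fin n × Fin n | ij.1 ≠ ij.2}, frontier (F.obj ij.1) ∩ frontier (F.obj ij.2) := by
    rintro p ⟨i, -, j, -, hij, hi, hj⟩
    exact Set.mem_biUnion (x := (i, j)) hij ⟨hi, hj⟩
  exact (Set.Finite.biUnion (Set.toFinite _)
    fun ij hij => F.frontier_inter_finite ij.1 ij.2 hij).subset h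

theorem frontier_unionOf_subset (X : Finset (Fin n)) :
    frontier (unionOf F.obj X) ⊆ ⋃ i ∈ X, frontier (F.obj i) := by
  intro p hp
  have hmem : p ∈ unionOf F.obj X := (F.isClosed_unionOf X).frontier_subset hp
  simp only [unionOf, Set.mem_iUnion, exists_prop] at hmem ⊢
  obtain ⟨i, hi, hpi⟩ := hmem
  refine ⟨i, hi, subset_closure hpi, fun hpint => hp.2 ?_⟩
  exact interior_mono (Set.subset_biUnion_of_mem (u := F.obj) hi) hpint

/-- The boundary of the union has no isolated points. -/
theorem mem_closure_frontier_unionOf_diff (X : Finset (Fin n)) {V : Set Plane} (hV : V.Finite)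
    {p : Plane} (hp : p ∈ frontier (unionOf F.obj X)) :
    p ∈ closure (frontier (unionOf F.obj X) \ V) := by
  -- Otherwise a punctured ball around `p` misses the boundary. Being connected, it lies in the
  -- interior of the union, and then `p` is interior too, or in the exterior, which is impossible
  -- because an object through `p` is the closure of its interior.
  by_contra hcon
  set W := unionOf F.obj X with hW
  have hfin : (V \ {p}).Finite := hV.subset Set.sdiff_subset
  have hopen : IsOpen ((closure (frontier W \ V))ᶜ ∩ (V \ {p})ᶜ) :=
    isClosed_closure.isOpen_compl.inter hfin.isClosed.isOpen_compl
  obtain ⟨ε, hε, hball⟩ := Metric.isOpen_iff.1 hopen p ⟨hcon, by simp⟩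
  have hdisj : Disjoint (Metric.ball p ε \ {p}) (frontier W) := by
    rw [Set.disjoint_left]
    rintro q ⟨hq, hqp⟩ hqW
    have h := hball hq
    by_cases hqV : q ∈ V
    · exact h.2 ⟨hqV, hqp⟩
    · exact h.1 (subset_closure ⟨hqW, hqV⟩)
  have hWc : closure W = W := (F.isClosed_unionOf X).closure_eq
  have hpW : p ∈ W := (F.isClosed_unionOf X).frontier_subset hp
  rcases (Plane.isPreconnected_punctured_ball p ε).subset_interior_or_disjoint hdisj with h | h
  · refine hp.2 (mem_interior.2 ⟨Metric.ball p ε, fun q hq => ?_, Metric.isOpen_ball,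
      Metric.mem_ball_self hε⟩)
    by_cases hqp : q = p
    · exact hqp ▸ hpW
    · exact interior_subset (h ⟨hq, hqp⟩)
  · have hmem : p ∈ W := hpW
    simp only [hW, unionOf, Set.mem_iUnion, exists_prop] at hmem
    obtain ⟨i, hi, hpi⟩ := hmem
    have hsub : F.obj i ⊆ W := Set.subset_biUnion_of_mem (u := F.obj) hi
    have hpc : p ∈ closure (interior (F.obj i)) := by
      rwa [(F.isJordanRegion i).closure_interior]
    obtain ⟨q, hq, hqi⟩ := mem_closure_iff.1 hpc _ Metric.isOpen_ball (Metric.mem_ball_self hε)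
    have hqp : q = p := by
      by_contra hne
      exact h ⟨hq, hne⟩ (subset_closure (hsub (interior_subset hqi)))
    subst hqp
    exact hp.2 (interior_mono hsub hqi)

/-- A connected piece of the boundary of the union, cut at the vertices, is adjacent to at most two
vertices. -/
theorem not_three_adjacent_vertices (X : Finset (Fin n)) {S : Set Plane} (hS : IsPreconnected S)
    (hSX : S ⊆ frontier (unionOf F.obj X) \ arrVertices F.obj X) {a b d : Plane}
    (hab : a ≠ b) (had : a ≠ d) (hbd : b ≠ d)
    (ha : a ∈ closure S ∩ arrVertices F.obj X) (hb : b ∈ closure S ∩ arrVertices F.obj X)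
    (hd : d ∈ closure S ∩ arrVertices F.obj X) : False := by
  obtain ⟨x, hx⟩ : S.Nonempty := closure_nonempty_iff.1 ⟨a, ha.1⟩
  have hcov := fun {y} (hy : y ∈ S) => F.frontier_unionOf_subset X (hSX hy).1
  obtain ⟨i, hi, hxi⟩ : ∃ i ∈ X, x ∈ frontier (F.obj i) := by simpa using hcov hx
  -- Away from the vertices the boundary curves are pairwise disjoint closed sets, so a connected
  -- piece stays on one of them and can be pulled back to the circle.
  have hSi : S ⊆ frontier (F.obj i) := by
    have hB : IsClosed (⋃ j ∈ X.erase i, frontier (F.obj j)) :=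
      (X.erase i).finite_toSet.isClosed_biUnion fun j _ => isClosed_frontier
    intro y hy
    by_contra hyi
    have hc : S ⊆ frontier (F.obj i) ∪ ⋃ j ∈ X.erase i, frontier (F.obj j) := by
      intro z hz
      obtain ⟨j, hj, hzj⟩ : ∃ j ∈ X, z ∈ frontier (F.obj j) := by simpa using hcov hz
      by_cases hji : j = i
      · exact Or.inl (hji ▸ hzj)
      · exact Or.inr (Set.mem_biUnion (Finset.mem_coe.2 (Finset.mem_erase.2 ⟨hji, hj⟩)) hzj)
    obtain ⟨z, hz, hzi, hzj⟩ := isPreconnected_closed_iff.1 hS _ _ isClosed_frontier hB hc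
      ⟨x, hx, hxi⟩ ⟨y, hy, (hc hy).resolve_left hyi⟩
    simp only [Set.mem_iUnion, Finset.mem_erase, exists_prop] at hzj
    obtain ⟨j, ⟨hji, hj⟩, hzj⟩ := hzj
    exact (hSX hz).2 ⟨i, hi, j, hj, Ne.symm hji, hzi, hzj⟩
  obtain ⟨γ, hγ, hinj, hr⟩ := (F.isJordanRegion i).boundary
  have hemb : Topology.IsClosedEmbedding γ := hγ.isClosedEmbedding hinj
  have himg : γ '' (γ ⁻¹' S) = S := Set.image_preimage_eq_of_subset (hr ▸ hSi)
  have hpre : IsPreconnected (γ ⁻¹' S) := by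
    rw [← hemb.isInducing.isPreconnected_image, himg]; exact hS
  have hcl : ∀ v ∈ closure S ∩ arrVertices F.obj X,
      ∃ u ∈ closure (γ ⁻¹' S) \ γ ⁻¹' S, γ u = v := by
    rintro v ⟨hv, hvV⟩
    rw [← himg, hemb.closure_image_eq] at hv
    obtain ⟨u, hu, rfl⟩ := hv
    exact ⟨u, ⟨hu, fun h => (hSX h).2 hvV⟩, rfl⟩
  obtain ⟨a', ha', rfl⟩ := hcl a ha
  obtain ⟨b', hb', rfl⟩ := hcl b hb
  obtain ⟨d', hdcl, rfl⟩ := hcl d hd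
  exact Circle.not_three_boundary_points hpre (ne_of_apply_ne γ hab) (ne_of_apply_ne γ had)
    (ne_of_apply_ne γ hbd) ha' hb' hdcl

/-- The number of vertices on the boundary of the union is at most twice its complexity. -/
theorem ncard_vertices_le (X : Finset (Fin n)) {N : ℕ} (hN : unionComplexity F.obj X ≤ N) :
    (frontier (unionOf F.obj X) ∩ arrVertices F.obj X).ncard ≤ 2 * N := by
  classical
  set Y := frontier (unionOf F.obj X) \ arrVertices F.obj X with hY
  have hfin : Finite (ConnectedComponents Y) := by
    rw [← ENat.card_lt_top]
    exact lt_of_le_of_lt hN (ENat.natCast_lt_top N)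
  have := Fintype.ofFinite (ConnectedComponents Y)
  have hcard : Fintype.card (ConnectedComponents Y) ≤ N := by
    have h := hN
    rw [unionComplexity, ENat.card_eq_coe_fintype_card] at h
    exact_mod_cast h
  let piece : ConnectedComponents Y → Set Plane :=
    fun C => Subtype.val '' {y : Y | ConnectedComponents.mk y = C}
  have hpre : ∀ C, IsPreconnected (piece C) := by
    intro C
    obtain ⟨y, rfl⟩ := ConnectedComponents.surjective_coe C
    have h : {z : Y | ConnectedComponents.mk z = ConnectedComponents.mk y} =
        connectedComponent y := by
      ext z
      simp only [Set.mem_ofPred_eq, ConnectedComponents.coe_eq_coe']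
    simp only [piece]
    rw [h]
    exact isPreconnected_connectedComponent.image _ continuous_subtype_val.continuousOn
  have hsub : ∀ C, piece C ⊆ Y := by
    rintro C _ ⟨y, -, rfl⟩
    exact y.2
  have hun : Y ⊆ ⋃ C, piece C := fun y hy =>
    Set.mem_iUnion.2 ⟨ConnectedComponents.mk ⟨y, hy⟩, ⟨y, hy⟩, rfl, rfl⟩
  set V := (F.arrVertices_finite X).toFinset with hV
  let adj : ConnectedComponents Y → Finset Plane := fun C => V.filter (· ∈ closure (piece C))
  have hadj : ∀ C, (adj C).card ≤ 2 := by
    intro C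
    by_contra hcon
    obtain ⟨a, b, d, ha, hb, hd, hab, had, hbd⟩ := Finset.two_lt_card_iff.1 (not_le.1 hcon)
    simp only [adj, hV, Finset.mem_filter, Set.Finite.mem_toFinset] at ha hb hd
    exact F.not_three_adjacent_vertices X (hpre C) (hsub C) hab had hbd ha.symm hb.symm hd.symm
  have hcov : frontier (unionOf F.obj X) ∩ arrVertices F.obj X ⊆
      ((Finset.univ.biUnion adj : Finset Plane) : Set Plane) := by
    rintro p ⟨hp, hpV⟩
    -- A vertex on the boundary is a limit of the cut boundary. As there are finitely many pieces,
    -- it is a limit of a single piece, to which it is charged; no piece is charged more than twice.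
    have h := F.mem_closure_frontier_unionOf_diff X (F.arrVertices_finite X) hp
    have h' := closure_mono hun h
    rw [closure_iUnion_of_finite] at h'
    obtain ⟨C, hC⟩ := Set.mem_iUnion.1 h'
    simp only [Finset.coe_biUnion, Set.mem_iUnion, Finset.mem_coe]
    exact ⟨C, Finset.mem_univ C, by simp [adj, hV, hpV, hC]⟩
  calc (frontier (unionOf F.obj X) ∩ arrVertices F.obj X).ncard
      ≤ ((Finset.univ.biUnion adj : Finset Plane) : Set Plane).ncard :=
        Set.ncard_le_ncard hcov (Finset.finite_toSet _)
    _ = (Finset.univ.biUnion adj).card := Set.ncard_coe_finset _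
    _ ≤ ∑ C, (adj C).card := Finset.card_biUnion_le
    _ ≤ ∑ _C : ConnectedComponents Y, 2 := Finset.sum_le_sum fun C _ => hadj C
    _ = Fintype.card (ConnectedComponents Y) * 2 := by simp
    _ ≤ 2 * N := by omega

variable {F} {K c : ℝ} {U : ℝ → ℝ}

theorem UnionComplexityLE.ncard_vertices_le (hF : F.UnionComplexityLE K U) (hK : 0 < K)
    {X : Finset (Fin n)} (hX : X.Nonempty) (hU : 0 ≤ U X.card) :
    ((frontier (unionOf F.obj X) ∩ arrVertices F.obj X).ncard : ℝ) ≤ 2 * (K * U X.card) := by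
  have h := F.ncard_vertices_le X (hF X hX)
  calc ((frontier (unionOf F.obj X) ∩ arrVertices F.obj X).ncard : ℝ)
      ≤ ((2 * ⌊K * U X.card⌋₊ : ℕ) : ℝ) := by exact_mod_cast h
    _ = 2 * (⌊K * U X.card⌋₊ : ℝ) := by push_cast; ring
    _ ≤ _ := by
      gcongr
      exact Nat.floor_le (by positivity)

/-- A single object contributes at least one arc. -/
theorem UnionComplexityLE.one_le (hF : F.UnionComplexityLE K U) (i : Fin n) : 1 ≤ K * U 1 := by
  have h := hF {i} (Finset.singleton_nonempty i)
  have hne : Nonempty ↥(frontier (unionOf F.obj {i}) \ arrVertices F.obj {i}) := by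
    obtain ⟨p, hp⟩ := (F.isJordanRegion i).frontier_infinite.nonempty
    refine ⟨p, by simpa [unionOf] using hp, ?_⟩
    rintro ⟨j, hj, k, hk, hjk, -⟩
    exact hjk ((Finset.mem_singleton.1 hj).trans (Finset.mem_singleton.1 hk).symm)
  have hne' : Nonempty (ConnectedComponents ↥(frontier (unionOf F.obj {i}) \
      arrVertices F.obj {i})) := hne.map ConnectedComponents.mk
  have h1 : (1 : ℕ∞) ≤ unionComplexity F.obj {i} := by
    rw [unionComplexity, ENat.one_le_card_iff_nonempty]; exact hne'
  have h2 : 1 ≤ ⌊K * U ({i} : Finset (Fin n)).card⌋₊ := by exact_mod_cast h1.trans h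
  simpa using Nat.floor_pos.1 h2

end WeightedObjects

/-! ### Independent sampling of a finite type -/

section Sampling

/-- The union bound for the event that nothing in `T` is sampled. -/
theorem one_sub_sum_le_prod_one_sub {ι : Type*} [DecidableEq ι] {q : ι → ℝ} (h0 : ∀ i, 0 ≤ q i)
    (h1 : ∀ i, q i ≤ 1) (T : Finset ι) : 1 - ∑ i ∈ T, q i ≤ ∏ i ∈ T, (1 - q i) := by
  induction T using Finset.induction_on with
  | empty => simp
  | insert a T ha ih =>
    rw [Finset.sum_insert ha, Finset.prod_insert ha]
    have hp : ∏ i ∈ T, (1 - q i) ≤ 1 :=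
      Finset.prod_le_one (fun i _ => sub_nonneg.2 (h1 i)) fun i _ => by linarith [h0 i]
    nlinarith [h0 a, h1 a]

variable {ι : Type*} [Fintype ι] [DecidableEq ι]

/-- The probability that the set of successes of independent trials with success probabilities `q`
is `C`. -/
def sampleProb (q : ι → ℝ) (C : Finset ι) : ℝ :=
  (∏ i ∈ C, q i) * ∏ i ∈ Cᶜ, (1 - q i)

theorem sampleProb_nonneg {q : ι → ℝ} (h0 : ∀ i, 0 ≤ q i) (h1 : ∀ i, q i ≤ 1) (C : Finset ι) :
    0 ≤ sampleProb q C :=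
  mul_nonneg (Finset.prod_nonneg fun i _ => h0 i)
    (Finset.prod_nonneg fun i _ => sub_nonneg.2 (h1 i))

/-- The probability that the sample contains `A` and avoids `T`. -/
theorem sum_sampleProb_subset_disjoint (q : ι → ℝ) {A T : Finset ι} (hAT : Disjoint A T) :
    ∑ C : Finset ι, (if A ⊆ C ∧ Disjoint T C then sampleProb q C else 0) =
      (∏ i ∈ A, q i) * ∏ i ∈ T, (1 - q i) := by
  -- Replacing the success factors on `T` and the failure factors on `A` by zero removes exactly the
  -- samples that are not counted from the expanded product.
  have key := Fintype.prod_add (fun i => if i ∈ T then 0 else q i)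
    (fun i => if i ∈ A then 0 else 1 - q i)
  have h1 : ∏ i, ((if i ∈ T then 0 else q i) + (if i ∈ A then 0 else 1 - q i)) =
      (∏ i ∈ A, q i) * ∏ i ∈ T, (1 - q i) := by
    rw [← Finset.prod_filter_mul_prod_filter_not Finset.univ (· ∈ A),
      ← Finset.prod_filter_mul_prod_filter_not ({x | ¬x ∈ A} : Finset ι) (· ∈ T)]
    have e1 : ({x | x ∈ A} : Finset ι) = A := by ext; simp
    have e2 : ({x ∈ ({x | ¬x ∈ A} : Finset ι) | x ∈ T}) = T := by
      ext x
      simp only [Finset.mem_filter, Finset.mem_univ, true_and, and_iff_right_iff_imp]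
      exact fun h h' => Finset.disjoint_left.1 hAT h' h
    rw [e1, e2]
    congr 1
    · refine Finset.prod_congr rfl fun i hi => ?_
      rw [if_neg (Finset.disjoint_left.1 hAT hi), if_pos hi, add_zero]
    · rw [Finset.prod_eq_one (s := Finset.filter (fun x => ¬x ∈ T) _), mul_one]
      · refine Finset.prod_congr rfl fun i hi => ?_
        rw [if_pos hi, if_neg (Finset.disjoint_right.1 hAT hi), zero_add]
      · intro i hi
        simp only [Finset.mem_filter, Finset.mem_univ, true_and] at hi
        rw [if_neg hi.2, if_neg hi.1]; ring
  rw [← h1, key]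
  refine Finset.sum_congr rfl fun C _ => ?_
  split_ifs with h
  · refine congrArg₂ (· * ·) ?_ ?_
    · exact Finset.prod_congr rfl fun i hi => (if_neg (Finset.disjoint_right.1 h.2 hi)).symm
    · exact Finset.prod_congr rfl fun i hi =>
        (if_neg fun hA => (Finset.mem_compl.1 hi) (h.1 hA)).symm
  · rw [not_and_or, Finset.not_subset, Finset.not_disjoint_iff] at h
    rcases h with ⟨i, hA, hC⟩ | ⟨i, hT, hC⟩
    · rw [Finset.prod_eq_zero (f := fun i => if i ∈ A then (0 : ℝ) else 1 - q i)
        (Finset.mem_compl.2 hC) (if_pos hA), mul_zero]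
    · rw [Finset.prod_eq_zero (f := fun i => if i ∈ T then (0 : ℝ) else q i) hC (if_pos hT),
        zero_mul]

theorem le_sum_sampleProb {q : ι → ℝ} (h0 : ∀ i, 0 ≤ q i) (h1 : ∀ i, q i ≤ 1) {A T : Finset ι}
    (hAT : Disjoint A T) :
    (∏ i ∈ A, q i) * (1 - ∑ i ∈ T, q i) ≤
      ∑ C : Finset ι, (if A ⊆ C ∧ Disjoint T C then sampleProb q C else 0) := by
  rw [sum_sampleProb_subset_disjoint q hAT]
  exact mul_le_mul_of_nonneg_left (one_sub_sum_le_prod_one_sub h0 h1 T)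
    (Finset.prod_nonneg fun i _ => h0 i)

/-- The exponential moments of the size of the sample. -/
theorem sum_sampleProb_mul_pow_card_le {q : ι → ℝ} (h0 : ∀ i, 0 ≤ q i) {b : ℝ} (hb : 1 ≤ b) :
    ∑ C : Finset ι, sampleProb q C * b ^ C.card ≤ Real.exp ((b - 1) * ∑ i, q i) := by
  have key := Fintype.prod_add (fun i => q i * b) (fun i => 1 - q i)
  have h : ∑ C : Finset ι, sampleProb q C * b ^ C.card = ∏ i, (q i * b + (1 - q i)) := by
    rw [key]
    refine Finset.sum_congr rfl fun C _ => ?_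
    rw [Finset.prod_mul_distrib, Finset.prod_const, sampleProb]; ring
  rw [h, Finset.mul_sum, Real.exp_sum]
  refine Finset.prod_le_prod (fun i _ => ?_) fun i _ => ?_
  · nlinarith [h0 i]
  · have := Real.add_one_le_exp ((b - 1) * q i)
    linarith

end Sampling

/-! ### Growth of well-behaved functions -/

/-- A bound for the growth constant of functions that are well behaved with constant `c`. -/
noncomputable def growthConst (c : ℝ) : ℝ := 2 ^ (⌈c⌉₊ ^ 2)

theorem growthConst_pos (c : ℝ) : 0 < growthConst c := by unfold growthConst; positivity

/-- Lets a quadratic in the number `j` of doublings be dominated by `2 ^ (j - 1)`. It serves both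
the growth of `U` and the running time. -/
theorem sq_le_four_mul_two_pow (j : ℕ) : j ^ 2 ≤ 4 * 2 ^ (j - 1) := by
  induction j with
  | zero => simp
  | succ j ih =>
    rcases Nat.lt_or_ge j 4 with h | h
    · interval_cases j <;> norm_num
    · have : 2 ^ (j + 1 - 1) = 2 * 2 ^ (j - 1) := by
        rw [← pow_succ']; congr 1; omega
      rw [this]
      nlinarith

namespace WellBehaved

variable {c K : ℝ} {U : ℝ → ℝ}

theorem nonneg_of_one_le (hU : WellBehaved c U) (h1 : 0 ≤ U 1) {r : ℝ} (hr : 1 ≤ r) : 0 ≤ U r :=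
  h1.trans (hU.mono (Set.mem_Ici.2 le_rfl) hr hr)

theorem pow_doubling (hU : WellBehaved c U) (hc : 0 ≤ c) {r : ℝ} (hr : 1 ≤ r) (j : ℕ) :
    U (2 ^ j * r) ≤ c ^ j * U r := by
  induction j with
  | zero => simp
  | succ j ih =>
    have h1 : 1 ≤ 2 ^ j * r := one_le_mul_of_one_le_of_one_le (one_le_pow₀ one_le_two) hr
    calc U (2 ^ (j + 1) * r) = U (2 * (2 ^ j * r)) := by ring_nf
      _ ≤ c * U (2 ^ j * r) := hU.doubling _ 2 h1 one_le_two le_rfl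
      _ ≤ c * (c ^ j * U r) := mul_le_mul_of_nonneg_left ih hc
      _ = c ^ (j + 1) * U r := by ring

/-- Doubling makes `U` grow polynomially, hence slower than an exponential. Reaching `k` from `B`
takes `j` doublings and costs `c ^ j`, while for `j ≥ 1` the exponential factor is `2 ^ (k / B) ≥ 2
^ (2 ^ (j - 1))`; `growthConst c` absorbs the small `j`. The exponential form is chosen to match the
moments of the sample size. -/
theorem le_growthConst_mul (hU : WellBehaved c U) (h1 : 0 < U 1) {B : ℝ} (hB : 1 ≤ B) {k : ℕ}
    (hk : 1 ≤ k) : U k ≤ growthConst c * ((2 : ℝ) ^ (1 / B)) ^ k * U B := by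
  have hc : 1 ≤ c := by
    have := hU.doubling 1 1 le_rfl le_rfl one_le_two
    rw [mul_one] at this
    by_contra hcon
    nlinarith
  have hUB : 0 ≤ U B := hU.nonneg_of_one_le h1.le hB
  have hk' : (1 : ℝ) ≤ k := by exact_mod_cast hk
  have hB0 : 0 < B := by linarith
  obtain ⟨j, hj1, hj2⟩ : ∃ j : ℕ, (k : ℝ) ≤ 2 ^ j * B ∧ (j = 0 ∨ 2 ^ (j - 1) * B ≤ k) := by
    have hex : ∃ j : ℕ, (k : ℝ) ≤ 2 ^ j * B := by
      refine ⟨k, ?_⟩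
      have : (k : ℝ) ≤ 2 ^ k := by exact_mod_cast Nat.lt_two_pow_self.le
      nlinarith
    classical
    refine ⟨Nat.find hex, Nat.find_spec hex, ?_⟩
    by_cases h0 : Nat.find hex = 0
    · exact Or.inl h0
    · exact Or.inr (not_le.1 (Nat.find_min hex (Nat.sub_lt (Nat.pos_of_ne_zero h0) one_pos))).le
  have hpow : ((2 : ℝ) ^ (1 / B)) ^ k = 2 ^ ((k : ℝ) / B) := by
    rw [← Real.rpow_natCast, ← Real.rpow_mul zero_le_two]; congr 1; ring
  have hgrow : c ^ j ≤ growthConst c * ((2 : ℝ) ^ (1 / B)) ^ k := by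
    rw [hpow]
    rcases hj2 with rfl | hj2
    · rw [pow_zero]
      refine one_le_mul_of_one_le_of_one_le (one_le_pow₀ one_le_two) ?_
      exact Real.one_le_rpow one_le_two (by positivity)
    · set a := ⌈c⌉₊
      have hca : c ≤ 2 ^ a := (Nat.le_ceil c).trans (by exact_mod_cast Nat.lt_two_pow_self.le)
      -- From `(2 * a - j) ^ 2 ≥ 0`, that is `4 * a * j ≤ 4 * a ^ 2 + j ^ 2`.
      have hexp : a * j ≤ a ^ 2 + 2 ^ (j - 1) := by
        have := sq_le_four_mul_two_pow j
        zify at this ⊢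
        nlinarith [sq_nonneg (2 * (a : ℤ) - j)]
      calc c ^ j ≤ (2 ^ a) ^ j := pow_le_pow_left₀ (by linarith) hca j
        _ = 2 ^ (a * j) := (pow_mul _ _ _).symm
        _ ≤ 2 ^ (a ^ 2 + 2 ^ (j - 1)) := pow_le_pow_right₀ one_le_two hexp
        _ = growthConst c * 2 ^ (2 ^ (j - 1)) := by rw [pow_add]; rfl
        _ ≤ growthConst c * 2 ^ ((k : ℝ) / B) := by
          refine mul_le_mul_of_nonneg_left ?_ (growthConst_pos c).le
          rw [← Real.rpow_natCast]
          refine Real.rpow_le_rpow_of_exponent_le one_le_two ?_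
          rw [le_div_iff₀ hB0]
          push_cast
          exact hj2
  calc U k ≤ U (2 ^ j * B) := hU.mono hk' (by
          have : (1 : ℝ) ≤ 2 ^ j := one_le_pow₀ one_le_two
          exact Set.mem_Ici.2 (by nlinarith)) hj1
    _ ≤ c ^ j * U B := hU.pow_doubling (by linarith) hB j
    _ ≤ _ := mul_le_mul_of_nonneg_right hgrow hUB

/-- The expected value of `U` at the size of a sample of expected size at most `B / 2`. -/
theorem sum_sampleProb_mul_le {ι : Type*} [Fintype ι] [DecidableEq ι] (hU : WellBehaved c U)
    (h1 : 0 < U 1) {q : ι → ℝ} (hq0 : ∀ i, 0 ≤ q i) (hq1 : ∀ i, q i ≤ 1) {B : ℝ} (hB : 1 ≤ B)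
    (hsum : ∑ i, q i ≤ B / 2) :
    ∑ C : Finset ι, (if C.Nonempty then sampleProb q C * U C.card else 0) ≤
      2 * growthConst c * U B := by
  have hUB : 0 ≤ U B := hU.nonneg_of_one_le h1.le hB
  have hB0 : 0 < B := by linarith
  -- With this base `b - 1 ≤ 1 / B` by Bernoulli's inequality, and the expected size is at most `B /
  -- 2`, so the exponential moment is at most `exp (1 / 2) ≤ 2`.
  set b : ℝ := 2 ^ (1 / B) with hb
  have hb1 : 1 ≤ b := Real.one_le_rpow one_le_two (by positivity)
  have hb2 : b - 1 ≤ 1 / B := by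
    have h := rpow_one_add_le_one_add_mul_self (s := 1) (p := 1 / B) (by norm_num)
      (by positivity) (by rw [div_le_one hB0]; exact hB)
    have e : (1 : ℝ) + 1 = 2 := by norm_num
    rw [e] at h
    linarith
  have hle : ∀ C : Finset ι, (if C.Nonempty then sampleProb q C * U C.card else 0) ≤
      growthConst c * U B * (sampleProb q C * b ^ C.card) := by
    intro C
    have hC := sampleProb_nonneg hq0 hq1 C
    have hg := growthConst_pos c
    split_ifs with h
    · calc sampleProb q C * U C.card
          ≤ sampleProb q C * (growthConst c * b ^ C.card * U B) :=
            mul_le_mul_of_nonneg_left (hU.le_growthConst_mul h1 hB h.card_pos) hC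
        _ = _ := by ring
    · positivity
  have hmom := sum_sampleProb_mul_pow_card_le hq0 hb1
  have hexp : Real.exp ((b - 1) * ∑ i, q i) ≤ 2 := by
    have h0 : 0 ≤ ∑ i, q i := Finset.sum_nonneg fun i _ => hq0 i
    have : (b - 1) * ∑ i, q i ≤ 1 / 2 := by
      calc (b - 1) * ∑ i, q i ≤ 1 / B * (B / 2) := by
            apply mul_le_mul hb2 hsum h0 (by positivity)
        _ = 1 / 2 := by field_simp
    calc Real.exp ((b - 1) * ∑ i, q i) ≤ Real.exp (1 / 2) := Real.exp_le_exp.2 this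
      _ ≤ Real.exp (Real.log 2) := Real.exp_le_exp.2 (by have := Real.log_two_gt_d9; linarith)
      _ = 2 := Real.exp_log two_pos
  calc _ ≤ ∑ C : Finset ι, growthConst c * U B * (sampleProb q C * b ^ C.card) :=
        Finset.sum_le_sum fun C _ => hle C
    _ = growthConst c * U B * ∑ C : Finset ι, sampleProb q C * b ^ C.card := by
        rw [Finset.mul_sum]
    _ ≤ growthConst c * U B * 2 :=
        mul_le_mul_of_nonneg_left (hmom.trans hexp) (mul_nonneg (growthConst_pos c).le hUB)
    _ = _ := by ring

end WellBehaved

/-! ### Fractional packings have objects of small resistance -/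

namespace WeightedObjects

variable {n : ℕ} {F : WeightedObjects n} {c K : ℝ} {U : ℝ → ℝ}

open Classical in
/-- A weaker form of feasibility for the LP relaxation: only one common boundary point of each pair
of objects has to be covered with total value at most `1`. -/
structure FractionalPacking (F : WeightedObjects n) (z : Fin n → ℝ) : Prop where
  nonneg : ∀ i, 0 ≤ z i
  le_one : ∀ i, z i ≤ 1
  vertex : ∀ i j, i ≠ j → (frontier (F.obj i) ∩ frontier (F.obj j)).Nonempty →
    ∃ p ∈ frontier (F.obj i) ∩ frontier (F.obj j), ∑ l with p ∈ F.obj l, z l ≤ 1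
  nested : ∀ i, ∑ j with F.obj i ⊂ F.obj j, z j ≤ 1

/-- The weaker notion is what the program can produce with one row per ordered pair, however many
points the two boundaries share. All resistance bounds are proved for it and so serve both the LP
rounding and the program. -/
theorem LPFeasible.fractionalPacking {x : Fin n → ℝ} (hx : F.LPFeasible x) :
    F.FractionalPacking x where
  nonneg := hx.nonneg
  le_one := hx.le_one
  vertex i j hij := fun ⟨p, hp⟩ =>
    ⟨p, hp, hx.vertex p ⟨i, Finset.mem_univ i, j, Finset.mem_univ j, hij, hp.1, hp.2⟩⟩
  nested := hx.nested

theorem FractionalPacking.mono {z z' : Fin n → ℝ} (hz : F.FractionalPacking z)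
    (h0 : ∀ i, 0 ≤ z' i) (hle : ∀ i, z' i ≤ z i) : F.FractionalPacking z' where
  nonneg := h0
  le_one i := (hle i).trans (hz.le_one i)
  vertex i j hij hne := by
    obtain ⟨p, hp, hs⟩ := hz.vertex i j hij hne
    exact ⟨p, hp, (Finset.sum_le_sum fun l _ => hle l).trans hs⟩
  nested i := (Finset.sum_le_sum fun l _ => hle l).trans (hz.nested i)

/-- Different objects that intersect have a common boundary point, or one of them is a proper
subset of the other. -/
theorem frontier_inter_or_ssubset (F : WeightedObjects n) {i j : Fin n} (hij : i ≠ j)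
    (h : (F.obj i ∩ F.obj j).Nonempty) :
    (frontier (F.obj i) ∩ frontier (F.obj j)).Nonempty ∨ F.obj i ⊂ F.obj j ∨
      F.obj j ⊂ F.obj i := by
  have hne : F.obj i ≠ F.obj j := by
    intro he
    have := F.frontier_inter_finite i j hij
    rw [he, Set.inter_self] at this
    exact (F.isJordanRegion j).frontier_infinite this
  rcases Set.eq_empty_or_nonempty (frontier (F.obj i) ∩ frontier (F.obj j)) with he | he
  · right
    rcases (F.isJordanRegion i).subset_or_subset (F.isJordanRegion j) h he with h' | h'
    · exact Or.inl (h'.ssubset_of_ne hne)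
    · exact Or.inr (h'.ssubset_of_ne hne.symm)
  · exact Or.inl he

/-- A common boundary point of two objects is on the boundary of a union if no other objects of
the union contain it. -/
theorem mem_frontier_unionOf (F : WeightedObjects n) {C : Finset (Fin n)} {i j : Fin n}
    (hij : i ≠ j) (hi : i ∈ C) {p : Plane} (hp : p ∈ frontier (F.obj i) ∩ frontier (F.obj j))
    (hC : ∀ l ∈ C, p ∈ F.obj l → l = i ∨ l = j) : p ∈ frontier (unionOf F.obj C) := by
  classical
  have hpi : p ∈ F.obj i := (F.isJordanRegion i).isClosed.frontier_subset hp.1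
  refine ⟨subset_closure (Set.mem_biUnion hi hpi), fun hpint => ?_⟩
  -- Near `p` the union of `C` is contained in the union of the two objects, because the rest is
  -- closed and misses `p`. General position says that `p` is not interior to the latter union.
  set D := C.filter fun l => l ≠ i ∧ l ≠ j with hD
  have hDo : IsOpen (unionOf F.obj D)ᶜ := (F.isClosed_unionOf D).isOpen_compl
  have hpD : p ∉ unionOf F.obj D := by
    simp only [unionOf, Set.mem_iUnion, exists_prop, not_exists, not_and]
    intro l hl hpl
    rw [hD, Finset.mem_filter] at hl
    rcases hC l hl.1 hpl with h | h
    · exact hl.2.1 h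
    · exact hl.2.2 h
  refine (F.frontier_inter_subset i j hij hp).2 (mem_interior.2
    ⟨interior (unionOf F.obj C) ∩ (unionOf F.obj D)ᶜ, ?_, isOpen_interior.inter hDo, hpint, hpD⟩)
  rintro q ⟨hq, hqD⟩
  have hq' := interior_subset hq
  simp only [unionOf, Set.mem_iUnion, exists_prop] at hq'
  obtain ⟨l, hl, hql⟩ := hq'
  by_cases hli : l = i
  · exact Or.inl (hli ▸ hql)
  · by_cases hlj : l = j
    · exact Or.inr (hlj ▸ hql)
    · exact absurd (Set.mem_biUnion (Finset.mem_filter.2 ⟨hl, hli, hlj⟩) hql) hqD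

open Classical in
/-- Pairs of objects of `C` with a chosen common boundary point that is covered by no third object
of `C` are at most twice as many as the vertices on the boundary of the union. -/
theorem card_exposed_pairs_le (F : WeightedObjects n) (C : Finset (Fin n))
    (pt : Fin n × Fin n → Plane) (P : Finset (Fin n × Fin n))
    (hP : ∀ ij ∈ P, ij.1 ≠ ij.2 ∧ ij.1 ∈ C ∧ ij.2 ∈ C ∧
      pt ij ∈ frontier (F.obj ij.1) ∩ frontier (F.obj ij.2) ∧
      ∀ l ∈ C, pt ij ∈ F.obj l → l = ij.1 ∨ l = ij.2) :
    P.card ≤ 2 * (frontier (unionOf F.obj C) ∩ arrVertices F.obj C).ncard := by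
  have hfin : (frontier (unionOf F.obj C) ∩ arrVertices F.obj C).Finite :=
    (F.arrVertices_finite C).subset Set.inter_subset_right
  rw [Set.ncard_eq_toFinset_card _ hfin]
  -- The point determines its pair up to order, so the fibres have at most two elements.
  refine Finset.card_le_mul_card_image_of_maps_to (f := pt) (fun ij hij => ?_) 2 fun p hp => ?_
  · obtain ⟨hne, h1, h2, hf, hl⟩ := hP ij hij
    rw [Set.Finite.mem_toFinset]
    exact ⟨F.mem_frontier_unionOf hne h1 hf hl, ij.1, h1, ij.2, h2, hne, hf.1, hf.2⟩
  · rcases Finset.eq_empty_or_nonempty ({a ∈ P | pt a = p}) with h0 | ⟨ij, hij⟩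
    · simp [h0]
    · refine (Finset.card_le_card (t := {ij, ij.swap}) fun kl hkl => ?_).trans Finset.card_le_two
      rw [Finset.mem_filter] at hij hkl
      obtain ⟨hne, h1, h2, hf, hl⟩ := hP ij hij.1
      obtain ⟨hne', h1', h2', hf', hl'⟩ := hP kl hkl.1
      have hmem : ∀ l, p ∈ frontier (F.obj l) → p ∈ F.obj l := fun l h =>
        (F.isJordanRegion l).isClosed.frontier_subset h
      rw [hij.2] at hf hl
      rw [hkl.2] at hf'
      have e1 := hl _ h1' (hmem _ hf'.1)
      have e2 := hl _ h2' (hmem _ hf'.2)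
      rw [Finset.mem_insert, Finset.mem_singleton]
      rcases e1 with e1 | e1 <;> rcases e2 with e2 | e2
      · exact absurd (e1.trans e2.symm) hne'
      · exact Or.inl (Prod.ext e1 e2)
      · exact Or.inr (Prod.ext e1 e2)
      · exact absurd (e1.trans e2.symm) hne'

open Classical in
/-- The total value of the pairs of objects with a common boundary point. -/
theorem FractionalPacking.sum_crossing_le {z : Fin n → ℝ} (hz : F.FractionalPacking z)
    (hU : WellBehaved c U) (hF : F.UnionComplexityLE K U) (hK : 0 < K) (hE : 1 ≤ ∑ i, z i) :
    ∑ ij : Fin n × Fin n with ij.1 ≠ ij.2 ∧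
        (frontier (F.obj ij.1) ∩ frontier (F.obj ij.2)).Nonempty, z ij.1 * z ij.2 ≤
      64 * K * growthConst c * U (∑ i, z i) := by
  set P : Finset (Fin n × Fin n) := {ij | ij.1 ≠ ij.2 ∧
    (frontier (F.obj ij.1) ∩ frontier (F.obj ij.2)).Nonempty} with hP
  have hn : Nonempty (Fin n) := by
    by_contra h
    rw [not_nonempty_iff] at h
    simp at hE
    linarith
  have hU1 : 0 < U 1 := by
    have := hF.one_le hn.some
    by_contra hcon
    nlinarith
  have hchoice : ∀ ij : Fin n × Fin n, ∃ p : Plane, ij ∈ P →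
      p ∈ frontier (F.obj ij.1) ∩ frontier (F.obj ij.2) ∧ ∑ l with p ∈ F.obj l, z l ≤ 1 := by
    intro ij
    by_cases h : ij ∈ P
    · have h' := h
      rw [hP, Finset.mem_filter] at h'
      obtain ⟨p, hp, hs⟩ := hz.vertex _ _ h'.2.1 h'.2.2
      exact ⟨p, fun _ => ⟨hp, hs⟩⟩
    · exact ⟨0, fun h' => absurd h' h⟩
  choose pt hpt using hchoice
  -- The covering value of a chosen point is at most 1. After halving, the probability that a third
  -- object covering it is sampled is at most 1/2.
  set q : Fin n → ℝ := fun i => z i / 2 with hq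
  have hq0 : ∀ i, 0 ≤ q i := fun i => by have := hz.nonneg i; simp only [hq]; linarith
  have hq1 : ∀ i, q i ≤ 1 := fun i => by have := hz.le_one i; simp only [hq]; linarith
  let cover : Fin n × Fin n → Finset (Fin n) := fun ij =>
    Finset.univ.filter fun l => pt ij ∈ F.obj l ∧ l ≠ ij.1 ∧ l ≠ ij.2
  have hAT : ∀ ij : Fin n × Fin n, Disjoint ({ij.1, ij.2} : Finset (Fin n)) (cover ij) := by
    intro ij
    rw [Finset.disjoint_left]
    intro l hl hl'
    rw [Finset.mem_insert, Finset.mem_singleton] at hl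
    have := (Finset.mem_filter.1 hl').2
    rcases hl with h | h
    · exact this.2.1 h
    · exact this.2.2 h
  have hprob : ∀ ij ∈ P, z ij.1 * z ij.2 / 8 ≤ ∑ C : Finset (Fin n),
      (if {ij.1, ij.2} ⊆ C ∧ Disjoint (cover ij) C then sampleProb q C else 0) := by
    intro ij hij
    have hne : ij.1 ≠ ij.2 := (Finset.mem_filter.1 hij).2.1
    refine le_trans ?_ (le_sum_sampleProb hq0 hq1 (hAT ij))
    rw [Finset.prod_pair hne]
    have hcov : ∑ i ∈ cover ij, q i ≤ 1 / 2 := by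
      have h1 : ∑ i ∈ cover ij, z i ≤ 1 := by
        refine le_trans (Finset.sum_le_sum_of_subset_of_nonneg ?_ fun i _ _ => hz.nonneg i)
          (hpt ij hij).2
        intro l hl
        exact Finset.mem_filter.2 ⟨Finset.mem_univ l, (Finset.mem_filter.1 hl).2.1⟩
      simp only [hq]
      rw [← Finset.sum_div]
      linarith
    have hpos : 0 ≤ q ij.1 * q ij.2 := mul_nonneg (hq0 _) (hq0 _)
    have he : z ij.1 * z ij.2 / 8 = q ij.1 * q ij.2 * (1 / 2) := by simp only [hq]; ring
    rw [he]
    exact mul_le_mul_of_nonneg_left (by linarith) hpos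
  -- A sample exposes at most twice as many ordered pairs as its union has boundary vertices, and
  -- these are at most `2 * (K * U C.card)` in number.
  have hcount : ∀ C : Finset (Fin n),
      ∑ ij ∈ P, (if {ij.1, ij.2} ⊆ C ∧ Disjoint (cover ij) C then sampleProb q C else 0) ≤
        4 * K * (if C.Nonempty then sampleProb q C * U C.card else 0) := by
    intro C
    have hC0 := sampleProb_nonneg hq0 hq1 C
    rw [← Finset.sum_filter, Finset.sum_const, nsmul_eq_mul]
    split_ifs with hne
    · have h1 := F.card_exposed_pairs_le C pt
        (P.filter fun ij => {ij.1, ij.2} ⊆ C ∧ Disjoint (cover ij) C) (by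
          intro ij hij
          rw [Finset.mem_filter, Finset.insert_subset_iff, Finset.singleton_subset_iff] at hij
          refine ⟨(Finset.mem_filter.1 hij.1).2.1, hij.2.1.1, hij.2.1.2, (hpt ij hij.1).1, ?_⟩
          intro l hl hpl
          by_contra hcon
          rw [not_or] at hcon
          exact Finset.disjoint_right.1 hij.2.2 hl
            (Finset.mem_filter.2 ⟨Finset.mem_univ l, hpl, hcon⟩))
      have hcard : (1 : ℝ) ≤ C.card := by exact_mod_cast hne.card_pos
      have h2 := hF.ncard_vertices_le hK hne (hU.nonneg_of_one_le hU1.le hcard)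
      have h3 : ((P.filter fun ij => {ij.1, ij.2} ⊆ C ∧ Disjoint (cover ij) C).card : ℝ) ≤
          4 * K * U C.card := by
        have : ((P.filter fun ij => {ij.1, ij.2} ⊆ C ∧ Disjoint (cover ij) C).card : ℝ) ≤
          2 * ((frontier (unionOf F.obj C) ∩ arrVertices F.obj C).ncard : ℝ) := by
          exact_mod_cast h1
        linarith
      calc _ ≤ 4 * K * U C.card * sampleProb q C := mul_le_mul_of_nonneg_right h3 hC0
        _ = _ := by ring
    · rw [Finset.filter_eq_empty_iff.2]
      · simp
      · rintro ij - ⟨h, -⟩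
        exact hne ⟨ij.1, h (by simp)⟩
  have hsum : ∑ i, q i ≤ (∑ i, z i) / 2 := by
    simp only [hq]
    rw [Finset.sum_div]
  have hexp := hU.sum_sampleProb_mul_le hU1 hq0 hq1 hE hsum
  -- Exchange the sums. The constant 64 is 8 from the probability, 4 from the count and 2 from the
  -- growth bound.
  have : ∑ ij ∈ P, z ij.1 * z ij.2 / 8 ≤ 4 * K * (2 * growthConst c * U (∑ i, z i)) := by
    calc ∑ ij ∈ P, z ij.1 * z ij.2 / 8 ≤ ∑ ij ∈ P, ∑ C : Finset (Fin n),
        (if {ij.1, ij.2} ⊆ C ∧ Disjoint (cover ij) C then sampleProb q C else 0) :=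
          Finset.sum_le_sum hprob
      _ = ∑ C : Finset (Fin n), ∑ ij ∈ P,
        (if {ij.1, ij.2} ⊆ C ∧ Disjoint (cover ij) C then sampleProb q C else 0) :=
          Finset.sum_comm
      _ ≤ ∑ C : Finset (Fin n), 4 * K *
          (if C.Nonempty then sampleProb q C * U C.card else 0) :=
          Finset.sum_le_sum fun C _ => hcount C
      _ ≤ _ := by
        rw [← Finset.mul_sum]
        exact mul_le_mul_of_nonneg_left hexp (by positivity)
  rw [← Finset.sum_div] at this
  linarith

/-- The constant in the bound for the minimum resistance. -/
noncomputable def resistanceConst (c K : ℝ) : ℝ := 64 * K * growthConst c + 2 * K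

theorem resistanceConst_pos (c : ℝ) (hK : 0 < K) : 0 < resistanceConst c K := by
  have := growthConst_pos c
  unfold resistanceConst
  positivity

theorem le_resistanceConst (c : ℝ) (hK : 0 < K) : K ≤ resistanceConst c K := by
  have : 0 ≤ 64 * K * growthConst c := by have := growthConst_pos c; positivity
  unfold resistanceConst
  linarith

/-- A single object already has an arc, and the monotone ratio carries this to all arguments. It
absorbs terms linear in the total value, and resistances up to 1, into the bounds in terms of `U`.
-/
theorem UnionComplexityLE.ratio_ge (hF : F.UnionComplexityLE K U) (hU : WellBehaved c U)
    (i : Fin n) (hK : 0 < K) {r : ℝ} (hr : 1 ≤ r) : 1 ≤ K * (U r / r) := by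
  have h1 := hF.one_le i
  have h2 := hU.ratio_mono (Set.mem_Ici.2 le_rfl) hr hr
  simp only [div_one] at h2
  exact h1.trans (mul_le_mul_of_nonneg_left h2 hK.le)

/-- The average resistance, weighted by the values. -/
theorem FractionalPacking.sum_mul_resistance_le {z : Fin n → ℝ} (hz : F.FractionalPacking z)
    (hU : WellBehaved c U) (hF : F.UnionComplexityLE K U) (hK : 0 < K) (hE : 1 ≤ ∑ i, z i) :
    ∑ i, z i * F.resistance z Finset.univ i ≤ resistanceConst c K * U (∑ i, z i) := by
  classical
  have hcross := hz.sum_crossing_le hU hF hK hE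
  set E := ∑ i, z i with hEdef
  have hn : Nonempty (Fin n) := by
    by_contra h
    rw [not_nonempty_iff] at h
    simp [hEdef] at hE
    linarith
  have hEU : E ≤ K * U E := by
    have h := hF.ratio_ge hU hn.some hK hE
    have hE0 : 0 < E := by linarith
    rw [← mul_div_assoc, one_le_div hE0] at h
    exact h
  have hnest : ∑ i, z i * ∑ j with F.obj i ⊂ F.obj j, z j ≤ E := by
    rw [hEdef]
    refine Finset.sum_le_sum fun i _ => ?_
    exact mul_le_of_le_one_right (hz.nonneg i) (hz.nested i)
  -- Only the objects above a given one are constrained, but the double sum is symmetric, so the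
  -- objects below cost no more.
  have hnest' : ∑ i, z i * ∑ j with F.obj j ⊂ F.obj i, z j ≤ E := by
    refine le_trans (le_of_eq ?_) hnest
    simp only [Finset.mul_sum, Finset.sum_filter]
    rw [Finset.sum_comm]
    refine Finset.sum_congr rfl fun j _ => Finset.sum_congr rfl fun i _ => ?_
    split_ifs <;> ring
  have hsplit : ∀ i, F.resistance z Finset.univ i ≤
      (∑ j with i ≠ j ∧ (frontier (F.obj i) ∩ frontier (F.obj j)).Nonempty, z j) +
      (∑ j with F.obj i ⊂ F.obj j, z j) + ∑ j with F.obj j ⊂ F.obj i, z j := by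
    intro i
    rw [resistance, Finset.sum_filter, Finset.sum_filter, Finset.sum_filter, Finset.sum_filter,
      ← Finset.sum_add_distrib, ← Finset.sum_add_distrib]
    refine Finset.sum_le_sum fun j _ => ?_
    have h0 := hz.nonneg j
    have ha : 0 ≤ if i ≠ j ∧ (frontier (F.obj i) ∩ frontier (F.obj j)).Nonempty then z j else 0 := by
      split_ifs <;> simp [h0]
    have hb : 0 ≤ if F.obj i ⊂ F.obj j then z j else 0 := by split_ifs <;> simp [h0]
    have hc : 0 ≤ if F.obj j ⊂ F.obj i then z j else 0 := by split_ifs <;> simp [h0]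
    by_cases h : j ≠ i ∧ (F.obj i ∩ F.obj j).Nonempty
    · rw [if_pos h]
      rcases F.frontier_inter_or_ssubset h.1.symm h.2 with h' | h' | h'
      · rw [if_pos ⟨h.1.symm, h'⟩]; linarith
      · rw [if_pos h'] at hb ⊢; linarith
      · rw [if_pos h'] at hc ⊢; linarith
    · rw [if_neg h]; linarith
  have hcross' : ∑ i, z i * ∑ j with i ≠ j ∧
      (frontier (F.obj i) ∩ frontier (F.obj j)).Nonempty, z j ≤ 64 * K * growthConst c * U E := by
    refine le_trans (le_of_eq ?_) hcross
    rw [Finset.sum_filter, Fintype.sum_prod_type]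
    simp only [Finset.mul_sum, Finset.sum_filter]
    refine Finset.sum_congr rfl fun i _ => Finset.sum_congr rfl fun j _ => ?_
    split_ifs <;> ring
  calc ∑ i, z i * F.resistance z Finset.univ i
      ≤ ∑ i, z i * ((∑ j with i ≠ j ∧ (frontier (F.obj i) ∩ frontier (F.obj j)).Nonempty, z j) +
      (∑ j with F.obj i ⊂ F.obj j, z j) + ∑ j with F.obj j ⊂ F.obj i, z j) :=
        Finset.sum_le_sum fun i _ => mul_le_mul_of_nonneg_left (hsplit i) (hz.nonneg i)
    _ = (∑ i, z i * ∑ j with i ≠ j ∧ (frontier (F.obj i) ∩ frontier (F.obj j)).Nonempty, z j) +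
      (∑ i, z i * ∑ j with F.obj i ⊂ F.obj j, z j) +
        ∑ i, z i * ∑ j with F.obj j ⊂ F.obj i, z j := by
        rw [← Finset.sum_add_distrib, ← Finset.sum_add_distrib]
        refine Finset.sum_congr rfl fun i _ => ?_
        ring
    _ ≤ _ := by unfold resistanceConst; linarith

/-- Every nonempty set of objects contains an object whose resistance within the set is small. -/
theorem FractionalPacking.exists_resistance_le {z : Fin n → ℝ} (hz : F.FractionalPacking z)
    (hU : WellBehaved c U) (hF : F.UnionComplexityLE K U) (hK : 0 < K) {H : Finset (Fin n)}
    (hH : H.Nonempty) {B : ℝ} (hB : 1 ≤ B) (hHB : ∑ i ∈ H, z i ≤ B) :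
    ∃ i ∈ H, F.resistance z H i ≤ resistanceConst c K * (U B / B) := by
  classical
  have hρ := resistanceConst_pos c hK
  -- For total value at most 1 every resistance is at most 1, and any object of `H` will do.
  rcases le_total (∑ i ∈ H, z i) 1 with hE | hE
  · obtain ⟨i, hi⟩ := hH
    refine ⟨i, hi, ?_⟩
    have h1 := hF.ratio_ge hU i hK hB
    have h2 : F.resistance z H i ≤ ∑ i ∈ H, z i :=
      Finset.sum_le_sum_of_subset_of_nonneg (Finset.filter_subset _ _) fun j _ _ => hz.nonneg j
    have h3 : 0 ≤ U B / B := by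
      by_contra hcon
      nlinarith
    have := mul_le_mul_of_nonneg_right (le_resistanceConst c hK) h3
    linarith
  -- Setting the values outside `H` to zero keeps the packing constraints and turns resistance
  -- within `H` into plain resistance. If every object of `H` exceeded the bound, so would the
  -- weighted average.
  · set z' : Fin n → ℝ := fun i => if i ∈ H then z i else 0 with hz'
    have hz'0 : ∀ i, 0 ≤ z' i := fun i => by
      simp only [hz']; split_ifs
      · exact hz.nonneg i
      · exact le_rfl
    have hz'p : F.FractionalPacking z' := hz.mono hz'0 fun i => by
      simp only [hz']; split_ifs
      · exact le_rfl
      · exact hz.nonneg i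
    have hsum : ∑ i, z' i = ∑ i ∈ H, z i := by simp [hz', Finset.sum_ite_mem]
    have hres : ∀ i, F.resistance z' Finset.univ i = F.resistance z H i := by
      intro i
      simp only [resistance, Finset.sum_filter, hz']
      rw [← Finset.sum_subset (Finset.subset_univ H)]
      · refine Finset.sum_congr rfl fun j hj => ?_
        rw [if_pos hj]
      · intro j _ hj
        rw [if_neg hj, ite_self]
    have havg := hz'p.sum_mul_resistance_le hU hF hK (hsum ▸ hE)
    rw [hsum] at havg
    set E := ∑ i ∈ H, z i with hEdef
    have hE0 : 0 < E := by linarith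
    by_contra hcon
    push Not at hcon
    have hratio : U E / E ≤ U B / B := hU.ratio_mono hE hB hHB
    have hlt : resistanceConst c K * (U B / B) * E <
        ∑ i, z' i * F.resistance z' Finset.univ i := by
      have h1 : resistanceConst c K * (U B / B) * E =
          ∑ i ∈ H, z i * (resistanceConst c K * (U B / B)) := by
        rw [← Finset.sum_mul]; ring
      have h2 : ∑ i, z' i * F.resistance z' Finset.univ i =
          ∑ i ∈ H, z i * F.resistance z H i := by
        simp only [hres]
        simp only [hz', ite_mul, zero_mul, Finset.sum_ite_mem, Finset.univ_inter]
      rw [h1, h2]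
      obtain ⟨i, hi, hpos⟩ : ∃ i ∈ H, 0 < z i := by
        by_contra hno
        push Not at hno
        have := Finset.sum_nonpos hno
        linarith
      exact Finset.sum_lt_sum (fun j hj => mul_le_mul_of_nonneg_left (hcon j hj).le (hz.nonneg j))
        ⟨i, hi, mul_lt_mul_of_pos_left (hcon i hi) hpos⟩
    have h4 : resistanceConst c K * U E ≤ resistanceConst c K * (U B / B) * E := by
      have : U E = U E / E * E := by field_simp
      rw [mul_assoc]
      refine mul_le_mul_of_nonneg_left ?_ hρ.le
      rw [this]
      exact mul_le_mul_of_nonneg_right hratio hE0.le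
    linarith

end WeightedObjects

/-! ### The LP relaxation and its rounding -/

namespace WeightedObjects

variable {n : ℕ} {F : WeightedObjects n} {c K : ℝ} {U : ℝ → ℝ}

theorem independent_empty (F : WeightedObjects n) : F.Independent ∅ := by
  intro i hi
  simp at hi

theorem opt_le_of_forall {b : ℝ} (h : ∀ S, F.Independent S → F.totalWeight S ≤ b) : F.opt ≤ b := by
  have : Nonempty {S : Finset (Fin n) // F.Independent S} := ⟨⟨∅, F.independent_empty⟩⟩
  exact ciSup_le fun S => h S.1 S.2

theorem totalWeight_le_opt {S : Finset (Fin n)} (hS : F.Independent S) :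
    F.totalWeight S ≤ F.opt :=
  le_ciSup (f := fun S : {S : Finset (Fin n) // F.Independent S} => F.totalWeight S.1)
    (Set.finite_range _).bddAbove ⟨S, hS⟩

theorem weight_le_opt (F : WeightedObjects n) (i : Fin n) : F.weight i ≤ F.opt := by
  have h : F.Independent {i} := by
    intro a ha b hb hab
    exact absurd ((Finset.mem_singleton.1 ha).trans (Finset.mem_singleton.1 hb).symm) hab
  simpa [totalWeight] using totalWeight_le_opt h

/-- An independent set contains at most one of the objects that contain a given nonempty set. -/
theorem Independent.sum_indicator_le_one {S : Finset (Fin n)} (hS : F.Independent S)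
    {T : Finset (Fin n)} {p : Plane} (hT : ∀ l ∈ T, p ∈ F.obj l) :
    ∑ l ∈ T, (if l ∈ S then (1 : ℝ) else 0) ≤ 1 := by
  rw [← Finset.sum_filter, Finset.sum_const, nsmul_eq_mul, mul_one]
  have : (T.filter (· ∈ S)).card ≤ 1 := by
    rw [Finset.card_le_one]
    intro a ha b hb
    rw [Finset.mem_filter] at ha hb
    by_contra hab
    exact Set.disjoint_left.1 (hS a ha.2 b hb.2 hab) (hT a ha.1) (hT b hb.1)
  exact_mod_cast this

/-- Each constraint, for a vertex or for a contained object, concerns objects with a common point,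
and at most one of those is in an independent set. -/
theorem Independent.lpFeasible {S : Finset (Fin n)} (hS : F.Independent S) :
    F.LPFeasible fun i => if i ∈ S then 1 else 0 where
  nonneg i := by split_ifs <;> norm_num
  le_one i := by split_ifs <;> norm_num
  vertex p _ := by
    classical
    exact hS.sum_indicator_le_one fun l hl => (Finset.mem_filter.1 hl).2
  nested i := by
    classical
    obtain ⟨p, hp⟩ := (F.isJordanRegion i).nonempty
    exact hS.sum_indicator_le_one fun l hl => (Finset.mem_filter.1 hl).2.1 hp

theorem lpValue_indicator (F : WeightedObjects n) (S : Finset (Fin n)) :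
    F.lpValue (fun i => if i ∈ S then 1 else 0) = F.totalWeight S := by
  simp [lpValue, totalWeight]

theorem LPOptimal.opt_le {x : Fin n → ℝ} (hx : F.LPOptimal x) : F.opt ≤ F.lpValue x :=
  opt_le_of_forall fun S hS => F.lpValue_indicator S ▸ hx.2 _ hS.lpFeasible

/-- An optimal solution of the LP has total value at least `1`. -/
theorem LPOptimal.one_le_sum {x : Fin n → ℝ} (hx : F.LPOptimal x) (hn : 1 ≤ n) :
    1 ≤ ∑ i, x i := by
  classical
  by_contra hcon
  rw [not_le] at hcon
  obtain ⟨i₀⟩ : Nonempty (Fin n) := ⟨⟨0, hn⟩⟩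
  set η := 1 - ∑ i, x i with hη
  have hη0 : 0 < η := by linarith
  -- Put the missing value on one object. Every constraint is a partial sum of a nonnegative vector
  -- of total 1, so feasibility is kept while the objective grows.
  set y : Fin n → ℝ := fun i => x i + if i = i₀ then η else 0 with hy
  have hy0 : ∀ i, 0 ≤ y i := fun i => by
    have := hx.1.nonneg i
    simp only [hy]
    split_ifs <;> linarith
  have hysum : ∑ i, y i = 1 := by
    simp only [hy, Finset.sum_add_distrib, Finset.sum_ite_eq', Finset.mem_univ, if_true]
    linarith
  have hle : ∀ T : Finset (Fin n), ∑ i ∈ T, y i ≤ 1 := fun T => by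
    rw [← hysum]
    exact Finset.sum_le_sum_of_subset_of_nonneg (Finset.subset_univ T) fun i _ _ => hy0 i
  have hyF : F.LPFeasible y :=
    { nonneg := hy0
      le_one := fun i => by simpa using hle {i}
      vertex := fun p _ => hle _
      nested := fun i => hle _ }
  have h := hx.2 y hyF
  have h' : F.lpValue y = F.lpValue x + F.weight i₀ * η := by
    simp only [lpValue, hy, mul_add, Finset.sum_add_distrib, mul_ite, mul_zero, Finset.sum_ite_eq',
      Finset.mem_univ, if_true]
  have := mul_pos (F.weight_pos i₀) hη0
  linarith

/-- Some remaining object has small resistance, so the extracted minimum has too. -/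
theorem ResistanceOrder.resistance_le {x : Fin n → ℝ} {π : Equiv.Perm (Fin n)}
    (hπ : F.ResistanceOrder x π) (hx : F.FractionalPacking x) (hU : WellBehaved c U)
    (hF : F.UnionComplexityLE K U) (hK : 0 < K) {B : ℝ} (hB : 1 ≤ B) (hsum : ∑ i, x i ≤ B)
    (k : Fin n) :
    F.resistance x ((Finset.Ici k).image π) (π k) ≤ resistanceConst c K * (U B / B) := by
  have hne : ((Finset.Ici k).image π).Nonempty :=
    ⟨π k, Finset.mem_image_of_mem π (Finset.mem_Ici.2 le_rfl)⟩
  obtain ⟨i, hi, hle⟩ := hx.exists_resistance_le hU hF hK hne hB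
    ((Finset.sum_le_sum_of_subset_of_nonneg (Finset.subset_univ _) fun i _ _ => hx.nonneg i).trans
      hsum)
  obtain ⟨l, hl, rfl⟩ := Finset.mem_image.1 hi
  exact (hπ k l (Finset.mem_Ici.1 hl)).trans hle

/-! #### The greedy scan -/

open Classical in
/-- One step of the scan. -/
noncomputable def greedyStep (F : WeightedObjects n) (C I : Finset (Fin n)) (i : Fin n) :
    Finset (Fin n) :=
  if i ∈ C ∧ ∀ j ∈ I, Disjoint (F.obj i) (F.obj j) then insert i I else I

theorem subset_greedyStep (C I : Finset (Fin n)) (i : Fin n) : I ⊆ F.greedyStep C I i := by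
  unfold greedyStep
  split_ifs
  · exact Finset.subset_insert i I
  · exact subset_rfl

theorem subset_foldl_greedyStep (C : Finset (Fin n)) (L : List (Fin n)) (I : Finset (Fin n)) :
    I ⊆ L.foldl (F.greedyStep C) I := by
  induction L generalizing I with
  | nil => exact subset_rfl
  | cons i L ih => exact (subset_greedyStep C I i).trans (ih _)

theorem mem_foldl_greedyStep {C : Finset (Fin n)} {L : List (Fin n)} {I : Finset (Fin n)}
    {j : Fin n} (hj : j ∈ L.foldl (F.greedyStep C) I) : j ∈ I ∨ j ∈ L ∧ j ∈ C := by
  induction L generalizing I with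
  | nil => exact Or.inl hj
  | cons i L ih =>
    rcases ih hj with h | h
    · unfold greedyStep at h
      split_ifs at h with hc
      · rcases Finset.mem_insert.1 h with rfl | h
        · exact Or.inr ⟨List.mem_cons_self, hc.1⟩
        · exact Or.inl h
      · exact Or.inl h
    · exact Or.inr ⟨List.mem_cons_of_mem i h.1, h.2⟩

theorem independent_foldl_greedyStep (C : Finset (Fin n)) (L : List (Fin n)) {I : Finset (Fin n)}
    (hI : F.Independent I) : F.Independent (L.foldl (F.greedyStep C) I) := by
  induction L generalizing I with
  | nil => exact hI
  | cons i L ih =>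
    refine ih ?_
    unfold greedyStep
    split_ifs with hc
    · intro a ha b hb hab
      rcases Finset.mem_insert.1 ha with rfl | ha'
      · rcases Finset.mem_insert.1 hb with rfl | hb'
        · exact absurd rfl hab
        · exact hc.2 b hb'
      · rcases Finset.mem_insert.1 hb with rfl | hb'
        · exact (hc.2 a ha').symm
        · exact hI a ha' b hb' hab
    · exact hI

theorem greedy_eq_foldl (F : WeightedObjects n) (π : Equiv.Perm (Fin n)) (C : Finset (Fin n)) :
    F.greedy π C = (List.ofFn π).reverse.foldl (F.greedyStep C) ∅ := by
  classical
  unfold greedy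
  congr 1

theorem independent_greedy (F : WeightedObjects n) (π : Equiv.Perm (Fin n)) (C : Finset (Fin n)) :
    F.Independent (F.greedy π C) := by
  rw [greedy_eq_foldl]
  exact independent_foldl_greedyStep C _ F.independent_empty

/-- A candidate is selected if it is disjoint from the candidates that are scanned before. -/
theorem mem_greedy {π : Equiv.Perm (Fin n)} {C : Finset (Fin n)} {k : Fin n} (hk : π k ∈ C)
    (h : ∀ l, k < l → π l ∈ C → Disjoint (F.obj (π k)) (F.obj (π l))) : π k ∈ F.greedy π C := by
  have hlen : (k : ℕ) < (List.ofFn π).length := by simp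
  -- In the reversed list exactly the objects of larger index precede `π k`.
  have hsplit : (List.ofFn π).reverse = ((List.ofFn π).drop (k + 1)).reverse ++
      π k :: ((List.ofFn π).take k).reverse := by
    have h1 : List.ofFn π = (List.ofFn π).take k ++ π k :: (List.ofFn π).drop (k + 1) := by
      have h2 := List.drop_eq_getElem_cons hlen
      rw [List.getElem_ofFn] at h2
      conv_lhs => rw [← List.take_append_drop (k : ℕ) (List.ofFn π), h2]
    conv_lhs => rw [h1]
    simp
  rw [greedy_eq_foldl, hsplit, List.foldl_append, List.foldl_cons]
  apply subset_foldl_greedyStep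
  unfold greedyStep
  rw [if_pos]
  · exact Finset.mem_insert_self _ _
  · refine ⟨hk, fun j hj => ?_⟩
    rcases mem_foldl_greedyStep hj with hj | ⟨hj, hjC⟩
    · simp at hj
    · rw [List.mem_reverse, List.mem_drop_iff_getElem] at hj
      obtain ⟨m, hm, rfl⟩ := hj
      rw [List.getElem_ofFn] at hjC ⊢
      exact h _ (by rw [Fin.lt_def]; simp; omega) hjC

/-- The expected weight of the rounding when all resistances along the order are at most half the
scaling parameter. -/
theorem le_expectedRounding {x : Fin n → ℝ} {π : Equiv.Perm (Fin n)} {τ : ℝ} (hτ : 0 < τ)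
    (h0 : ∀ i, 0 ≤ x i) (h1 : ∀ i, x i ≤ τ)
    (hres : ∀ k, F.resistance x ((Finset.Ici k).image π) (π k) ≤ τ / 2) :
    F.lpValue x / (2 * τ) ≤ F.expectedRounding π fun i => x i / τ := by
  classical
  set q : Fin n → ℝ := fun i => x i / τ with hq
  have hq0 : ∀ i, 0 ≤ q i := fun i => div_nonneg (h0 i) hτ.le
  have hq1 : ∀ i, q i ≤ 1 := fun i => (div_le_one hτ).2 (h1 i)
  -- The objects that can block `π k`: its neighbours that the reverse scan meets first. Their total
  -- value is at most `τ / 2`, so with probability at least 1/2 none of them is a candidate.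
  let T : Fin n → Finset (Fin n) := fun k => ((Finset.Ici k).image π).filter fun j =>
    j ≠ π k ∧ (F.obj (π k) ∩ F.obj j).Nonempty
  have hT : ∀ k, ∑ j ∈ T k, q j ≤ 1 / 2 := by
    intro k
    have h := hres k
    rw [resistance] at h
    simp only [hq]
    rw [← Finset.sum_div, div_le_iff₀ hτ]
    calc ∑ j ∈ T k, x j ≤ τ / 2 := by convert h
      _ = 1 / 2 * τ := by ring
  have hsel : ∀ C : Finset (Fin n), ∑ k, F.weight (π k) *
      (if {π k} ⊆ C ∧ Disjoint (T k) C then 1 else 0) ≤ F.totalWeight (F.greedy π C) := by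
    intro C
    have hre : F.totalWeight (F.greedy π C) =
        ∑ k, F.weight (π k) * (if π k ∈ F.greedy π C then 1 else 0) := by
      rw [Equiv.sum_comp π fun i => F.weight i * (if i ∈ F.greedy π C then (1 : ℝ) else 0)]
      simp [totalWeight]
    rw [hre]
    refine Finset.sum_le_sum fun k _ => mul_le_mul_of_nonneg_left ?_ (F.weight_pos _).le
    split_ifs with h1 h2 h2
    · exact le_rfl
    · exfalso
      refine h2 (mem_greedy (Finset.singleton_subset_iff.1 h1.1) fun l hl hlC => ?_)
      by_contra hd
      rw [Set.not_disjoint_iff_nonempty_inter] at hd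
      refine Finset.disjoint_right.1 h1.2 hlC (Finset.mem_filter.2 ⟨?_, ?_, hd⟩)
      · exact Finset.mem_image_of_mem π (Finset.mem_Ici.2 hl.le)
      · exact fun he => hl.ne' (π.injective he)
    · exact zero_le_one
    · exact le_rfl
  have hprob : ∀ k, q (π k) / 2 ≤
      ∑ C : Finset (Fin n), (if {π k} ⊆ C ∧ Disjoint (T k) C then sampleProb q C else 0) := by
    intro k
    have hd : Disjoint {π k} (T k) := by
      rw [Finset.disjoint_singleton_left]
      exact fun h => (Finset.mem_filter.1 h).2.1 rfl
    refine le_trans ?_ (le_sum_sampleProb hq0 hq1 hd)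
    rw [Finset.prod_singleton]
    nlinarith [hq0 (π k), hT k]
  calc F.lpValue x / (2 * τ) = ∑ k, F.weight (π k) * (q (π k) / 2) := by
        rw [Equiv.sum_comp π fun i => F.weight i * (q i / 2), lpValue, Finset.sum_div]
        refine Finset.sum_congr rfl fun i _ => ?_
        simp only [hq]
        field_simp
    _ ≤ ∑ k, F.weight (π k) * ∑ C : Finset (Fin n),
        (if {π k} ⊆ C ∧ Disjoint (T k) C then sampleProb q C else 0) :=
        Finset.sum_le_sum fun k _ => mul_le_mul_of_nonneg_left (hprob k) (F.weight_pos _).le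
    _ = ∑ C : Finset (Fin n), sampleProb q C * ∑ k, F.weight (π k) *
        (if {π k} ⊆ C ∧ Disjoint (T k) C then 1 else 0) := by
        simp only [Finset.mul_sum]
        rw [Finset.sum_comm]
        refine Finset.sum_congr rfl fun C _ => Finset.sum_congr rfl fun k _ => ?_
        split_ifs <;> ring
    _ ≤ ∑ C : Finset (Fin n), sampleProb q C * F.totalWeight (F.greedy π C) :=
        Finset.sum_le_sum fun C _ =>
          mul_le_mul_of_nonneg_left (hsel C) (sampleProb_nonneg hq0 hq1 C)
    _ = _ := by
        unfold expectedRounding sampleProb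
        rfl

/-- Rounding an optimal solution of the LP relaxation. -/
theorem LPOptimal.rounding {x : Fin n → ℝ} (hx : F.LPOptimal x) (hn : 1 ≤ n)
    (hU : WellBehaved c U) (hF : F.UnionComplexityLE K U) (hK : 0 < K) {π : Equiv.Perm (Fin n)}
    (hπ : F.ResistanceOrder x π) {τ : ℝ}
    (hτ : τ = 2 * resistanceConst c K * (U (∑ i, x i) / ∑ i, x i)) :
    (∀ i, 0 ≤ x i / τ ∧ x i / τ ≤ 1) ∧
      1 / (4 * resistanceConst c K) * (n / U n * F.lpValue x) ≤
        F.expectedRounding π fun i => x i / τ := by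
  have hE := hx.one_le_sum hn
  set E := ∑ i, x i with hEdef
  have i₀ : Fin n := ⟨0, hn⟩
  have hρ := resistanceConst_pos c hK
  have hKρ := le_resistanceConst c hK
  have hr := hF.ratio_ge hU i₀ hK hE
  have hr0 : 0 < U E / E := by
    by_contra hcon
    nlinarith
  -- From `1 ≤ K * (U E / E)` and `K ≤ resistanceConst c K`; this makes the scaled values
  -- probabilities.
  have hτ1 : 1 ≤ τ := by
    rw [hτ]
    nlinarith
  have hτ0 : 0 < τ := by linarith
  have hx1 : ∀ i, x i ≤ τ := fun i => (hx.1.le_one i).trans hτ1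
  refine ⟨fun i => ⟨div_nonneg (hx.1.nonneg i) hτ0.le, (div_le_one hτ0).2 (hx1 i)⟩, ?_⟩
  have hmain := le_expectedRounding hτ0 hx.1.nonneg hx1 (F := F) (π := π) fun k => by
    have h := hπ.resistance_le hx.1.fractionalPacking hU hF hK hE le_rfl k
    calc _ ≤ _ := h
      _ = τ / 2 := by rw [hτ]; ring
  refine le_trans ?_ hmain
  have hEn : E ≤ n := by
    rw [hEdef]
    calc ∑ i, x i ≤ ∑ _i : Fin n, (1 : ℝ) := Finset.sum_le_sum fun i _ => hx.1.le_one i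
      _ = n := by simp
  have hn1 : (1 : ℝ) ≤ n := by exact_mod_cast hn
  -- As the ratio increases, the guarantee in terms of `E` implies the one in terms of `n`.
  have hrn : U E / E ≤ U n / n := hU.ratio_mono hE hn1 hEn
  have hopt : 0 ≤ F.lpValue x :=
    Finset.sum_nonneg fun i _ => mul_nonneg (F.weight_pos i).le (hx.1.nonneg i)
  have hinv : (n : ℝ) / U n ≤ (U E / E)⁻¹ := by
    rw [← inv_div]
    exact inv_anti₀ hr0 hrn
  calc 1 / (4 * resistanceConst c K) * (n / U n * F.lpValue x)
      ≤ 1 / (4 * resistanceConst c K) * ((U E / E)⁻¹ * F.lpValue x) := by gcongr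
    _ = F.lpValue x / (2 * τ) := by rw [hτ]; field_simp; ring

end WeightedObjects

/-! ### Multiplicative weights for the packing constraints -/

namespace WeightedObjects

variable {n : ℕ} (F : WeightedObjects n)

/-- The weight of the object with index `i`, as stored in the input array. -/
noncomputable def weightAt (i : ℕ) : ℝ := if h : i < n then F.weight ⟨i, h⟩ else 0

theorem weightAt_coe (i : Fin n) : F.weightAt i = F.weight i := by simp [weightAt]

theorem weightAt_pos {i : ℕ} (hi : i < n) : 0 < F.weightAt i := by
  simp [weightAt, hi, F.weight_pos]

/-- Object `l` takes part in the constraint with index `e = i * n + j`. For `i = j` these are the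
objects that contain object `i`, otherwise the objects that contain the first common boundary
point of objects `i` and `j`, if there is one. -/
def RowMem (e l : ℕ) : Prop :=
  (e / n = e % n ∧ ∃ (hi : e / n < n) (hl : l < n), F.obj ⟨e / n, hi⟩ ⊆ F.obj ⟨l, hl⟩) ∨
  (e / n ≠ e % n ∧ ∃ (hi : e / n < n) (hj : e % n < n) (hl : l < n),
    ∃ p, (F.crossings ⟨e / n, hi⟩ ⟨e % n, hj⟩)[0]? = some p ∧ p ∈ F.obj ⟨l, hl⟩)

variable {F}

/-- The objects that take part in a constraint have a common point. -/
theorem exists_point_of_row (F : WeightedObjects n) (e : ℕ) :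
    ∃ p : Plane, ∀ l : Fin n, F.RowMem e l → p ∈ F.obj l := by
  by_cases hd : e / n = e % n
  · by_cases hi : e / n < n
    · obtain ⟨p, hp⟩ := (F.isJordanRegion ⟨e / n, hi⟩).nonempty
      refine ⟨p, fun l hl => ?_⟩
      rcases hl with ⟨-, _, _, h⟩ | ⟨h, -⟩
      · exact h hp
      · exact absurd hd h
    · refine ⟨0, fun l hl => ?_⟩
      rcases hl with ⟨-, h, -⟩ | ⟨-, h, -⟩ <;> exact absurd h hi
  · by_cases hex : ∃ (hi : e / n < n) (hj : e % n < n) (p : Plane),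
        (F.crossings ⟨e / n, hi⟩ ⟨e % n, hj⟩)[0]? = some p
    · obtain ⟨hi, hj, p, hp⟩ := hex
      refine ⟨p, fun l hl => ?_⟩
      rcases hl with ⟨h, -⟩ | ⟨-, _, _, _, p', hp', hl⟩
      · exact absurd h hd
      · rw [hp] at hp'
        cases hp'
        exact hl
    · refine ⟨0, fun l hl => ?_⟩
      rcases hl with ⟨h, -⟩ | ⟨-, hi, hj, _, p, hp, -⟩
      · exact absurd h hd
      · exact absurd ⟨hi, hj, p, hp⟩ hex

/-- Every object has a row of its own. Hence loads bound multiplicities, and costs never vanish. -/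
theorem rowMem_diag {l : ℕ} (hl : l < n) : F.RowMem (l * n + l) l := by
  have hn : 0 < n := by omega
  have h1 : (l * n + l) / n = l := by
    rw [Nat.mul_comm, Nat.mul_add_div hn, Nat.div_eq_of_lt hl, Nat.add_zero]
  have h2 : (l * n + l) % n = l := by
    rw [Nat.mul_comm, Nat.mul_add_mod, Nat.mod_eq_of_lt hl]
  refine Or.inl ⟨by rw [h1, h2], by rw [h1]; exact hl, hl, ?_⟩
  simp [h1]

theorem RowMem.lt {e l : ℕ} (h : F.RowMem e l) : l < n := by
  rcases h with ⟨-, -, h, -⟩ | ⟨-, -, -, h, -⟩ <;> exact h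

theorem diag_lt {l : ℕ} (hl : l < n) : l * n + l < n * n := by nlinarith

open Classical in
/-- The load of constraint `e` under the multiplicities `x`. -/
noncomputable def load (F : WeightedObjects n) (x : ℕ → ℕ) (e : ℕ) : ℕ :=
  ∑ l ∈ Finset.range n, if F.RowMem e l then x l else 0

open Classical in
/-- The cost of object `l`: the total weight of its constraints among the first `M`, where the
weight of a constraint is exponential in its load. -/
noncomputable def cost (F : WeightedObjects n) (M : ℕ) (x : ℕ → ℕ) (l : ℕ) : ℕ :=
  ∑ e ∈ Finset.range M, if F.RowMem e l then 2 ^ F.load x e else 0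

/-- The total weight of the first `M` constraints. -/
noncomputable def potential (F : WeightedObjects n) (M : ℕ) (x : ℕ → ℕ) : ℕ :=
  ∑ e ∈ Finset.range M, 2 ^ F.load x e

/-- The multiplicities `x`, with the one of `l` increased by `1`. -/
def raised (x : ℕ → ℕ) (l : ℕ) : ℕ → ℕ := Function.update x l (x l + 1)

open Classical in
theorem load_raised (x : ℕ → ℕ) (e l : ℕ) :
    F.load (raised x l) e = F.load x e + if F.RowMem e l then 1 else 0 := by
  by_cases hl : l < n
  · have hm : l ∈ Finset.range n := Finset.mem_range.2 hl
    rw [load, load, ← Finset.add_sum_erase _ _ hm, ← Finset.add_sum_erase (a := l) _ _ hm]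
    have : ∑ i ∈ (Finset.range n).erase l, (if F.RowMem e i then raised x l i else 0) =
        ∑ i ∈ (Finset.range n).erase l, if F.RowMem e i then x i else 0 := by
      refine Finset.sum_congr rfl fun i hi => ?_
      rw [raised, Function.update_of_ne (Finset.ne_of_mem_erase hi)]
    rw [this, raised, Function.update_self]
    split_ifs <;> omega
  · rw [if_neg fun h => hl h.lt, load, load, add_zero]
    refine Finset.sum_congr rfl fun i hi => ?_
    rw [raised, Function.update_of_ne]
    rintro rfl
    exact hl (Finset.mem_range.1 hi)

theorem load_le_load_raised (x : ℕ → ℕ) (e l : ℕ) : F.load x e ≤ F.load (raised x l) e := by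
  rw [load_raised]; exact Nat.le_add_right _ _

theorem cost_le_cost_raised (M : ℕ) (x : ℕ → ℕ) (l j : ℕ) :
    F.cost M x j ≤ F.cost M (raised x l) j := by
  classical
  refine Finset.sum_le_sum fun e _ => ?_
  split_ifs
  · exact Nat.pow_le_pow_right two_pos (load_le_load_raised x e l)
  · exact le_rfl

/-- A raise doubles exactly the weights of the rows of `l`, so the potential grows by their previous
total. -/
theorem potential_raised (M : ℕ) (x : ℕ → ℕ) (l : ℕ) :
    F.potential M (raised x l) = F.potential M x + F.cost M x l := by
  classical
  rw [potential, potential, cost, ← Finset.sum_add_distrib]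
  refine Finset.sum_congr rfl fun e _ => ?_
  rw [load_raised]
  split_ifs
  · rw [pow_succ]; ring
  · simp

theorem two_pow_load_le_cost {M : ℕ} {x : ℕ → ℕ} {e l : ℕ} (he : e < M) (h : F.RowMem e l) :
    2 ^ F.load x e ≤ F.cost M x l := by
  classical
  have := Finset.single_le_sum (f := fun e => if F.RowMem e l then 2 ^ F.load x e else 0)
    (fun _ _ => Nat.zero_le _) (Finset.mem_range.2 he)
  simpa [h, cost] using this

theorem cost_le_potential (M : ℕ) (x : ℕ → ℕ) (l : ℕ) : F.cost M x l ≤ F.potential M x := by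
  classical
  refine Finset.sum_le_sum fun e _ => ?_
  split_ifs
  · exact le_rfl
  · exact Nat.zero_le _

theorem le_load {x : ℕ → ℕ} {e l : ℕ} (h : F.RowMem e l) : x l ≤ F.load x e := by
  classical
  have := Finset.single_le_sum (f := fun l => if F.RowMem e l then x l else 0)
    (fun _ _ => Nat.zero_le _) (Finset.mem_range.2 h.lt)
  simpa [h, load] using this

theorem one_le_cost {M : ℕ} (hM : n * n ≤ M) (x : ℕ → ℕ) {l : ℕ} (hl : l < n) :
    1 ≤ F.cost M x l :=
  Nat.one_le_two_pow.trans (two_pow_load_le_cost ((diag_lt hl).trans_le hM) (rowMem_diag hl))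

/-- The costs of the objects of an independent set add up to at most the potential. -/
theorem Independent.sum_cost_le {S : Finset (Fin n)} (hS : F.Independent S) (M : ℕ) (x : ℕ → ℕ) :
    ∑ i ∈ S, F.cost M x i ≤ F.potential M x := by
  classical
  simp only [cost, potential]
  rw [Finset.sum_comm]
  refine Finset.sum_le_sum fun e _ => ?_
  rw [← Finset.sum_filter, Finset.sum_const, smul_eq_mul]
  refine Nat.mul_le_of_le_div _ _ _ ?_
  -- The objects of a row share a point, so each row is charged at most once.
  rw [Nat.div_self (by positivity), Finset.card_le_one]
  obtain ⟨p, hp⟩ := F.exists_point_of_row e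
  intro a ha b hb
  rw [Finset.mem_filter] at ha hb
  by_contra hab
  exact Set.disjoint_left.1 (hS a ha.1 b hb.1 hab) (hp a ha.2) (hp b hb.2)

/-- The total weight of the multiplicities `x`. -/
noncomputable def multWeight (F : WeightedObjects n) (x : ℕ → ℕ) : ℝ :=
  ∑ i ∈ Finset.range n, F.weightAt i * x i

theorem multWeight_raised (x : ℕ → ℕ) {l : ℕ} (hl : l < n) :
    F.multWeight (raised x l) = F.multWeight x + F.weightAt l := by
  have hm : l ∈ Finset.range n := Finset.mem_range.2 hl
  rw [multWeight, multWeight, ← Finset.add_sum_erase _ _ hm,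
    ← Finset.add_sum_erase (a := l) _ _ hm]
  have : ∑ i ∈ (Finset.range n).erase l, F.weightAt i * (raised x l i : ℝ) =
      ∑ i ∈ (Finset.range n).erase l, F.weightAt i * (x i : ℝ) := by
    refine Finset.sum_congr rfl fun i hi => ?_
    rw [raised, Function.update_of_ne (Finset.ne_of_mem_erase hi)]
  rw [this, raised, Function.update_self]
  push_cast
  ring

/-- The invariant of the multiplicative weights method in phase `k`. -/
structure MwuInvariant (F : WeightedObjects n) (M k : ℕ) (wmax : ℝ) (x : ℕ → ℕ) : Prop where
  load_le : ∀ e < M, F.load x e ≤ k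
  cost_ge : ∀ j < n, 2 ^ k * F.weightAt j ≤ 2 * (F.cost M x j * wmax)
  potential_le : (F.potential M x : ℝ) ≤ M * Real.exp (2 * F.multWeight x / F.opt)

theorem MwuInvariant.zero {M : ℕ} {wmax : ℝ} (hM : n * n ≤ M)
    (hw : ∀ j < n, F.weightAt j ≤ wmax) : F.MwuInvariant M 0 wmax fun _ => 0 where
  load_le e _ := by simp [load]
  cost_ge j hj := by
    have h1 : (1 : ℝ) ≤ F.cost M (fun _ => 0) j := by exact_mod_cast one_le_cost hM _ hj
    have h2 := hw j hj
    have h3 := F.weightAt_pos hj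
    nlinarith
  potential_le := by simp [potential, load, multWeight]

/-- Raising an object whose cost is below the threshold of the phase preserves the invariant. -/
theorem MwuInvariant.raised {M k : ℕ} {wmax : ℝ} {x : ℕ → ℕ} (h : F.MwuInvariant M k wmax x)
    (hw : ∀ j < n, F.weightAt j ≤ wmax) {l : ℕ} (hl : l < n)
    (hlt : F.cost M x l * wmax < 2 ^ k * F.weightAt l) :
    F.MwuInvariant M k wmax (raised x l) := by
  classical
  have hwl := F.weightAt_pos hl
  have hwm : 0 < wmax := hwl.trans_le (hw l hl)
  -- Below the threshold no row of `l` has reached load `k`, so one more unit is allowed.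
  have hlk : (F.cost M x l : ℝ) < 2 ^ k := by
    by_contra hcon
    rw [not_lt] at hcon
    have := mul_le_mul hcon (hw l hl) hwl.le (by positivity)
    linarith
  refine ⟨fun e he => ?_, fun j hj => ?_, ?_⟩
  · rw [load_raised]
    split_ifs with hr
    · have h1 : 2 ^ F.load x e < 2 ^ k :=
        (two_pow_load_le_cost he hr).trans_lt (by exact_mod_cast hlk)
      exact (Nat.pow_lt_pow_iff_right one_lt_two).1 h1
    · exact h.load_le e he
  · refine (h.cost_ge j hj).trans ?_
    have : (F.cost M x j : ℝ) ≤ F.cost M (WeightedObjects.raised x l) j := by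
      exact_mod_cast cost_le_cost_raised M x l j
    gcongr
  · have hopt : 0 < F.opt := by
      have := F.weight_le_opt ⟨l, hl⟩
      exact (F.weight_pos _).trans_le this
    -- The cost of `l` per unit of weight is below `2 ^ k / wmax`, hence at most twice that of any
    -- other object. Summing over an independent set, whose costs add up to at most the potential,
    -- shows that the potential grows by a factor of at most `1 + 2 * F.weightAt l / F.opt`.
    have hc : (F.cost M x l : ℝ) * F.opt ≤ 2 * F.weightAt l * F.potential M x := by
      rcases Nat.eq_zero_or_pos (F.cost M x l) with h0 | h0
      · rw [h0]; simp; positivity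
      · have h0' : (0 : ℝ) < F.cost M x l := by exact_mod_cast h0
        rw [mul_comm, ← le_div_iff₀ h0']
        refine opt_le_of_forall fun S hS => ?_
        rw [le_div_iff₀ h0', totalWeight, Finset.sum_mul]
        have hsum : (∑ i ∈ S, (F.cost M x i : ℝ)) ≤ F.potential M x := by
          exact_mod_cast hS.sum_cost_le M x
        calc ∑ i ∈ S, F.weight i * (F.cost M x l : ℝ)
            ≤ ∑ i ∈ S, 2 * F.weightAt l * (F.cost M x i : ℝ) := by
              refine Finset.sum_le_sum fun i _ => ?_
              have h1 := h.cost_ge i i.2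
              rw [weightAt_coe] at h1
              have h2 := F.weight_pos i
              have h3 : F.weight i * F.cost M x l * (wmax * 2 ^ k) ≤
                  2 * F.weightAt l * F.cost M x i * (wmax * 2 ^ k) := by
                calc F.weight i * F.cost M x l * (wmax * 2 ^ k)
                    = (2 ^ k * F.weight i) * (F.cost M x l * wmax) := by ring
                  _ ≤ (2 * (F.cost M x i * wmax)) * (2 ^ k * F.weightAt l) :=
                      mul_le_mul h1 hlt.le (by positivity) (by positivity)
                  _ = _ := by ring
              exact le_of_mul_le_mul_right h3 (by positivity)
          _ = 2 * F.weightAt l * ∑ i ∈ S, (F.cost M x i : ℝ) := by rw [Finset.mul_sum]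
          _ ≤ 2 * F.weightAt l * F.potential M x := by gcongr
    rw [potential_raised, multWeight_raised x hl]
    push_cast
    have hP : (0 : ℝ) ≤ F.potential M x := Nat.cast_nonneg _
    calc (F.potential M x : ℝ) + F.cost M x l
        ≤ F.potential M x * (2 * F.weightAt l / F.opt + 1) := by
          have : (F.cost M x l : ℝ) ≤ 2 * F.weightAt l * F.potential M x / F.opt := by
            rwa [le_div_iff₀ hopt]
          calc _ ≤ (F.potential M x : ℝ) + 2 * F.weightAt l * F.potential M x / F.opt := by linarith
            _ = _ := by ring
      _ ≤ F.potential M x * Real.exp (2 * F.weightAt l / F.opt) :=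
          mul_le_mul_of_nonneg_left (Real.add_one_le_exp _) hP
      _ ≤ M * Real.exp (2 * F.multWeight x / F.opt) * Real.exp (2 * F.weightAt l / F.opt) :=
          mul_le_mul_of_nonneg_right h.potential_le (Real.exp_pos _).le
      _ = _ := by rw [mul_assoc, ← Real.exp_add]; congr 2; ring

/-- Once no object is below the threshold, the factor 2 allowed in `cost_ge` is unused and pays for
doubling the threshold. -/
theorem MwuInvariant.next {M k : ℕ} {wmax : ℝ} {x : ℕ → ℕ} (h : F.MwuInvariant M k wmax x)
    (hc : ∀ j < n, 2 ^ k * F.weightAt j ≤ F.cost M x j * wmax) :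
    F.MwuInvariant M (k + 1) wmax x where
  load_le e he := (h.load_le e he).trans (Nat.le_succ k)
  cost_ge j hj := by have := hc j hj; rw [pow_succ]; linarith
  potential_le := h.potential_le

/-- After the last phase, the multiplicities form a near-optimal fractional packing. -/
theorem MwuInvariant.opt_le {M T : ℕ} {wmax : ℝ} {x : ℕ → ℕ}
    (h : F.MwuInvariant M (T + 1) wmax x) {j : ℕ} (hj : j < n) (hw : F.weightAt j = wmax)
    (hMT : M ^ 2 ≤ 2 ^ T) (hM : 0 < M) : F.opt * T ≤ 8 * F.multWeight x := by
  have hwm : 0 < wmax := hw ▸ F.weightAt_pos hj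
  have hopt : 0 < F.opt := (F.weight_pos _).trans_le (F.weight_le_opt ⟨j, hj⟩)
  have h1 : (2 : ℝ) ^ T ≤ F.potential M x := by
    have h2 := h.cost_ge j hj
    rw [hw, pow_succ] at h2
    have h3 : (2 : ℝ) ^ T ≤ F.cost M x j := by nlinarith
    exact h3.trans (by exact_mod_cast cost_le_potential M x j)
  have h2 := h1.trans h.potential_le
  have hM' : (0 : ℝ) < M := by exact_mod_cast hM
  -- Logarithms of `2 ^ T ≤ M * exp (2 * F.multWeight x / F.opt)`. Since `M ^ 2 ≤ 2 ^ T`, the term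
  -- `log M` takes at most half of the left side, and `log 2 > 1 / 2` leads to the constant 8.
  have h3 : (T : ℝ) * Real.log 2 ≤ Real.log M + 2 * F.multWeight x / F.opt := by
    have := Real.log_le_log (by positivity) h2
    rwa [Real.log_pow, Real.log_mul hM'.ne' (Real.exp_pos _).ne', Real.log_exp] at this
  have h4 : 2 * Real.log M ≤ T * Real.log 2 := by
    have : ((M : ℝ)) ^ 2 ≤ 2 ^ T := by exact_mod_cast hMT
    have := Real.log_le_log (by positivity) this
    rwa [Real.log_pow, Real.log_pow] at this
  have h5 := Real.log_two_gt_d9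
  have hT : (0 : ℝ) ≤ T := Nat.cast_nonneg T
  have h6 : (T : ℝ) ≤ 8 * F.multWeight x / F.opt := by
    have : 8 * F.multWeight x / F.opt = 4 * (2 * F.multWeight x / F.opt) := by ring
    rw [this]
    nlinarith
  rw [le_div_iff₀ hopt] at h6
  linarith

theorem load_eq_sum (F : WeightedObjects n) (x : ℕ → ℕ) (e : ℕ) [DecidablePred (F.RowMem e)] :
    F.load x e = ∑ l : Fin n, if F.RowMem e l then x l else 0 := by
  rw [load, Finset.sum_range]
  refine Finset.sum_congr rfl fun l _ => ?_
  congr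

/-- Multiplicities with bounded loads give a fractional packing. -/
theorem fractionalPacking_of_load_le {x : ℕ → ℕ} {T : ℕ} (hT : 0 < T)
    (h : ∀ e < n * n, F.load x e ≤ T) : F.FractionalPacking fun i => (x i : ℝ) / T := by
  classical
  have hT' : (0 : ℝ) < T := by exact_mod_cast hT
  have hrow : ∀ e < n * n, ∀ A : Finset (Fin n), (∀ l ∈ A, F.RowMem e l) →
      ∑ l ∈ A, (x l : ℝ) / T ≤ 1 := by
    intro e he A hA
    rw [← Finset.sum_div, div_le_one hT']
    have h1 : ∑ l ∈ A, x l ≤ F.load x e := by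
      rw [load_eq_sum, ← Finset.sum_filter]
      exact Finset.sum_le_sum_of_subset fun l hl => by simp [hA l hl]
    exact_mod_cast h1.trans (h e he)
  refine ⟨fun i => by positivity, fun i => ?_, fun i j hij hne => ?_, fun i => ?_⟩
  · have := hrow _ (diag_lt i.2) {i} (by simpa using rowMem_diag i.2)
    simpa using this
  · have hn : 0 < n := i.pos
    obtain ⟨p₀, hp₀⟩ := hne
    have hmem := (F.mem_crossings i j hij p₀).2 hp₀
    -- A packing needs only one well-covered common boundary point per pair; the row uses the head
    -- of the list.
    obtain ⟨p, L, hL⟩ := List.exists_cons_of_ne_nil (List.ne_nil_of_mem hmem)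
    refine ⟨p, (F.mem_crossings i j hij p).1 (hL ▸ List.mem_cons_self), ?_⟩
    have h1 : ((i : ℕ) * n + j) / n = i := by
      rw [Nat.mul_comm, Nat.mul_add_div hn, Nat.div_eq_of_lt j.2, Nat.add_zero]
    have h2 : ((i : ℕ) * n + j) % n = j := by
      rw [Nat.mul_comm, Nat.mul_add_mod, Nat.mod_eq_of_lt j.2]
    refine hrow (i * n + j) (by nlinarith [i.2, j.2]) _ fun l hl => ?_
    refine Or.inr ⟨by rw [h1, h2]; exact Fin.val_ne_of_ne hij, by rw [h1]; exact i.2,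
      by rw [h2]; exact j.2, l.2, p, ?_, (Finset.mem_filter.1 hl).2⟩
    simp [h1, h2, hL]
  · refine hrow _ (diag_lt i.2) _ fun l hl => ?_
    have hn : 0 < n := i.pos
    have h1 : ((i : ℕ) * n + i) / n = i := by
      rw [Nat.mul_comm, Nat.mul_add_div hn, Nat.div_eq_of_lt i.2, Nat.add_zero]
    have h2 : ((i : ℕ) * n + i) % n = i := by
      rw [Nat.mul_comm, Nat.mul_add_mod, Nat.mod_eq_of_lt i.2]
    refine Or.inl ⟨by rw [h1, h2], by rw [h1]; exact i.2, l.2, ?_⟩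
    have := (Finset.mem_filter.1 hl).2.1
    simpa [h1] using this

/-! ### Rounding by the local ratio method -/

open Classical in
/-- `t` is an extraction order. Each object receives the part `α i` of its weight that is not yet
taken by earlier objects that intersect it; `S` is chosen greedily in the reverse order among the
objects with `0 < α i`. Then the weight of `S` is comparable to that of any fractional solution
with small resistances along the order. -/
theorem localRatio_le {t : Fin n → ℕ} {α z : Fin n → ℝ} {S : Finset (Fin n)} {ρ : ℝ}
    (hα : ∀ i, 0 ≤ α i)
    (hw : ∀ i, F.weight i ≤
      α i + ∑ j with t j < t i ∧ (F.obj i ∩ F.obj j).Nonempty, α j)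
    (hw' : ∀ i, 0 < α i → F.weight i =
      α i + ∑ j with t j < t i ∧ (F.obj i ∩ F.obj j).Nonempty, α j)
    (hS : ∀ i ∈ S, 0 < α i)
    (hS' : ∀ i, 0 < α i → i ∈ S ∨ ∃ j ∈ S, t i < t j ∧ (F.obj i ∩ F.obj j).Nonempty)
    (hz0 : ∀ i, 0 ≤ z i) (hz1 : ∀ i, z i ≤ 1)
    (hρ : ∀ i, ∑ j with t i < t j ∧ (F.obj i ∩ F.obj j).Nonempty, z j ≤ ρ) :
    F.lpValue z ≤ (1 + ρ) * F.totalWeight S := by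
  have hswap : ∀ (f g : Fin n → ℝ),
      ∑ i, f i * ∑ j with t j < t i ∧ (F.obj i ∩ F.obj j).Nonempty, g j =
        ∑ j, g j * ∑ i with t j < t i ∧ (F.obj j ∩ F.obj i).Nonempty, f i := by
    intro f g
    simp only [Finset.mul_sum, Finset.sum_filter]
    rw [Finset.sum_comm]
    refine Finset.sum_congr rfl fun j _ => Finset.sum_congr rfl fun i _ => ?_
    rw [Set.inter_comm]
    split_ifs <;> ring
  -- Expanding the weights of `S` counts `α i` once for every member of `S` that is `i` or a later
  -- neighbour of `i`. By `hS'` each positive `α i` is counted at least once.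
  have h1 : ∑ i, α i ≤ F.totalWeight S := by
    set χ : Fin n → ℝ := fun i => if i ∈ S then 1 else 0 with hχ
    have hχ0 : ∀ i, 0 ≤ χ i := fun i => by simp only [hχ]; split_ifs <;> norm_num
    have he : F.totalWeight S = ∑ i, χ i * F.weight i := by simp [hχ, totalWeight]
    have he' : ∑ i, χ i * F.weight i = ∑ i, χ i *
        (α i + ∑ j with t j < t i ∧ (F.obj i ∩ F.obj j).Nonempty, α j) := by
      refine Finset.sum_congr rfl fun i _ => ?_
      by_cases hi : i ∈ S
      · rw [hw' i (hS i hi)]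
      · simp [hχ, hi]
    rw [he, he']
    simp only [mul_add, Finset.sum_add_distrib]
    rw [hswap, ← Finset.sum_add_distrib]
    refine Finset.sum_le_sum fun i _ => ?_
    have hs0 : 0 ≤ ∑ j with t i < t j ∧ (F.obj i ∩ F.obj j).Nonempty, χ j :=
      Finset.sum_nonneg fun j _ => hχ0 j
    rcases (hα i).eq_or_lt with h0 | h0
    · rw [← h0]; simp
    · rcases hS' i h0 with hi | ⟨j, hj, hij⟩
      · have : χ i = 1 := by simp [hχ, hi]
        rw [this]
        nlinarith
      · have : 1 ≤ ∑ j with t i < t j ∧ (F.obj i ∩ F.obj j).Nonempty, χ j := by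
          have h2 := Finset.single_le_sum (f := χ) (fun j _ => hχ0 j)
            (Finset.mem_filter.2 ⟨Finset.mem_univ j, hij⟩ :
              j ∈ Finset.univ.filter fun j => t i < t j ∧ (F.obj i ∩ F.obj j).Nonempty)
          simpa [hχ, hj] using h2
        nlinarith [hχ0 i]
  -- The same expansion for `z` counts `α i` with multiplicity `z i` plus the value of the later
  -- neighbours, at most `1 + ρ`.
  have h2 : F.lpValue z ≤ ∑ i, α i * (1 + ρ) := by
    calc F.lpValue z ≤ ∑ i, z i *
        (α i + ∑ j with t j < t i ∧ (F.obj i ∩ F.obj j).Nonempty, α j) := by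
          refine Finset.sum_le_sum fun i _ => ?_
          rw [mul_comm]
          exact mul_le_mul_of_nonneg_left (hw i) (hz0 i)
      _ = ∑ i, α i * (z i + ∑ j with t i < t j ∧ (F.obj i ∩ F.obj j).Nonempty, z j) := by
          simp only [mul_add, Finset.sum_add_distrib]
          rw [hswap]
          congr 1
          exact Finset.sum_congr rfl fun i _ => mul_comm _ _
      _ ≤ ∑ i, α i * (1 + ρ) := Finset.sum_le_sum fun i _ =>
          mul_le_mul_of_nonneg_left (add_le_add (hz1 i) (hρ i)) (hα i)
  rw [← Finset.sum_mul] at h2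
  rcases isEmpty_or_nonempty (Fin n) with hn | ⟨⟨i⟩⟩
  · have : S = ∅ := Finset.eq_empty_of_isEmpty S
    simp [lpValue, totalWeight, this]
  · have hρ0 : 0 ≤ ρ := (Finset.sum_nonneg fun j _ => hz0 j).trans (hρ i)
    nlinarith
end WeightedObjects

/-! ### Execution of deterministic programs -/

namespace Mem

/-- Assign a natural variable. -/
def setN (s : Mem) (x v : ℕ) : Mem := { s with nvar := Function.update s.nvar x v }

/-- Assign a real variable. -/
def setR (s : Mem) (x : ℕ) (v : ℝ) : Mem := { s with rvar := Function.update s.rvar x v }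

/-- Assign an entry of a natural array. -/
def storeN (s : Mem) (a i v : ℕ) : Mem :=
  { s with narr := Function.update s.narr a (Function.update (s.narr a) i v) }

/-- Assign an entry of a real array. -/
def storeR (s : Mem) (a i : ℕ) (v : ℝ) : Mem :=
  { s with rarr := Function.update s.rarr a (Function.update (s.rarr a) i v) }

variable (s : Mem) (x a i v y b : ℕ) (r : ℝ)

@[simp] theorem nvar_setN : (s.setN x v).nvar y = if y = x then v else s.nvar y := by
  simp [setN, Function.update_apply]
@[simp] theorem rvar_setN : (s.setN x v).rvar = s.rvar := rfl
@[simp] theorem narr_setN : (s.setN x v).narr = s.narr := rfl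
@[simp] theorem rarr_setN : (s.setN x v).rarr = s.rarr := rfl
@[simp] theorem nvar_setR : (s.setR x r).nvar = s.nvar := rfl
@[simp] theorem rvar_setR : (s.setR x r).rvar y = if y = x then r else s.rvar y := by
  simp [setR, Function.update_apply]
@[simp] theorem narr_setR : (s.setR x r).narr = s.narr := rfl
@[simp] theorem rarr_setR : (s.setR x r).rarr = s.rarr := rfl
@[simp] theorem nvar_storeN : (s.storeN a i v).nvar = s.nvar := rfl
@[simp] theorem rvar_storeN : (s.storeN a i v).rvar = s.rvar := rfl
@[simp] theorem narr_storeN : (s.storeN a i v).narr b =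
    if b = a then Function.update (s.narr a) i v else s.narr b := by
  by_cases h : b = a
  · subst h; simp [storeN]
  · simp [storeN, h]
@[simp] theorem rarr_storeN : (s.storeN a i v).rarr = s.rarr := rfl
@[simp] theorem nvar_storeR : (s.storeR a i r).nvar = s.nvar := rfl
@[simp] theorem rvar_storeR : (s.storeR a i r).rvar = s.rvar := rfl
@[simp] theorem narr_storeR : (s.storeR a i r).narr = s.narr := rfl
@[simp] theorem rarr_storeR : (s.storeR a i r).rarr b =
    if b = a then Function.update (s.rarr a) i r else s.rarr b := by
  by_cases h : b = a
  · subst h; simp [storeR]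
  · simp [storeR, h]

end Mem

section Logic

variable {n : ℕ} (F : WeightedObjects n)

/-- `Exec F c s t s'`: the command `c`, started with memory `s`, halts after exactly `t` steps with
memory `s'`, without flipping coins. -/
inductive Exec : Cmd → Mem → ℕ → Mem → Prop
  | skip (s : Mem) : Exec .skip s 1 s
  | setN (x : ℕ) (e : NExpr) (s : Mem) : Exec (.setN x e) s 1 (s.setN x (e.eval F s))
  | setR (x : ℕ) (e : RExpr) (s : Mem) : Exec (.setR x e) s 1 (s.setR x (e.eval F s))
  | storeN (a : ℕ) (i e : NExpr) (s : Mem) :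
      Exec (.storeN a i e) s 1 (s.storeN a (i.eval F s) (e.eval F s))
  | storeR (a : ℕ) (i : NExpr) (e : RExpr) (s : Mem) :
      Exec (.storeR a i e) s 1 (s.storeR a (i.eval F s) (e.eval F s))
  | seq {c₁ c₂ : Cmd} {s s₁ s₂ : Mem} {t₁ t₂ : ℕ} (h₁ : Exec c₁ s t₁ s₁) (h₂ : Exec c₂ s₁ t₂ s₂) :
      Exec (.seq c₁ c₂) s (t₁ + t₂ + 1) s₂
  | iteTrue {b : BExpr} {c₁ c₂ : Cmd} {s s' : Mem} {t : ℕ} (hb : b.holds F s)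
      (h : Exec c₁ s t s') : Exec (.ite b c₁ c₂) s (t + 1) s'
  | iteFalse {b : BExpr} {c₁ c₂ : Cmd} {s s' : Mem} {t : ℕ} (hb : ¬ b.holds F s)
      (h : Exec c₂ s t s') : Exec (.ite b c₁ c₂) s (t + 1) s'
  | loopTrue {b : BExpr} {c : Cmd} {s s₁ s₂ : Mem} {t₁ t₂ : ℕ} (hb : b.holds F s)
      (h₁ : Exec c s t₁ s₁) (h₂ : Exec (.loop b c) s₁ t₂ s₂) :
      Exec (.loop b c) s (t₁ + t₂ + 1) s₂
  | loopFalse {b : BExpr} {c : Cmd} {s : Mem} (hb : ¬ b.holds F s) : Exec (.loop b c) s 1 s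

theorem runFor_add (a b : ℕ) (cfg : Config) :
    runFor F (a + b) cfg = (runFor F a cfg).bind (runFor F b) := by
  induction a generalizing cfg with
  | zero => simp [runFor]
  | succ a ih =>
    rw [Nat.succ_add, runFor, runFor, PMF.bind_bind]
    congr 1
    funext cfg'
    exact ih cfg'

theorem runFor_nil (t : ℕ) (s : Mem) : runFor F t ([], s) = PMF.pure ([], s) := by
  induction t with
  | zero => rfl
  | succ t ih => rw [runFor, step, PMF.pure_bind, ih]

variable {F}

theorem runFor_one_add {t : ℕ} {cfg cfg' : Config} (h : step F cfg = PMF.pure cfg') :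
    runFor F (t + 1) cfg = runFor F t cfg' := by
  rw [runFor, h, PMF.pure_bind]

/-- Transfers a coin-free derivation to the probabilistic machine, where the distribution is a point
mass. The remaining stack `k` is arbitrary because the induction through `seq` and `loop` extends
it. -/
theorem Exec.runFor_eq {c : Cmd} {s s' : Mem} {t : ℕ} (h : Exec F c s t s') (k : List Cmd) :
    runFor F t (c :: k, s) = PMF.pure (k, s') := by
  induction h generalizing k with
  | skip s => rw [runFor_one_add (by rw [step])]; rfl
  | setN x e s => rw [runFor_one_add (by rw [step])]; rfl
  | setR x e s => rw [runFor_one_add (by rw [step])]; rfl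
  | storeN a i e s => rw [runFor_one_add (by rw [step])]; rfl
  | storeR a i e s => rw [runFor_one_add (by rw [step])]; rfl
  | seq h₁ h₂ ih₁ ih₂ =>
    rw [runFor_one_add (by rw [step]), runFor_add, ih₁, PMF.pure_bind, ih₂]
  | iteTrue hb h ih => rw [runFor_one_add (by rw [step, if_pos hb]), ih]
  | iteFalse hb h ih => rw [runFor_one_add (by rw [step, if_neg hb]), ih]
  | loopTrue hb h₁ h₂ ih₁ ih₂ =>
    rw [runFor_one_add (by rw [step, if_pos hb]), runFor_add, ih₁, PMF.pure_bind, ih₂]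
  | loopFalse hb => rw [runFor_one_add (by rw [step, if_neg hb])]; rfl

theorem Exec.execute_eq {P : Cmd} {s : Mem} {t t' : ℕ} (h : Exec F P (initMem F) t s)
    (ht : t ≤ t') : execute P F t' = PMF.pure ([], s) := by
  obtain ⟨d, rfl⟩ := Nat.exists_eq_add_of_le ht
  rw [execute, runFor_add, h.runFor_eq, PMF.pure_bind, runFor_nil]

/-! #### Frames -/

/-- The natural variables that a command may assign. -/
def Cmd.modN : Cmd → List ℕ
  | .setN x _ => [x]
  | .flip x _ => [x]
  | .seq c₁ c₂ => c₁.modN ++ c₂.modN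
  | .ite _ c₁ c₂ => c₁.modN ++ c₂.modN
  | .loop _ c => c.modN
  | _ => []

/-- The real variables that a command may assign. -/
def Cmd.modR : Cmd → List ℕ
  | .setR x _ => [x]
  | .seq c₁ c₂ => c₁.modR ++ c₂.modR
  | .ite _ c₁ c₂ => c₁.modR ++ c₂.modR
  | .loop _ c => c.modR
  | _ => []

/-- The natural arrays that a command may modify. -/
def Cmd.modNA : Cmd → List ℕ
  | .storeN a _ _ => [a]
  | .seq c₁ c₂ => c₁.modNA ++ c₂.modNA
  | .ite _ c₁ c₂ => c₁.modNA ++ c₂.modNA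
  | .loop _ c => c.modNA
  | _ => []

/-- The real arrays that a command may modify. -/
def Cmd.modRA : Cmd → List ℕ
  | .storeR a _ _ => [a]
  | .seq c₁ c₂ => c₁.modRA ++ c₂.modRA
  | .ite _ c₁ c₂ => c₁.modRA ++ c₂.modRA
  | .loop _ c => c.modRA
  | _ => []

/-- The memories `s` and `s'` agree on everything that `c` cannot modify. -/
structure Frame (c : Cmd) (s s' : Mem) : Prop where
  nvar : ∀ x, x ∉ c.modN → s'.nvar x = s.nvar x
  rvar : ∀ x, x ∉ c.modR → s'.rvar x = s.rvar x
  narr : ∀ a, a ∉ c.modNA → s'.narr a = s.narr a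
  rarr : ∀ a, a ∉ c.modRA → s'.rarr a = s.rarr a

theorem Frame.rfl (c : Cmd) (s : Mem) : Frame c s s :=
  ⟨fun _ _ => Eq.refl _, fun _ _ => Eq.refl _, fun _ _ => Eq.refl _, fun _ _ => Eq.refl _⟩

theorem Frame.trans {c : Cmd} {s₁ s₂ s₃ : Mem} (h : Frame c s₁ s₂) (h' : Frame c s₂ s₃) :
    Frame c s₁ s₃ :=
  ⟨fun x hx => (h'.nvar x hx).trans (h.nvar x hx), fun x hx => (h'.rvar x hx).trans (h.rvar x hx),
    fun x hx => (h'.narr x hx).trans (h.narr x hx), fun x hx => (h'.rarr x hx).trans (h.rarr x hx)⟩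

theorem Frame.mono {c c' : Cmd} {s s' : Mem} (h : Frame c s s') (hN : c.modN ⊆ c'.modN)
    (hR : c.modR ⊆ c'.modR) (hNA : c.modNA ⊆ c'.modNA) (hRA : c.modRA ⊆ c'.modRA) :
    Frame c' s s' :=
  ⟨fun x hx => h.nvar x fun h => hx (hN h), fun x hx => h.rvar x fun h => hx (hR h),
    fun x hx => h.narr x fun h => hx (hNA h), fun x hx => h.rarr x fun h => hx (hRA h)⟩

theorem Frame.seq_left {c₁ c₂ : Cmd} {s s' : Mem} (h : Frame c₁ s s') : Frame (.seq c₁ c₂) s s' :=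
  h.mono (List.subset_append_left _ _) (List.subset_append_left _ _)
    (List.subset_append_left _ _) (List.subset_append_left _ _)

theorem Frame.seq_right {c₁ c₂ : Cmd} {s s' : Mem} (h : Frame c₂ s s') : Frame (.seq c₁ c₂) s s' :=
  h.mono (List.subset_append_right _ _) (List.subset_append_right _ _)
    (List.subset_append_right _ _) (List.subset_append_right _ _)

/-- The lists of assigned names are syntactic, so that a variable is unchanged can later be settled
by `decide`. -/
theorem Exec.frame {c : Cmd} {s s' : Mem} {t : ℕ} (h : Exec F c s t s') : Frame c s s' := by
  induction h with
  | skip s => exact Frame.rfl _ s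
  | setN x e s =>
    refine ⟨fun y hy => ?_, fun _ _ => rfl, fun _ _ => rfl, fun _ _ => rfl⟩
    rw [Mem.nvar_setN, if_neg fun h => hy (by rw [h]; exact List.mem_singleton_self _)]
  | setR x e s =>
    refine ⟨fun _ _ => rfl, fun y hy => ?_, fun _ _ => rfl, fun _ _ => rfl⟩
    rw [Mem.rvar_setR, if_neg fun h => hy (by rw [h]; exact List.mem_singleton_self _)]
  | storeN a i e s =>
    refine ⟨fun _ _ => rfl, fun _ _ => rfl, fun y hy => ?_, fun _ _ => rfl⟩
    rw [Mem.narr_storeN, if_neg fun h => hy (by rw [h]; exact List.mem_singleton_self _)]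
  | storeR a i e s =>
    refine ⟨fun _ _ => rfl, fun _ _ => rfl, fun _ _ => rfl, fun y hy => ?_⟩
    rw [Mem.rarr_storeR, if_neg fun h => hy (by rw [h]; exact List.mem_singleton_self _)]
  | seq h₁ h₂ ih₁ ih₂ => exact ih₁.seq_left.trans ih₂.seq_right
  | iteTrue hb h ih =>
    exact ih.mono (List.subset_append_left _ _) (List.subset_append_left _ _)
      (List.subset_append_left _ _) (List.subset_append_left _ _)
  | iteFalse hb h ih =>
    exact ih.mono (List.subset_append_right _ _) (List.subset_append_right _ _)
      (List.subset_append_right _ _) (List.subset_append_right _ _)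
  | loopTrue hb h₁ h₂ ih₁ ih₂ =>
    exact Frame.trans (ih₁.mono (fun _ h => h) (fun _ h => h) (fun _ h => h) fun _ h => h) ih₂
  | loopFalse hb => exact Frame.rfl _ _

/-! #### Total correctness with running time -/

variable (F)

/-- The command `c`, started with memory `s`, halts without flipping coins, and the number of steps
and the final memory satisfy `Q`. -/
def Halts (c : Cmd) (s : Mem) (Q : ℕ → Mem → Prop) : Prop := ∃ t s', Exec F c s t s' ∧ Q t s'

variable {F} {c c₁ c₂ : Cmd} {s : Mem} {Q Q' : ℕ → Mem → Prop}

theorem Halts.mono (h : Halts F c s Q) (hQ : ∀ t s', Frame c s s' → Q t s' → Q' t s') :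
    Halts F c s Q' := by
  obtain ⟨t, s', he, hq⟩ := h
  exact ⟨t, s', he, hQ t s' he.frame hq⟩

-- These equivalences form a weakest-precondition calculus: simplification runs straight-line code
-- symbolically and keeps count of the steps.
@[simp] theorem halts_skip : Halts F .skip s Q ↔ Q 1 s :=
  ⟨fun ⟨_, _, he, hq⟩ => by cases he; exact hq, fun h => ⟨_, _, .skip s, h⟩⟩

@[simp] theorem halts_setN {x : ℕ} {e : NExpr} :
    Halts F (.setN x e) s Q ↔ Q 1 (s.setN x (e.eval F s)) :=
  ⟨fun ⟨_, _, he, hq⟩ => by cases he; exact hq, fun h => ⟨_, _, .setN x e s, h⟩⟩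

@[simp] theorem halts_setR {x : ℕ} {e : RExpr} :
    Halts F (.setR x e) s Q ↔ Q 1 (s.setR x (e.eval F s)) :=
  ⟨fun ⟨_, _, he, hq⟩ => by cases he; exact hq, fun h => ⟨_, _, .setR x e s, h⟩⟩

@[simp] theorem halts_storeN {a : ℕ} {i e : NExpr} :
    Halts F (.storeN a i e) s Q ↔ Q 1 (s.storeN a (i.eval F s) (e.eval F s)) :=
  ⟨fun ⟨_, _, he, hq⟩ => by cases he; exact hq, fun h => ⟨_, _, .storeN a i e s, h⟩⟩

@[simp] theorem halts_storeR {a : ℕ} {i : NExpr} {e : RExpr} :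
    Halts F (.storeR a i e) s Q ↔ Q 1 (s.storeR a (i.eval F s) (e.eval F s)) :=
  ⟨fun ⟨_, _, he, hq⟩ => by cases he; exact hq, fun h => ⟨_, _, .storeR a i e s, h⟩⟩

@[simp] theorem halts_seq :
    Halts F (.seq c₁ c₂) s Q ↔
      Halts F c₁ s fun t₁ s₁ => Halts F c₂ s₁ fun t₂ s₂ => Q (t₁ + t₂ + 1) s₂ := by
  constructor
  · rintro ⟨_, _, he, hq⟩
    cases he with
    | seq h₁ h₂ => exact ⟨_, _, h₁, _, _, h₂, hq⟩
  · rintro ⟨_, _, h₁, _, _, h₂, hq⟩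
    exact ⟨_, _, .seq h₁ h₂, hq⟩

@[simp] theorem halts_ite {b : BExpr} :
    Halts F (.ite b c₁ c₂) s Q ↔
      (b.holds F s → Halts F c₁ s fun t s' => Q (t + 1) s') ∧
      (¬ b.holds F s → Halts F c₂ s fun t s' => Q (t + 1) s') := by
  constructor
  · rintro ⟨_, _, he, hq⟩
    cases he with
    | iteTrue hb h => exact ⟨fun _ => ⟨_, _, h, hq⟩, fun h' => absurd hb h'⟩
    | iteFalse hb h => exact ⟨fun h' => absurd h' hb, fun _ => ⟨_, _, h, hq⟩⟩
  · rintro ⟨h₁, h₂⟩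
    by_cases hb : b.holds F s
    · obtain ⟨_, _, h, hq⟩ := h₁ hb
      exact ⟨_, _, .iteTrue hb h, hq⟩
    · obtain ⟨_, _, h, hq⟩ := h₂ hb
      exact ⟨_, _, .iteFalse hb h, hq⟩

/-- The rule for loops, with an invariant that involves the elapsed time and a variant. -/
theorem Halts.loop {b : BExpr} (I : ℕ → Mem → Prop) (μ : Mem → ℕ) (h0 : I 0 s)
    (hstep : ∀ t s', Frame c s s' → I t s' → b.holds F s' →
      Halts F c s' fun t' s'' => I (t + t' + 1) s'' ∧ μ s'' < μ s')
    (hQ : ∀ t s', Frame c s s' → I t s' → ¬ b.holds F s' → Q (t + 1) s') :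
    Halts F (.loop b c) s Q := by
  have key : ∀ (m t : ℕ) (s' : Mem), μ s' = m → Frame c s s' → I t s' →
      Halts F (.loop b c) s' fun t' s'' => Q (t + t') s'' := by
    intro m
    induction m using Nat.strong_induction_on with
    | _ m ih =>
      intro t s' hm hf hI
      by_cases hb : b.holds F s'
      · obtain ⟨t₁, s₁, he, hI₁, hμ⟩ := hstep t s' hf hI hb
        obtain ⟨t₂, s₂, he₂, hq⟩ :=
          ih (μ s₁) (hm ▸ hμ) (t + t₁ + 1) s₁ rfl (hf.trans he.frame) hI₁
        refine ⟨_, _, .loopTrue hb he he₂, ?_⟩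
        have : t + (t₁ + t₂ + 1) = t + t₁ + 1 + t₂ := by omega
        simpa only [this] using hq
      · exact ⟨1, s', .loopFalse hb, hQ t s' hf hI hb⟩
  have := key (μ s) 0 s rfl (Frame.rfl c s) h0
  simpa using this

/-- `for x := 0 to bnd - 1 do c`, where `x` and `bnd` are natural variables. -/
def Cmd.for (x bnd : ℕ) (c : Cmd) : Cmd :=
  .seq (.setN x (.const 0))
    (.loop (.natLt (.var x) (.var bnd)) (.seq c (.setN x (.add (.var x) (.const 1)))))

/-- The rule for counting loops, with an invariant that involves the elapsed time. -/
theorem Halts.for_time {x bnd : ℕ} (hx : bnd ≠ x) (hxc : x ∉ c.modN) (hbc : bnd ∉ c.modN)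
    (I : ℕ → ℕ → Mem → Prop) (h0 : I 0 0 (s.setN x 0))
    (hstep : ∀ k t s', k < s.nvar bnd → s'.nvar x = k → Frame (Cmd.for x bnd c) s s' → I k t s' →
      Halts F c s' fun t' s'' => I (k + 1) (t + t' + 3) (s''.setN x (k + 1)))
    (hQ : ∀ t s', s'.nvar x = s.nvar bnd → Frame (Cmd.for x bnd c) s s' →
      I (s.nvar bnd) t s' → Q (t + 3) s') :
    Halts F (Cmd.for x bnd c) s Q := by
  unfold Cmd.for
  rw [halts_seq, halts_setN]
  have hfr : ∀ s', Frame (.seq c (.setN x (.add (.var x) (.const 1)))) (s.setN x 0) s' →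
      Frame (Cmd.for x bnd c) s s' := by
    intro s' hf
    refine ⟨fun y hy => ?_, hf.rvar, hf.narr, hf.rarr⟩
    have hy' : y ≠ x := by
      rintro rfl
      exact hy (by simp [Cmd.for, Cmd.modN])
    have h := hf.nvar y (by
      intro hmem
      exact hy (by simpa [Cmd.for, Cmd.modN] using Or.inr hmem))
    rw [h, Mem.nvar_setN, if_neg hy']
  have hfb : ∀ s', Frame (.seq c (.setN x (.add (.var x) (.const 1)))) (s.setN x 0) s' →
      s'.nvar bnd = s.nvar bnd := by
    intro s' hf
    have h := hf.nvar bnd (by simp [Cmd.modN, hbc, hx])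
    rw [h, Mem.nvar_setN, if_neg hx]
  refine Halts.loop (fun t s' => ∃ k, s'.nvar x = k ∧ k ≤ s.nvar bnd ∧ I k t s')
    (fun s' => s.nvar bnd - s'.nvar x) ⟨0, by simp [NExpr.eval], Nat.zero_le _, h0⟩ ?_ ?_
  · rintro t s' hf ⟨k, hk, hle, hI⟩ hb
    simp only [BExpr.holds, NExpr.eval] at hb
    rw [hfb s' hf, hk] at hb
    rw [halts_seq]
    refine (hstep k t s' hb hk (hfr s' hf) hI).mono fun t' s'' hf' hI' => ?_
    have hk' : s''.nvar x = k := (hf'.nvar x hxc).trans hk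
    rw [halts_setN]
    simp only [NExpr.eval, hk']
    refine ⟨⟨k + 1, by simp, hb, ?_⟩, ?_⟩
    -- The overhead of a round is three steps: the test, the sequencing and the increment.
    · have : t + (t' + 1 + 1) + 1 = t + t' + 3 := by omega
      rwa [this]
    · simp only [Mem.nvar_setN, if_true, hk]
      omega
  · rintro t s' hf ⟨k, hk, hle, hI⟩ hb
    simp only [BExpr.holds, NExpr.eval] at hb
    rw [hfb s' hf, hk] at hb
    have hkN : k = s.nvar bnd := by omega
    subst hkN
    -- Three more steps for the initial assignment, the outer sequencing and the final test.
    have : 1 + (t + 1) + 1 = t + 3 := by omega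
    rw [this]
    exact hQ t s' hk (hfr s' hf) hI

/-- The rule for counting loops whose body takes at most `B` steps. -/
theorem Halts.for {x bnd : ℕ} (hx : bnd ≠ x) (hxc : x ∉ c.modN) (hbc : bnd ∉ c.modN) (B : ℕ)
    (I : ℕ → Mem → Prop) (h0 : I 0 (s.setN x 0))
    (hstep : ∀ k s', k < s.nvar bnd → s'.nvar x = k → Frame (Cmd.for x bnd c) s s' → I k s' →
      Halts F c s' fun t' s'' => t' ≤ B ∧ I (k + 1) (s''.setN x (k + 1)))
    (hQ : ∀ t s', t ≤ s.nvar bnd * (B + 3) + 3 → s'.nvar x = s.nvar bnd →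
      Frame (Cmd.for x bnd c) s s' → I (s.nvar bnd) s' → Q t s') :
    Halts F (Cmd.for x bnd c) s Q := by
  refine Halts.for_time hx hxc hbc (fun k t s' => t ≤ k * (B + 3) ∧ I k s') ⟨by simp, h0⟩ ?_ ?_
  · rintro k t s' hk hx' hf ⟨ht, hI⟩
    refine (hstep k s' hk hx' hf hI).mono fun t' s'' _ h => ⟨?_, h.2⟩
    have := h.1
    rw [Nat.succ_mul]
    omega
  · rintro t s' hx' hf ⟨ht, hI⟩
    exact hQ _ s' (by omega) hx' hf hI

end Logic

/-! ### Sums over the set bits of a number -/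

section Bits

open Classical in
/-- The number whose binary digits are given by `b`, restricted to the first `m` places. -/
noncomputable def bitSum (b : ℕ → Prop) (m : ℕ) : ℕ :=
  ∑ r ∈ Finset.range m, if b r then 2 ^ r else 0

open Classical in
theorem bitSum_succ (b : ℕ → Prop) (m : ℕ) :
    bitSum b (m + 1) = bitSum b m + if b m then 2 ^ m else 0 :=
  Finset.sum_range_succ _ _

theorem bitSum_lt (b : ℕ → Prop) (m : ℕ) : bitSum b m < 2 ^ m := by
  classical
  induction m with
  | zero => simp [bitSum]
  | succ m ih =>
    rw [bitSum_succ, pow_succ]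
    split_ifs <;> omega

theorem testBit_bitSum (b : ℕ → Prop) {m r : ℕ} (hr : r < m) :
    (bitSum b m).testBit r = true ↔ b r := by
  classical
  induction m with
  | zero => omega
  | succ m ih =>
    rw [bitSum_succ]
    rcases Nat.lt_succ_iff_lt_or_eq.1 hr with h | rfl
    · split_ifs
      · rw [add_comm, Nat.testBit_two_pow_add_gt h, ih h]
      · rw [add_zero, ih h]
    · have hlt := Nat.testBit_lt_two_pow (bitSum_lt b r)
      split_ifs with hb
      · rw [add_comm, Nat.testBit_two_pow_add_eq, hlt]
        simp [hb]
      · rw [add_zero, hlt]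
        simp [hb]

/-- The sum of `y r` over the set bits `r < m` of `v`. -/
def tableSum (y : ℕ → ℕ) (m v : ℕ) : ℕ :=
  ∑ r ∈ Finset.range m, if v.testBit r then y r else 0

theorem tableSum_succ_of_lt (y : ℕ → ℕ) {m v : ℕ} (hv : v < 2 ^ m) :
    tableSum y (m + 1) v = tableSum y m v := by
  rw [tableSum, Finset.sum_range_succ, Nat.testBit_lt_two_pow hv]
  simp [tableSum]

/-- One more row doubles the table: the new upper half is the old table with `y m` added. `rebuild`
fills the tables by this recurrence. -/
theorem tableSum_succ_add (y : ℕ → ℕ) {m v : ℕ} (hv : v < 2 ^ m) :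
    tableSum y (m + 1) (2 ^ m + v) = tableSum y m v + y m := by
  rw [tableSum, Finset.sum_range_succ, Nat.testBit_two_pow_add_eq, Nat.testBit_lt_two_pow hv]
  simp only [Bool.not_false, if_true, tableSum]
  congr 1
  refine Finset.sum_congr rfl fun r hr => ?_
  rw [Nat.testBit_two_pow_add_gt (Finset.mem_range.1 hr)]

theorem tableSum_congr {y y' : ℕ → ℕ} {m : ℕ} (h : ∀ r < m, y r = y' r) (v : ℕ) :
    tableSum y m v = tableSum y' m v :=
  Finset.sum_congr rfl fun r hr => by rw [h r (Finset.mem_range.1 hr)]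

open Classical in
-- With the membership pattern of an object as the address, the table entry is the share of the
-- block in the cost of the object.
theorem tableSum_bitSum (y : ℕ → ℕ) (b : ℕ → Prop) (m : ℕ) :
    tableSum y m (bitSum b m) = ∑ r ∈ Finset.range m, if b r then y r else 0 := by
  refine Finset.sum_congr rfl fun r hr => ?_
  simp only [testBit_bitSum b (Finset.mem_range.1 hr)]

theorem sum_range_mul (f : ℕ → ℕ) (G m : ℕ) :
    ∑ e ∈ Finset.range (G * m), f e =
      ∑ g ∈ Finset.range G, ∑ r ∈ Finset.range m, f (g * m + r) := by
  induction G with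
  | zero => simp
  | succ G ih => rw [Nat.succ_mul, Finset.sum_range_add, ih, Finset.sum_range_succ]

end Bits

/-! ### The program

The constraints are processed in blocks of `bs` consecutive rows, where `2 ^ bs` is about the square
root of `n`. For each block a table holds the sums of the row weights over all sets of rows of the
block, so that the cost of an object is the sum of one table entry for each block.

Natural variables: `0` number of objects, `1` block size, `2` table size, `4` number of phases,
`5, 6, 7` objects, `8` row within the block, `9` block, `10, 11` table index and power of two,
`12, 13, 14, 15` offsets of the block in the arrays of flags, addresses, tables and row weights,
`16` number of blocks, `17` cost, `18` threshold, `19` phase or step, `20` flags of a block,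
`21` position of a flag, `22` selected object, `23, 24` resistances.

Natural arrays: `0` output, `1` flags for the membership of objects in rows, `2` addresses of table
entries, `3` row weights, `4` tables, `5` multiplicities, `7` ranks, `8` extraction order.

Real variable `0`: maximum weight. Real arrays: `0` weights, `1` remaining weights. -/

namespace Program

/-- Compute the table of the current block from the row weights. -/
def rebuild : Cmd :=
  .seq (.storeN 4 (.var 14) (.const 0)) <|
  .seq (.setN 11 (.const 1)) <|
  .for 8 1 <|
    .seq
      (.for 10 11 <|
        .storeN 4 (.add (.add (.var 14) (.var 11)) (.var 10))
          (.add (.arr 4 (.add (.var 14) (.var 10))) (.arr 3 (.add (.var 15) (.var 8)))))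
      (.setN 11 (.add (.var 11) (.var 11)))

/-- Compute the cost of object `7`. -/
def check : Cmd :=
  .seq (.setN 17 (.const 0)) <|
  .seq (.setN 13 (.var 7)) <|
  .for 9 16 <|
    .seq (.setN 17 (.add (.var 17) (.arr 4 (.arr 2 (.var 13)))))
      (.setN 13 (.add (.var 13) (.var 0)))

/-- Double the weights of the rows of the current block that contain object `7`. -/
def doubleRows : Cmd :=
  .seq (.setN 21 (.var 12)) <|
  .for 8 1 <|
    .seq
      (.ite (.natLt (.const 0) (.arr 1 (.var 21)))
        (.storeN 3 (.add (.var 15) (.var 8))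
          (.add (.arr 3 (.add (.var 15) (.var 8))) (.arr 3 (.add (.var 15) (.var 8)))))
        .skip)
      (.setN 21 (.add (.var 21) (.var 0)))

/-- Increase the multiplicity of object `7` and update the row weights and tables. -/
def raise : Cmd :=
  .seq (.storeN 5 (.var 7) (.add (.arr 5 (.var 7)) (.const 1))) <|
  .seq (.setN 12 (.var 7)) <|
  .seq (.setN 13 (.var 7)) <|
  .seq (.setN 14 (.const 0)) <|
  .seq (.setN 15 (.const 0)) <|
  .for 9 16 <|
    .seq (.ite (.natLt (.const 0) (.arr 4 (.arr 2 (.var 13)))) (.seq doubleRows rebuild) .skip) <|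
    .seq (.setN 12 (.add (.var 12) (.var 20))) <|
    .seq (.setN 13 (.add (.var 13) (.var 0))) <|
    .seq (.setN 14 (.add (.var 14) (.var 2)))
      (.setN 15 (.add (.var 15) (.var 1)))

variable {n : ℕ} {F : WeightedObjects n}

/-- The number of steps of `rebuild` is at most this. -/
def rebuildTime (bs : ℕ) : ℕ := bs * (4 * 2 ^ bs + 8) + 7

theorem rebuild_halts {s : Mem} {bs q eb : ℕ} (h1 : s.nvar 1 = bs) (h14 : s.nvar 14 = q)
    (h15 : s.nvar 15 = eb) :
    Halts F rebuild s fun t s' => t ≤ rebuildTime bs ∧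
      (∀ v < 2 ^ bs, s'.narr 4 (q + v) = tableSum (fun r => s.narr 3 (eb + r)) bs v) ∧
      (∀ a, a < q ∨ q + 2 ^ bs ≤ a → s'.narr 4 a = s.narr 4 a) := by
  unfold rebuild
  simp only [halts_seq, halts_storeN, halts_setN, NExpr.eval]
  refine Halts.for (by decide) (by decide) (by decide) (4 * 2 ^ bs + 5)
    (fun r s' => s'.nvar 11 = 2 ^ r ∧
      (∀ v < 2 ^ r, s'.narr 4 (q + v) = tableSum (fun r => s.narr 3 (eb + r)) r v) ∧
      (∀ a, a < q ∨ q + 2 ^ r ≤ a → s'.narr 4 a = s.narr 4 a)) ?_ ?_ ?_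
  · refine ⟨by simp, ?_, ?_⟩
    · intro v hv
      have : v = 0 := by simpa using hv
      subst this
      simp [h14, tableSum]
    · intro a ha
      have : a ≠ q := by rcases ha with h | h <;> omega
      simp [h14, this]
  · rintro r s' hr hr8 hf ⟨hp, htab, hout⟩
    have e3 : s'.narr 3 = s.narr 3 := by rw [hf.narr 3 (by decide)]; simp
    have e14 : s'.nvar 14 = q := by rw [hf.nvar 14 (by decide)]; simp [h14]
    have e15 : s'.nvar 15 = eb := by rw [hf.nvar 15 (by decide)]; simp [h15]
    have hr' : r < bs := by simpa [h1] using hr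
    rw [halts_seq]
    -- This round writes only from `q + 2 ^ r` on and reads only below, so the values copied are
    -- those from before the round.
    refine Halts.for (by decide) (by decide) (by decide) 1
      (fun v' s'' => ∀ a, s''.narr 4 a = if q + 2 ^ r ≤ a ∧ a < q + 2 ^ r + v' then
        s'.narr 4 (a - 2 ^ r) + s.narr 3 (eb + r) else s'.narr 4 a) ?_ ?_ ?_
    · intro a
      rw [if_neg (by omega)]
      simp
    · intro v' s'' hv hv10 hf' hI
      have e3' : s''.narr 3 = s.narr 3 := by rw [hf'.narr 3 (by decide), e3]
      have e14' : s''.nvar 14 = q := by rw [hf'.nvar 14 (by decide), e14]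
      have e15' : s''.nvar 15 = eb := by rw [hf'.nvar 15 (by decide), e15]
      have e8' : s''.nvar 8 = r := by rw [hf'.nvar 8 (by decide), hr8]
      have e11' : s''.nvar 11 = 2 ^ r := by rw [hf'.nvar 11 (by decide), hp]
      rw [hp] at hv
      simp only [halts_storeN, NExpr.eval, e3', e14', e15', e8', e11', hv10, le_refl, true_and]
      intro a
      simp only [Mem.narr_setN, Mem.narr_storeN, if_true]
      by_cases ha : a = q + 2 ^ r + v'
      · subst ha
        rw [Function.update_self, if_pos (by omega), hI, if_neg (by omega)]
        congr 2
        omega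
      · rw [Function.update_of_ne ha, hI]
        by_cases hb : q + 2 ^ r ≤ a ∧ a < q + 2 ^ r + v'
        · rw [if_pos hb, if_pos (by omega)]
        · rw [if_neg hb, if_neg (by omega)]
    · intro t s'' ht _ hf' hI
      rw [hp] at ht hI
      have e11' : s''.nvar 11 = 2 ^ r := by rw [hf'.nvar 11 (by decide), hp]
      have hpow : 2 ^ (r + 1) ≤ 2 ^ bs := Nat.pow_le_pow_right two_pos hr'
      have h2 : 2 ^ (r + 1) = 2 ^ r + 2 ^ r := by rw [pow_succ]; omega
      simp only [halts_setN, NExpr.eval, e11']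
      refine ⟨by omega, ?_, ?_, ?_⟩
      · simp [h2]
      · intro v hv
        simp only [Mem.narr_setN]
        rw [hI]
        by_cases hv' : v < 2 ^ r
        · rw [if_neg (by omega), htab v hv', tableSum_succ_of_lt _ hv']
        · obtain ⟨u, rfl⟩ := Nat.exists_eq_add_of_le (not_lt.1 hv')
          have hu : u < 2 ^ r := by omega
          rw [if_pos (by omega), tableSum_succ_add _ hu, ← htab u hu]
          congr 2
          omega
      · intro a ha
        simp only [Mem.narr_setN]
        rw [hI, if_neg (by omega)]
        exact hout a (by omega)
  · rintro t s' ht _ _ ⟨_, htab, hout⟩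
    simp only [Mem.nvar_setN, Mem.nvar_storeN, h1] at ht htab hout
    norm_num at ht htab hout
    have he : 4 * 2 ^ bs + 5 + 3 = 4 * 2 ^ bs + 8 := rfl
    rw [he] at ht
    exact ⟨by unfold rebuildTime; omega, htab, hout⟩

/-- The part of the memory that is fixed before the main loop. -/
structure Layout (F : WeightedObjects n) (bs G : ℕ) (s : Mem) : Prop where
  nvar_zero : s.nvar 0 = n
  nvar_one : s.nvar 1 = bs
  nvar_two : s.nvar 2 = 2 ^ bs
  nvar_blocks : s.nvar 16 = G
  nvar_flags : s.nvar 20 = bs * n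
  flag : ∀ e < G * bs, ∀ l < n, 0 < s.narr 1 (e * n + l) ↔ F.RowMem e l
  addr : ∀ g < G, ∀ l < n,
    s.narr 2 (g * n + l) = g * 2 ^ bs + bitSum (fun r => F.RowMem (g * bs + r) l) bs

theorem Layout.frame {bs G : ℕ} {s s' : Mem} {c : Cmd} (h : Layout F bs G s) (hf : Frame c s s')
    (h0 : 0 ∉ c.modN) (h1 : 1 ∉ c.modN) (h2 : 2 ∉ c.modN) (h16 : 16 ∉ c.modN) (h20 : 20 ∉ c.modN)
    (ha1 : 1 ∉ c.modNA) (ha2 : 2 ∉ c.modNA) : Layout F bs G s' where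
  nvar_zero := (hf.nvar 0 h0).trans h.nvar_zero
  nvar_one := (hf.nvar 1 h1).trans h.nvar_one
  nvar_two := (hf.nvar 2 h2).trans h.nvar_two
  nvar_blocks := (hf.nvar 16 h16).trans h.nvar_blocks
  nvar_flags := (hf.nvar 20 h20).trans h.nvar_flags
  flag := by rw [hf.narr 1 ha1]; exact h.flag
  addr := by rw [hf.narr 2 ha2]; exact h.addr

/-- The row weights and tables in memory belong to the multiplicities `x`. -/
structure Represents (F : WeightedObjects n) (bs G : ℕ) (x : ℕ → ℕ) (s : Mem) : Prop where
  weight : ∀ e < G * bs, s.narr 3 e = 2 ^ F.load x e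
  table : ∀ g < G, ∀ v < 2 ^ bs,
    s.narr 4 (g * 2 ^ bs + v) = tableSum (fun r => 2 ^ F.load x (g * bs + r)) bs v
  mult : ∀ l < n, s.narr 5 l = x l

theorem Represents.congr {bs G : ℕ} {x : ℕ → ℕ} {s s' : Mem} (h : Represents F bs G x s)
    (h3 : s'.narr 3 = s.narr 3) (h4 : s'.narr 4 = s.narr 4) (h5 : s'.narr 5 = s.narr 5) :
    Represents F bs G x s' where
  weight := by rw [h3]; exact h.weight
  table := by rw [h4]; exact h.table
  mult := by rw [h5]; exact h.mult

/-- One lookup per block instead of one per row. Variable `13` moves through the addresses with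
stride `n`, as indices cannot be multiplied. -/
theorem check_halts {s : Mem} {bs G l : ℕ} {x : ℕ → ℕ} (hL : Layout F bs G s)
    (hR : Represents F bs G x s) (h7 : s.nvar 7 = l) (hl : l < n) :
    Halts F check s fun t s' => t ≤ 6 * G + 7 ∧ s'.nvar 17 = F.cost (G * bs) x l := by
  classical
  unfold check
  simp only [halts_seq, halts_setN, NExpr.eval]
  refine Halts.for (by decide) (by decide) (by decide) 3
    (fun g s' => s'.nvar 13 = g * n + l ∧ s'.nvar 17 = ∑ g' ∈ Finset.range g,
      tableSum (fun r => 2 ^ F.load x (g' * bs + r)) bs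
        (bitSum (fun r => F.RowMem (g' * bs + r) l) bs)) ?_ ?_ ?_
  · simp [h7]
  · rintro g s' hg hg9 hf ⟨h13, h17⟩
    have e0 : s'.nvar 0 = n := by rw [hf.nvar 0 (by decide)]; simp [hL.nvar_zero]
    have e2 : s'.narr 2 = s.narr 2 := by rw [hf.narr 2 (by decide)]; simp
    have e4 : s'.narr 4 = s.narr 4 := by rw [hf.narr 4 (by decide)]; simp
    have hg' : g < G := by simpa [hL.nvar_blocks] using hg
    simp only [halts_seq, halts_setN, NExpr.eval]
    refine ⟨by omega, ?_, ?_⟩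
    · simp [e0, h13, Nat.succ_mul]
      omega
    · simp [h13, h17, e2, e4, hL.addr g hg' l hl, hR.table g hg' _ (bitSum_lt _ _),
        Finset.sum_range_succ]
  · rintro t s' ht - hf ⟨-, h17⟩
    simp [hL.nvar_blocks] at ht h17
    refine ⟨by omega, ?_⟩
    rw [h17, WeightedObjects.cost, sum_range_mul]
    exact Finset.sum_congr rfl fun g _ => tableSum_bitSum _ _ _

theorem doubleRows_halts {s : Mem} {bs G g l : ℕ} {x : ℕ → ℕ} (hL : Layout F bs G s)
    (hg : g < G) (hl : l < n) (h12 : s.nvar 12 = g * (bs * n) + l) (h15 : s.nvar 15 = g * bs)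
    (hw : ∀ r < bs, s.narr 3 (g * bs + r) = 2 ^ F.load x (g * bs + r)) :
    Halts F doubleRows s fun t s' => t ≤ bs * 8 + 5 ∧
      (∀ r < bs, s'.narr 3 (g * bs + r) =
        2 ^ F.load (WeightedObjects.raised x l) (g * bs + r)) ∧
      (∀ e, e < g * bs ∨ (g + 1) * bs ≤ e → s'.narr 3 e = s.narr 3 e) := by
  classical
  unfold doubleRows
  simp only [halts_seq, halts_setN, NExpr.eval]
  refine Halts.for (by decide) (by decide) (by decide) 5
    (fun r s' => s'.nvar 21 = (g * bs + r) * n + l ∧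
      (∀ r' < r, s'.narr 3 (g * bs + r') =
        2 ^ F.load (WeightedObjects.raised x l) (g * bs + r')) ∧
      (∀ e, e < g * bs ∨ g * bs + r ≤ e → s'.narr 3 e = s.narr 3 e)) ?_ ?_ ?_
  · refine ⟨?_, by simp, by simp⟩
    simp [h12]
    ring
  · rintro r s' hr hr8 hf ⟨h21, hin, hout⟩
    have e0 : s'.nvar 0 = n := by rw [hf.nvar 0 (by decide)]; simp [hL.nvar_zero]
    have e15 : s'.nvar 15 = g * bs := by rw [hf.nvar 15 (by decide)]; simp [h15]
    have e1 : s'.narr 1 = s.narr 1 := by rw [hf.narr 1 (by decide)]; simp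
    have hr' : r < bs := by simpa [hL.nvar_one] using hr
    have hlt : g * bs + r < G * bs := by nlinarith
    have hflag := hL.flag _ hlt l hl
    have hold : s'.narr 3 (g * bs + r) = 2 ^ F.load x (g * bs + r) :=
      (hout _ (Or.inr le_rfl)).trans (hw r hr')
    have hnext : (g * bs + r) * n + l + n = (g * bs + (r + 1)) * n + l := by ring
    simp only [halts_seq, halts_ite, halts_storeN, halts_skip, halts_setN, NExpr.eval,
      BExpr.holds, e15, hr8, h21, e1, hflag, hold]
    constructor
    · intro hrow
      refine ⟨by omega, by simp [e0, h21, hnext], ?_, ?_⟩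
      · intro r' hr''
        simp only [Mem.narr_setN, Mem.narr_storeN, if_true]
        rcases Nat.lt_succ_iff_lt_or_eq.1 hr'' with h | rfl
        · rw [Function.update_of_ne (by omega), hin r' h]
        · rw [Function.update_self, WeightedObjects.load_raised, if_pos hrow, pow_succ]
          omega
      · intro e he
        simp only [Mem.narr_setN, Mem.narr_storeN, if_true]
        rw [Function.update_of_ne (by omega), hout e (by omega)]
    · intro hrow
      refine ⟨by omega, by simp [e0, hnext], ?_, ?_⟩
      · intro r' hr''
        simp only [Mem.narr_setN]
        rcases Nat.lt_succ_iff_lt_or_eq.1 hr'' with h | rfl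
        · exact hin r' h
        · rw [hold, WeightedObjects.load_raised, if_neg hrow, add_zero]
      · intro e he
        simp only [Mem.narr_setN]
        exact hout e (by omega)
  · rintro t s' ht - hf ⟨-, hin, hout⟩
    simp [hL.nvar_one] at ht hin hout
    refine ⟨by omega, hin, fun e he => hout e ?_⟩
    rw [Nat.succ_mul] at he
    exact he

open Classical in
/-- The number of the first `g` blocks with a row that contains object `l`. -/
noncomputable def touched (F : WeightedObjects n) (bs g l : ℕ) : ℕ :=
  ∑ g' ∈ Finset.range g, if ∃ r < bs, F.RowMem (g' * bs + r) l then 1 else 0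

/-- The number of steps of `raise` for object `l` is at most this. -/
noncomputable def raiseTime (F : WeightedObjects n) (bs G l : ℕ) : ℕ :=
  20 * G + 20 + touched F bs G l * (bs * 8 + 8 + rebuildTime bs)

/-- Only touched blocks pay for new row weights and a new table; the others cost a constant. The
time bound keeps the number of touched blocks for the later amortization. -/
theorem raise_halts {s : Mem} {bs G l : ℕ} {x : ℕ → ℕ} (hL : Layout F bs G s)
    (hR : Represents F bs G x s) (h7 : s.nvar 7 = l) (hl : l < n) :
    Halts F raise s fun t s' => t ≤ raiseTime F bs G l ∧
      Represents F bs G (WeightedObjects.raised x l) s' := by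
  classical
  unfold raise
  simp only [halts_seq, halts_setN, halts_storeN, NExpr.eval]
  set x' := WeightedObjects.raised x l with hx'
  refine Halts.for_time (by decide) (by decide) (by decide)
    (fun g t s' => t ≤ 15 * g + touched F bs g l * (bs * 8 + 8 + rebuildTime bs) ∧
      s'.nvar 12 = g * (bs * n) + l ∧ s'.nvar 13 = g * n + l ∧ s'.nvar 14 = g * 2 ^ bs ∧
      s'.nvar 15 = g * bs ∧
      (∀ e < g * bs, s'.narr 3 e = 2 ^ F.load x' e) ∧
      (∀ e, g * bs ≤ e → s'.narr 3 e = s.narr 3 e) ∧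
      (∀ g' < g, ∀ v < 2 ^ bs,
        s'.narr 4 (g' * 2 ^ bs + v) = tableSum (fun r => 2 ^ F.load x' (g' * bs + r)) bs v) ∧
      (∀ a, g * 2 ^ bs ≤ a → s'.narr 4 a = s.narr 4 a)) ?_ ?_ ?_
  · simp [h7, touched]
  · rintro g t s' hg hg9 hf ⟨ht, h12, h13, h14, h15, hin, hout, hin4, hout4⟩
    have hg' : g < G := by simpa [hL.nvar_blocks] using hg
    have hL' : Layout F bs G s' := by
      refine Layout.frame ?_ hf (by decide) (by decide) (by decide) (by decide) (by decide)
        (by decide) (by decide)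
      exact ⟨by simp [hL.nvar_zero], by simp [hL.nvar_one], by simp [hL.nvar_two],
        by simp [hL.nvar_blocks], by simp [hL.nvar_flags], by simpa using hL.flag,
        by simpa using hL.addr⟩
    have hnv : ∀ k : ℕ, k * 2 ^ bs + 2 ^ bs = (k + 1) * 2 ^ bs := fun k => by ring
    have hblock : ∀ r < bs, g * bs + r < G * bs := fun r hr => by nlinarith
    have hsum : s'.narr 4 (s'.narr 2 (s'.nvar 13)) =
        ∑ r ∈ Finset.range bs, if F.RowMem (g * bs + r) l then 2 ^ F.load x (g * bs + r) else 0 := by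
      rw [h13, hL'.addr g hg' l hl, hout4 _ (Nat.le_add_right _ _),
        hR.table g hg' _ (bitSum_lt _ _), tableSum_bitSum]
    -- Blocks from `g` on still hold the old tables, whose row weights are positive. So the entry at
    -- the pattern of `l` vanishes exactly when the pattern is empty, and one lookup decides whether
    -- the block is touched.
    have hpos : 0 < s'.narr 4 (s'.narr 2 (s'.nvar 13)) ↔ ∃ r < bs, F.RowMem (g * bs + r) l := by
      rw [hsum]
      constructor
      · intro h
        obtain ⟨r, hr, hr'⟩ := Finset.exists_ne_zero_of_sum_ne_zero h.ne'
        refine ⟨r, Finset.mem_range.1 hr, ?_⟩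
        by_contra hcon
        exact hr' (if_neg hcon)
      · rintro ⟨r, hr, hrow⟩
        refine Finset.sum_pos' (fun _ _ => Nat.zero_le _) ⟨r, Finset.mem_range.2 hr, ?_⟩
        rw [if_pos hrow]
        positivity
    have hts : touched F bs (g + 1) l =
        touched F bs g l + if ∃ r < bs, F.RowMem (g * bs + r) l then 1 else 0 :=
      Finset.sum_range_succ _ _
    have hw : ∀ r < bs, s'.narr 3 (g * bs + r) = 2 ^ F.load x (g * bs + r) := fun r hr =>
      (hout _ (Nat.le_add_right _ _)).trans (hR.weight _ (hblock r hr))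
    have hsucc : (g + 1) * bs = g * bs + bs := Nat.succ_mul _ _
    rw [halts_seq, halts_ite]
    simp only [BExpr.holds, NExpr.eval, hpos]
    constructor
    · intro htouch
      rw [if_pos htouch] at hts
      rw [halts_seq]
      refine (doubleRows_halts hL' hg' hl h12 h15 hw).mono ?_
      rintro t₁ s₁ hf₁ ⟨ht₁, hin₁, hout₁⟩
      have e1 : s₁.nvar 1 = bs := by rw [hf₁.nvar 1 (by decide), hL'.nvar_one]
      have e14 : s₁.nvar 14 = g * 2 ^ bs := by rw [hf₁.nvar 14 (by decide), h14]
      have e15 : s₁.nvar 15 = g * bs := by rw [hf₁.nvar 15 (by decide), h15]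
      refine (rebuild_halts e1 e14 e15).mono ?_
      rintro t₂ s₂ hf₂ ⟨ht₂, hin₂, hout₂⟩
      have hL₂ : Layout F bs G s₂ := (hL'.frame hf₁ (by decide) (by decide) (by decide) (by decide)
        (by decide) (by decide) (by decide)).frame hf₂ (by decide) (by decide) (by decide)
        (by decide) (by decide) (by decide) (by decide)
      have f12 : s₂.nvar 12 = g * (bs * n) + l := by
        rw [hf₂.nvar 12 (by decide), hf₁.nvar 12 (by decide), h12]
      have f13 : s₂.nvar 13 = g * n + l := by
        rw [hf₂.nvar 13 (by decide), hf₁.nvar 13 (by decide), h13]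
      have f14 : s₂.nvar 14 = g * 2 ^ bs := by rw [hf₂.nvar 14 (by decide), e14]
      have f15 : s₂.nvar 15 = g * bs := by rw [hf₂.nvar 15 (by decide), e15]
      have f3 : s₂.narr 3 = s₁.narr 3 := hf₂.narr 3 (by decide)
      have f4 : s₁.narr 4 = s'.narr 4 := hf₁.narr 4 (by decide)
      simp only [halts_seq, halts_setN, NExpr.eval]
      refine ⟨?_, ?_, ?_, ?_, ?_, ?_, ?_, ?_, ?_⟩
      · rw [hts, Nat.add_mul, Nat.mul_add]
        omega
      · simp [f12, hL₂.nvar_flags]; ring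
      · simp [f13, hL₂.nvar_zero]; ring
      · simp [f14, hL₂.nvar_two]; ring
      · simp [f15, hL₂.nvar_one]; ring
      · intro e he
        simp only [Mem.narr_setN, f3]
        by_cases h : e < g * bs
        · rw [hout₁ e (Or.inl h), hin e h]
        · obtain ⟨r, rfl⟩ := Nat.exists_eq_add_of_le (not_lt.1 h)
          exact hin₁ r (by omega)
      · intro e he
        simp only [Mem.narr_setN, f3]
        rw [hout₁ e (Or.inr he), hout e (by omega)]
      · intro g' hg'' v hv
        simp only [Mem.narr_setN]
        rcases Nat.lt_succ_iff_lt_or_eq.1 hg'' with h | rfl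
        · have : (g' + 1) * 2 ^ bs ≤ g * 2 ^ bs := Nat.mul_le_mul_right _ h
          have := hnv g'
          rw [hout₂ _ (Or.inl (by omega)), f4, hin4 g' h v hv]
        · rw [hin₂ v hv]
          exact tableSum_congr hin₁ v
      · intro a ha
        simp only [Mem.narr_setN]
        rw [hout₂ a (Or.inr (hnv g ▸ ha)), f4,
          hout4 a ((Nat.mul_le_mul_right _ (Nat.le_succ g)).trans ha)]
    · intro htouch
      rw [if_neg htouch] at hts
      have hsame : ∀ r < bs, F.load x' (g * bs + r) = F.load x (g * bs + r) := by
        intro r hr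
        rw [hx', WeightedObjects.load_raised, if_neg fun h => htouch ⟨r, hr, h⟩, add_zero]
      simp only [halts_seq, halts_skip, halts_setN, NExpr.eval]
      refine ⟨?_, ?_, ?_, ?_, ?_, ?_, ?_, ?_, ?_⟩
      · rw [hts, add_zero (touched F bs g l), Nat.mul_add]
        omega
      · simp [h12, hL'.nvar_flags]; ring
      · simp [h13, hL'.nvar_zero]; ring
      · simp [h14, hL'.nvar_two]; ring
      · simp [h15, hL'.nvar_one]; ring
      · intro e he
        simp only [Mem.narr_setN]
        by_cases h : e < g * bs
        · exact hin e h
        · obtain ⟨r, rfl⟩ := Nat.exists_eq_add_of_le (not_lt.1 h)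
          have hr : r < bs := by omega
          rw [hsame r hr, hw r hr]
      · intro e he
        simp only [Mem.narr_setN]
        exact hout e (by omega)
      · intro g' hg'' v hv
        simp only [Mem.narr_setN]
        rcases Nat.lt_succ_iff_lt_or_eq.1 hg'' with h | rfl
        · exact hin4 g' h v hv
        · rw [hout4 _ (Nat.le_add_right _ _), hR.table g' hg' v hv]
          exact tableSum_congr (fun r hr => by rw [hsame r hr]) v
      · intro a ha
        simp only [Mem.narr_setN]
        exact hout4 a ((Nat.mul_le_mul_right _ (Nat.le_succ g)).trans ha)
  · rintro t s' - hf ⟨ht, -, -, -, -, hin, -, hin4, -⟩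
    simp [hL.nvar_blocks] at ht hin hin4
    refine ⟨by unfold raiseTime; omega, hin, hin4, fun j hj => ?_⟩
    rw [hf.narr 5 (by decide)]
    simp only [Mem.narr_setN, Mem.narr_storeN, if_true, h7, hx', WeightedObjects.raised,
      Function.update_apply]
    split_ifs with h
    · rw [hR.mult l hl]
    · exact hR.mult j hj

end Program

namespace Program

variable {n : ℕ} {F : WeightedObjects n}

/-! ### Setting up -/

/-- Compute the block size `bs`, the table size `2 ^ bs` and the number `8 * (bs + 2) + 1` of
phases. -/
def setSizes : Cmd :=
  .seq (.setN 1 (.const 1)) <|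
  .seq (.setN 2 (.const 2)) <|
  .seq (.setN 3 (.const 4)) <|
  .seq
    (.loop (.not (.natLt (.var 0) (.add (.add (.var 3) (.var 3)) (.add (.var 3) (.var 3))))) <|
      .seq (.setN 1 (.add (.var 1) (.const 1))) <|
      .seq (.setN 2 (.add (.var 2) (.var 2)))
        (.setN 3 (.add (.add (.var 3) (.var 3)) (.add (.var 3) (.var 3))))) <|
  .seq (.setN 4 (.add (.var 1) (.const 2))) <|
  .seq (.setN 4 (.add (.var 4) (.var 4))) <|
  .seq (.setN 4 (.add (.var 4) (.var 4))) <|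
  .seq (.setN 4 (.add (.var 4) (.var 4))) <|
  .seq (.setN 4 (.add (.var 4) (.const 1))) <|
  .seq (.setN 20 (.const 0))
    (.for 8 1 (.setN 20 (.add (.var 20) (.var 0))))

/-- Indices can only be added and subtracted, so powers and products arise by doubling and repeated
addition. The loop stops at the first `bs ≥ 1` with `n < 4 ^ (bs + 1)`, which makes `2 ^ bs` of
order `√n`. -/
theorem setSizes_halts {s : Mem} (hn : 1 ≤ n) (h0 : s.nvar 0 = n) :
    Halts F setSizes s fun t s' => ∃ bs, 1 ≤ bs ∧ 4 ^ bs ≤ 4 * n ∧ n < 4 ^ (bs + 1) ∧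
      t ≤ 11 * bs + 30 ∧ s'.nvar 1 = bs ∧ s'.nvar 2 = 2 ^ bs ∧ s'.nvar 4 = 8 * (bs + 2) + 1 ∧
      s'.nvar 20 = bs * n := by
  unfold setSizes
  simp only [halts_seq, halts_setN, NExpr.eval]
  refine Halts.loop (fun t s' => ∃ bs, 1 ≤ bs ∧ 4 ^ bs ≤ 4 * n ∧ t + 6 ≤ 6 * bs ∧
    s'.nvar 1 = bs ∧ s'.nvar 2 = 2 ^ bs ∧ s'.nvar 3 = 4 ^ bs) (fun s' => n - s'.nvar 3) ?_ ?_ ?_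
  · exact ⟨1, le_rfl, by omega, by omega, by simp, by simp, by simp⟩
  · rintro t s' hf ⟨bs, h1, h4, ht, e1, e2, e3⟩ hb
    have e0 : s'.nvar 0 = n := by rw [hf.nvar 0 (by decide)]; simp [h0]
    simp only [BExpr.holds, NExpr.eval, e0, e3, not_lt] at hb
    have hp : 4 ^ (bs + 1) = 4 * 4 ^ bs := by ring
    have hpos : 0 < 4 ^ bs := by positivity
    simp only [halts_seq, halts_setN, NExpr.eval]
    refine ⟨⟨bs + 1, by omega, by omega, by omega, by simp [e1], ?_, ?_⟩, ?_⟩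
    · simp [e2, pow_succ]; omega
    · simp [e3, hp]; omega
    · simp [e3]; omega
  · rintro t s' hf ⟨bs, h1, h4, ht, e1, e2, e3⟩ hb
    have e0 : s'.nvar 0 = n := by rw [hf.nvar 0 (by decide)]; simp [h0]
    simp only [BExpr.holds, NExpr.eval, e0, e3, not_not] at hb
    have hp : 4 ^ (bs + 1) = 4 * 4 ^ bs := by ring
    refine Halts.for (by decide) (by decide) (by decide) 1 (fun r s'' => s''.nvar 20 = r * n)
      (by simp) ?_ ?_
    · intro r s'' _ _ hf' h20
      have e0' : s''.nvar 0 = n := by rw [hf'.nvar 0 (by decide)]; simp [e0]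
      simp [NExpr.eval, e0', h20, Nat.succ_mul]
    · intro t' s'' ht' _ hf' h20
      simp [e1] at ht' h20
      refine ⟨bs, h1, h4, by omega, by omega, ?_, ?_, ?_, h20⟩
      · rw [hf'.nvar 1 (by decide)]; simp [e1]
      · rw [hf'.nvar 2 (by decide)]; simp [e2]
      · rw [hf'.nvar 4 (by decide)]; simp [e1]; omega

/-- Compute the maximum weight. -/
def setMaxWeight : Cmd :=
  .for 5 0 <|
    .ite (.realLt (.var 0) (.arr 0 (.var 5))) (.setR 0 (.arr 0 (.var 5))) .skip

theorem setMaxWeight_halts {s : Mem} (hn : 1 ≤ n) (h0 : s.nvar 0 = n) (hr : s.rvar 0 = 0)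
    (hw : s.rarr 0 = F.weightAt) :
    Halts F setMaxWeight s fun t s' => t ≤ 5 * n + 3 ∧
      (∀ j < n, F.weightAt j ≤ s'.rvar 0) ∧ ∃ j < n, F.weightAt j = s'.rvar 0 := by
  unfold setMaxWeight
  refine Halts.for (by decide) (by decide) (by decide) 2
    (fun k s' => (∀ j < k, F.weightAt j ≤ s'.rvar 0) ∧
      (s'.rvar 0 = 0 ∨ ∃ j < n, F.weightAt j = s'.rvar 0)) ?_ ?_ ?_
  · simp [hr]
  · rintro k s' hk hk5 hf ⟨hle, hex⟩
    rw [h0] at hk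
    have ew : s'.rarr 0 = F.weightAt := by rw [hf.rarr 0 (by decide), hw]
    simp only [halts_ite, halts_setR, halts_skip, BExpr.holds, RExpr.eval, NExpr.eval, hk5, ew]
    refine ⟨fun hlt => ⟨by omega, ?_, ?_⟩, fun hlt => ⟨by omega, ?_, ?_⟩⟩
    · intro j hj
      simp only [Mem.rvar_setN, Mem.rvar_setR, if_true]
      rcases Nat.lt_succ_iff_lt_or_eq.1 hj with h | rfl
      · exact (hle j h).trans hlt.le
      · exact le_rfl
    · exact Or.inr ⟨k, hk, by simp⟩
    · intro j hj
      simp only [Mem.rvar_setN]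
      rcases Nat.lt_succ_iff_lt_or_eq.1 hj with h | rfl
      · exact hle j h
      · exact not_lt.1 hlt
    · simpa using hex
  · rintro t s' ht _ _ ⟨hle, hex⟩
    rw [h0] at ht hle
    -- The initial value 0 cannot survive, because weights are positive.
    refine ⟨by omega, hle, hex.resolve_left fun h => ?_⟩
    have := hle 0 (by omega)
    have := F.weightAt_pos (i := 0) (by omega)
    linarith

/-- The disjunction of two tests. -/
def orTest (a b : BExpr) : BExpr := .not (.and (.not a) (.not b))

/-- Test two indices for equality. -/
def eqTest (a b : NExpr) : BExpr := .and (.not (.natLt a b)) (.not (.natLt b a))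

@[simp] theorem holds_orTest {s : Mem} {a b : BExpr} :
    (orTest a b).holds F s ↔ a.holds F s ∨ b.holds F s := by
  simp only [orTest, BExpr.holds]
  tauto

@[simp] theorem holds_eqTest {s : Mem} {a b : NExpr} :
    (eqTest a b).holds F s ↔ a.eval F s = b.eval F s := by
  simp only [eqTest, BExpr.holds]
  omega

/-- Does object `7` take part in the constraint of objects `5` and `6`? -/
def rowTest : BExpr :=
  orTest (.and (eqTest (.var 5) (.var 6)) (.contained (.var 5) (.var 7)))
    (.and (.not (eqTest (.var 5) (.var 6))) (.crossingMem (.var 5) (.var 6) (.const 0) (.var 7)))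

theorem holds_rowTest {s : Mem} {e l : ℕ} (h5 : s.nvar 5 = e / n) (h6 : s.nvar 6 = e % n)
    (h7 : s.nvar 7 = l) : rowTest.holds F s ↔ F.RowMem e l := by
  subst h7
  simp only [rowTest, holds_orTest, BExpr.holds, holds_eqTest, NExpr.eval, h5, h6,
    WeightedObjects.RowMem]

/-- Enter the row of objects `5` and `6` into the flags and addresses. -/
def addRow : Cmd :=
  .for 7 0 <|
    .ite rowTest
      (.seq (.storeN 1 (.add (.var 12) (.var 7)) (.const 1))
        (.storeN 2 (.add (.var 13) (.var 7))
          (.add (.arr 2 (.add (.var 13) (.var 7))) (.var 11))))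
      (.storeN 1 (.add (.var 12) (.var 7)) (.const 0))

open Classical in
theorem addRow_halts {s : Mem} {e p pb pw : ℕ} (h0 : s.nvar 0 = n) (h5 : s.nvar 5 = e / n)
    (h6 : s.nvar 6 = e % n) (h11 : s.nvar 11 = pw) (h12 : s.nvar 12 = p) (h13 : s.nvar 13 = pb) :
    Halts F addRow s fun t s' => t ≤ 7 * n + 3 ∧
      (∀ l < n, 0 < s'.narr 1 (p + l) ↔ F.RowMem e l) ∧
      (∀ a, a < p ∨ p + n ≤ a → s'.narr 1 a = s.narr 1 a) ∧
      (∀ l < n, s'.narr 2 (pb + l) = s.narr 2 (pb + l) + if F.RowMem e l then pw else 0) ∧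
      (∀ a, a < pb ∨ pb + n ≤ a → s'.narr 2 a = s.narr 2 a) := by
  unfold addRow
  refine Halts.for (by decide) (by decide) (by decide) 4
    (fun k s' => (∀ l < k, 0 < s'.narr 1 (p + l) ↔ F.RowMem e l) ∧
      (∀ a, a < p ∨ p + k ≤ a → s'.narr 1 a = s.narr 1 a) ∧
      (∀ l < k, s'.narr 2 (pb + l) = s.narr 2 (pb + l) + if F.RowMem e l then pw else 0) ∧
      (∀ a, a < pb ∨ pb + k ≤ a → s'.narr 2 a = s.narr 2 a)) ?_ ?_ ?_
  · simp
  · rintro k s' hk hk7 hf ⟨hfl, hflo, had, hado⟩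
    rw [h0] at hk
    have e5 : s'.nvar 5 = e / n := by rw [hf.nvar 5 (by decide), h5]
    have e6 : s'.nvar 6 = e % n := by rw [hf.nvar 6 (by decide), h6]
    have e11 : s'.nvar 11 = pw := by rw [hf.nvar 11 (by decide), h11]
    have e12 : s'.nvar 12 = p := by rw [hf.nvar 12 (by decide), h12]
    have e13 : s'.nvar 13 = pb := by rw [hf.nvar 13 (by decide), h13]
    rw [halts_ite, holds_rowTest e5 e6 hk7]
    simp only [halts_seq, halts_storeN, NExpr.eval, Mem.nvar_storeN, e11, e12, e13, hk7]
    refine ⟨fun hrow => ⟨by omega, ?_, ?_, ?_, ?_⟩, fun hrow => ⟨by omega, ?_, ?_, ?_, ?_⟩⟩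
    · intro l hl
      simp only [Mem.narr_setN, Mem.narr_storeN, OfNat.one_ne_ofNat, if_false, if_true]
      rcases Nat.lt_succ_iff_lt_or_eq.1 hl with h | rfl
      · rw [Function.update_of_ne (by omega)]; exact hfl l h
      · rw [Function.update_self]; simp [hrow]
    · intro a ha
      simp only [Mem.narr_setN, Mem.narr_storeN, OfNat.one_ne_ofNat, if_false, if_true]
      rw [Function.update_of_ne (by omega)]; exact hflo a (by omega)
    · intro l hl
      simp only [Mem.narr_setN, Mem.narr_storeN, OfNat.ofNat_ne_one, if_false, if_true]
      rcases Nat.lt_succ_iff_lt_or_eq.1 hl with h | rfl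
      · rw [Function.update_of_ne (by omega)]; exact had l h
      · rw [Function.update_self, if_pos hrow, hado _ (Or.inr le_rfl)]
    · intro a ha
      simp only [Mem.narr_setN, Mem.narr_storeN, OfNat.ofNat_ne_one, if_false, if_true]
      rw [Function.update_of_ne (by omega)]; exact hado a (by omega)
    · intro l hl
      simp only [Mem.narr_setN, Mem.narr_storeN, if_true]
      rcases Nat.lt_succ_iff_lt_or_eq.1 hl with h | rfl
      · rw [Function.update_of_ne (by omega)]; exact hfl l h
      · rw [Function.update_self]; simp [hrow]
    · intro a ha
      simp only [Mem.narr_setN, Mem.narr_storeN, if_true]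
      rw [Function.update_of_ne (by omega)]; exact hflo a (by omega)
    · intro l hl
      simp only [Mem.narr_setN, Mem.narr_storeN, OfNat.ofNat_ne_one, if_false]
      rcases Nat.lt_succ_iff_lt_or_eq.1 hl with h | rfl
      · exact had l h
      · rw [if_neg hrow, add_zero]; exact hado _ (Or.inr le_rfl)
    · intro a ha
      simp only [Mem.narr_setN, Mem.narr_storeN, OfNat.ofNat_ne_one, if_false]
      exact hado a (by omega)
  · rintro t s' ht _ _ ⟨hfl, hflo, had, hado⟩
    rw [h0] at ht hfl hflo had hado
    exact ⟨by omega, hfl, hflo, had, hado⟩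

/-- Initialize the addresses of the current block. -/
def initAddr : Cmd := .for 7 0 (.storeN 2 (.add (.var 13) (.var 7)) (.var 14))

theorem initAddr_halts {s : Mem} {pb q : ℕ} (h0 : s.nvar 0 = n) (h13 : s.nvar 13 = pb)
    (h14 : s.nvar 14 = q) :
    Halts F initAddr s fun t s' => t ≤ 4 * n + 3 ∧ (∀ l < n, s'.narr 2 (pb + l) = q) ∧
      (∀ a, a < pb ∨ pb + n ≤ a → s'.narr 2 a = s.narr 2 a) := by
  unfold initAddr
  refine Halts.for (by decide) (by decide) (by decide) 1
    (fun k s' => (∀ l < k, s'.narr 2 (pb + l) = q) ∧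
      (∀ a, a < pb ∨ pb + k ≤ a → s'.narr 2 a = s.narr 2 a)) ?_ ?_ ?_
  · simp
  · rintro k s' hk hk7 hf ⟨hin, hout⟩
    have e13 : s'.nvar 13 = pb := by rw [hf.nvar 13 (by decide), h13]
    have e14 : s'.nvar 14 = q := by rw [hf.nvar 14 (by decide), h14]
    simp only [halts_storeN, NExpr.eval, e13, e14, hk7]
    refine ⟨le_rfl, ?_, ?_⟩
    · intro l hl
      simp only [Mem.narr_setN, Mem.narr_storeN, if_true]
      rcases Nat.lt_succ_iff_lt_or_eq.1 hl with h | rfl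
      · rw [Function.update_of_ne (by omega)]; exact hin l h
      · rw [Function.update_self]
    · intro a ha
      simp only [Mem.narr_setN, Mem.narr_storeN, if_true]
      rw [Function.update_of_ne (by omega)]; exact hout a (by omega)
  · rintro t s' ht _ _ ⟨hin, hout⟩
    rw [h0] at ht hin hout
    exact ⟨by omega, hin, hout⟩

/-- Enter the rows of the current block. -/
def addBlock : Cmd :=
  .seq initAddr <|
  .seq (.setN 11 (.const 1)) <|
  .for 8 1 <|
    .seq addRow <|
    .seq (.storeN 3 (.add (.var 15) (.var 8)) (.const 1)) <|
    .seq (.setN 12 (.add (.var 12) (.var 0))) <|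
    .seq (.setN 11 (.add (.var 11) (.var 11))) <|
    .seq (.setN 6 (.add (.var 6) (.const 1)))
      (.ite (.natLt (.var 6) (.var 0)) .skip
        (.seq (.setN 6 (.const 0)) (.setN 5 (.add (.var 5) (.const 1)))))

/-- The two objects of a row are the quotient and remainder of its index by `n`. Indices cannot be
divided, so both are maintained by counting with carry. -/
theorem succ_div_mod_of_lt {e : ℕ} (hn : 1 ≤ n) (h : e % n + 1 < n) :
    (e + 1) / n = e / n ∧ (e + 1) % n = e % n + 1 := by
  have hd := Nat.div_add_mod e n
  have he : e + 1 = n * (e / n) + (e % n + 1) := by omega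
  constructor
  · rw [he, Nat.mul_add_div (by omega), Nat.div_eq_of_lt h, Nat.add_zero]
  · conv_lhs => rw [he]
    rw [Nat.mul_add_mod, Nat.mod_eq_of_lt h]

theorem succ_div_mod_of_eq {e : ℕ} (hn : 1 ≤ n) (h : ¬ e % n + 1 < n) :
    (e + 1) / n = e / n + 1 ∧ (e + 1) % n = 0 := by
  have hd := Nat.div_add_mod e n
  have hm := Nat.mod_lt e (by omega : n > 0)
  have he : e + 1 = n * (e / n + 1) := by rw [Nat.mul_add, Nat.mul_one]; omega
  constructor
  · rw [he, Nat.mul_div_cancel_left _ (by omega)]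
  · rw [he, Nat.mul_mod_right]

/-- Each row `r` of the block adds `2 ^ r` to the addresses of its objects. Starting from the offset
of the table, an address becomes that of the entry for the object's membership pattern. -/
theorem addBlock_halts {s : Mem} {bs g : ℕ} (hn : 1 ≤ n) (h0 : s.nvar 0 = n) (h1 : s.nvar 1 = bs)
    (h5 : s.nvar 5 = g * bs / n) (h6 : s.nvar 6 = g * bs % n) (h12 : s.nvar 12 = g * bs * n)
    (h13 : s.nvar 13 = g * n) (h14 : s.nvar 14 = g * 2 ^ bs) (h15 : s.nvar 15 = g * bs) :
    Halts F addBlock s fun t s' => t ≤ 4 * n + 10 + bs * (7 * n + 30) ∧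
      s'.nvar 5 = (g + 1) * bs / n ∧ s'.nvar 6 = (g + 1) * bs % n ∧
      s'.nvar 12 = (g + 1) * bs * n ∧
      (∀ r < bs, ∀ l < n, 0 < s'.narr 1 ((g * bs + r) * n + l) ↔ F.RowMem (g * bs + r) l) ∧
      (∀ a, a < g * bs * n → s'.narr 1 a = s.narr 1 a) ∧
      (∀ l < n, s'.narr 2 (g * n + l) =
        g * 2 ^ bs + bitSum (fun r => F.RowMem (g * bs + r) l) bs) ∧
      (∀ a, a < g * n → s'.narr 2 a = s.narr 2 a) ∧
      (∀ r < bs, s'.narr 3 (g * bs + r) = 1) ∧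
      (∀ a, a < g * bs → s'.narr 3 a = s.narr 3 a) := by
  classical
  unfold addBlock
  rw [halts_seq]
  refine (initAddr_halts h0 h13 h14).mono ?_
  rintro t₀ s₀ hf₀ ⟨ht₀, hin₀, hout₀⟩
  rw [halts_seq, halts_setN]
  simp only [NExpr.eval]
  refine Halts.for (by decide) (by decide) (by decide) (7 * n + 27)
    (fun r s' => s'.nvar 5 = (g * bs + r) / n ∧ s'.nvar 6 = (g * bs + r) % n ∧
      s'.nvar 11 = 2 ^ r ∧ s'.nvar 12 = (g * bs + r) * n ∧
      (∀ r' < r, ∀ l < n, 0 < s'.narr 1 ((g * bs + r') * n + l) ↔ F.RowMem (g * bs + r') l) ∧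
      (∀ a, a < g * bs * n → s'.narr 1 a = s.narr 1 a) ∧
      (∀ l < n, s'.narr 2 (g * n + l) =
        g * 2 ^ bs + bitSum (fun r => F.RowMem (g * bs + r) l) r) ∧
      (∀ a, a < g * n → s'.narr 2 a = s.narr 2 a) ∧
      (∀ r' < r, s'.narr 3 (g * bs + r') = 1) ∧
      (∀ a, a < g * bs → s'.narr 3 a = s.narr 3 a)) ?_ ?_ ?_
  · refine ⟨?_, ?_, by simp, ?_, by simp, ?_, ?_, ?_, by simp, ?_⟩
    · simp [hf₀.nvar 5 (by decide), h5]
    · simp [hf₀.nvar 6 (by decide), h6]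
    · simp [hf₀.nvar 12 (by decide), h12]
    · intro a _; simp [hf₀.narr 1 (by decide)]
    · intro l hl; simp [hin₀ l hl, bitSum]
    · intro a ha; simp [hout₀ a (Or.inl ha)]
    · intro a _; simp [hf₀.narr 3 (by decide)]
  · rintro r s' hr hr8 hf ⟨i5, i6, i11, i12, hfl, hflo, had, hado, hw, hwo⟩
    have e0 : s'.nvar 0 = n := by
      rw [hf.nvar 0 (by decide)]; simp [hf₀.nvar 0 (by decide), h0]
    have e13 : s'.nvar 13 = g * n := by
      rw [hf.nvar 13 (by decide)]; simp [hf₀.nvar 13 (by decide), h13]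
    have e15 : s'.nvar 15 = g * bs := by
      rw [hf.nvar 15 (by decide)]; simp [hf₀.nvar 15 (by decide), h15]
    rw [halts_seq]
    refine (addRow_halts e0 i5 i6 i11 i12 e13).mono ?_
    rintro t₁ s₁ hf₁ ⟨ht₁, hfl₁, hflo₁, had₁, hado₁⟩
    have f0 : s₁.nvar 0 = n := by rw [hf₁.nvar 0 (by decide), e0]
    have f5 : s₁.nvar 5 = (g * bs + r) / n := by rw [hf₁.nvar 5 (by decide), i5]
    have f6 : s₁.nvar 6 = (g * bs + r) % n := by rw [hf₁.nvar 6 (by decide), i6]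
    have f8 : s₁.nvar 8 = r := by rw [hf₁.nvar 8 (by decide), hr8]
    have f11 : s₁.nvar 11 = 2 ^ r := by rw [hf₁.nvar 11 (by decide), i11]
    have f12 : s₁.nvar 12 = (g * bs + r) * n := by rw [hf₁.nvar 12 (by decide), i12]
    have f15 : s₁.nvar 15 = g * bs := by rw [hf₁.nvar 15 (by decide), e15]
    have f3 : s₁.narr 3 = s'.narr 3 := hf₁.narr 3 (by decide)
    have hcommon : (∀ r' < r + 1, ∀ l < n,
          0 < s₁.narr 1 ((g * bs + r') * n + l) ↔ F.RowMem (g * bs + r') l) ∧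
        (∀ a, a < g * bs * n → s₁.narr 1 a = s.narr 1 a) ∧
        (∀ l < n, s₁.narr 2 (g * n + l) =
          g * 2 ^ bs + bitSum (fun r => F.RowMem (g * bs + r) l) (r + 1)) ∧
        (∀ a, a < g * n → s₁.narr 2 a = s.narr 2 a) := by
      refine ⟨fun r' hr' l hl => ?_, fun a ha => ?_, fun l hl => ?_, fun a ha => ?_⟩
      · rcases Nat.lt_succ_iff_lt_or_eq.1 hr' with h | rfl
        · have hlt : (g * bs + r') * n + l < (g * bs + r) * n := by
            calc (g * bs + r') * n + l < (g * bs + r' + 1) * n := by rw [Nat.succ_mul]; omega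
              _ ≤ _ := Nat.mul_le_mul_right _ (by omega)
          rw [hflo₁ _ (Or.inl hlt)]
          exact hfl r' h l hl
        · exact hfl₁ l hl
      · have : g * bs * n ≤ (g * bs + r) * n := Nat.mul_le_mul_right _ (by omega)
        rw [hflo₁ a (Or.inl (by omega)), hflo a ha]
      · rw [had₁ l hl, had l hl, bitSum_succ, add_assoc]
      · rw [hado₁ a (Or.inl ha), hado a ha]
    obtain ⟨c1, c2, c3, c4⟩ := hcommon
    have hcw : (∀ r' < r + 1, Function.update (s'.narr 3) (g * bs + r) 1 (g * bs + r') = 1) ∧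
        (∀ a, a < g * bs → Function.update (s'.narr 3) (g * bs + r) 1 a = s.narr 3 a) := by
      refine ⟨fun r' hr' => ?_, fun a ha => ?_⟩
      · rcases Nat.lt_succ_iff_lt_or_eq.1 hr' with h | rfl
        · rw [Function.update_of_ne (by omega)]; exact hw r' h
        · rw [Function.update_self]
      · rw [Function.update_of_ne (by omega)]; exact hwo a ha
    have hpow : 2 ^ r + 2 ^ r = 2 ^ (r + 1) := by rw [pow_succ]; omega
    have hrow : (g * bs + r) * n + n = (g * bs + (r + 1)) * n := by ring
    have hassoc : g * bs + (r + 1) = g * bs + r + 1 := rfl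
    simp only [halts_seq, halts_setN, halts_storeN, halts_ite, halts_skip, NExpr.eval, BExpr.holds]
    constructor
    · intro hlt
      simp [f6, f0] at hlt
      obtain ⟨d1, d2⟩ := succ_div_mod_of_lt hn hlt
      refine ⟨by omega, ?_, ?_, ?_, ?_, ?_, ?_, ?_, ?_, ?_, ?_⟩
      · simp [f5, hassoc, d1]
      · simp [f6, hassoc, d2]
      · simp [f11, hpow]
      · simp [f12, f0, hrow]
      · simpa using c1
      · simpa using c2
      · simpa using c3
      · simpa using c4
      · simpa [f15, f8, f3] using hcw.1
      · simpa [f15, f8, f3] using hcw.2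
    · intro hlt
      simp [f6, f0] at hlt
      obtain ⟨d1, d2⟩ := succ_div_mod_of_eq hn (not_lt.2 hlt)
      refine ⟨by omega, ?_, ?_, ?_, ?_, ?_, ?_, ?_, ?_, ?_, ?_⟩
      · simp [f5, hassoc, d1]
      · simp [hassoc, d2]
      · simp [f11, hpow]
      · simp [f12, f0, hrow]
      · simpa using c1
      · simpa using c2
      · simpa using c3
      · simpa using c4
      · simpa [f15, f8, f3] using hcw.1
      · simpa [f15, f8, f3] using hcw.2
  · rintro t s' ht - - ⟨i5, i6, -, i12, hfl, hflo, had, hado, hw, hwo⟩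
    have e1 : s₀.nvar 1 = bs := by rw [hf₀.nvar 1 (by decide), h1]
    simp [e1] at ht i5 i6 i12 hfl had hw
    have hs : (g + 1) * bs = g * bs + bs := Nat.succ_mul _ _
    have he : 7 * n + 27 + 3 = 7 * n + 30 := rfl
    rw [he] at ht
    refine ⟨by omega, ?_, ?_, ?_, hfl, hflo, had, hado, hw, hwo⟩
    · rw [i5, hs]
    · rw [i6, hs]
    · rw [i12, hs]

/-- Enter all blocks. -/
def build : Cmd :=
  .seq (.setN 5 (.const 0)) <|
  .seq (.setN 6 (.const 0)) <|
  .loop (.natLt (.var 5) (.var 0)) <|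
    .seq addBlock <|
    .seq rebuild <|
    .seq (.setN 13 (.add (.var 13) (.var 0))) <|
    .seq (.setN 14 (.add (.var 14) (.var 2))) <|
    .seq (.setN 15 (.add (.var 15) (.var 1)))
      (.setN 16 (.add (.var 16) (.const 1)))

/-- The number of steps of `build` for one block is at most this. -/
def blockTime (n bs : ℕ) : ℕ := 4 * n + 30 + bs * (7 * n + 30) + rebuildTime bs

/-- The last block may run past row `n * n - 1`. Such rows have `e / n ≥ n`, so they contain no
object and only enlarge the row count `G * bs`. -/
theorem build_halts {s : Mem} {bs : ℕ} (hn : 1 ≤ n) (hbs : 1 ≤ bs) (h0 : s.nvar 0 = n)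
    (h1 : s.nvar 1 = bs) (h2 : s.nvar 2 = 2 ^ bs) (h20 : s.nvar 20 = bs * n)
    (h12 : s.nvar 12 = 0) (h13 : s.nvar 13 = 0) (h14 : s.nvar 14 = 0) (h15 : s.nvar 15 = 0)
    (h16 : s.nvar 16 = 0) (hx : s.narr 5 = fun _ => 0) :
    Halts F build s fun t s' => ∃ G, n * n ≤ G * bs ∧ G * bs ≤ n * n + bs ∧
      t ≤ G * blockTime n bs + 5 ∧ Layout F bs G s' ∧ Represents F bs G (fun _ => 0) s' := by
  unfold build
  simp only [halts_seq, halts_setN, NExpr.eval]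
  have hload : ∀ e, F.load (fun _ => 0) e = 0 := fun e => by simp [WeightedObjects.load]
  refine Halts.loop (fun t s' => ∃ g, g * bs ≤ n * n + bs ∧ t ≤ g * blockTime n bs ∧
    s'.nvar 5 = g * bs / n ∧ s'.nvar 6 = g * bs % n ∧ s'.nvar 12 = g * bs * n ∧
    s'.nvar 13 = g * n ∧ s'.nvar 14 = g * 2 ^ bs ∧ s'.nvar 15 = g * bs ∧
    Layout F bs g s' ∧ Represents F bs g (fun _ => 0) s')
    (fun s' => n * n + bs - s'.nvar 15) ?_ ?_ ?_
  · refine ⟨0, by simp, by simp, by simp, by simp, by simp [h12], by simp [h13], by simp [h14],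
      by simp [h15], ⟨by simp [h0], by simp [h1], by simp [h2], by simp [h16], by simp [h20],
        by simp, by simp⟩, ⟨by simp, by simp, by simp [hx]⟩⟩
  · rintro t s' hf ⟨g, hg, ht, i5, i6, i12, i13, i14, i15, hL, hR⟩ hb
    simp only [BExpr.holds, NExpr.eval, i5, hL.nvar_zero] at hb
    have hlt : g * bs < n * n := by
      by_contra hcon
      exact absurd ((Nat.le_div_iff_mul_le (by omega)).2 (not_lt.1 hcon)) (not_le.2 hb)
    rw [halts_seq]
    refine (addBlock_halts hn hL.nvar_zero hL.nvar_one i5 i6 i12 i13 i14 i15).mono ?_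
    rintro t₁ s₁ hf₁ ⟨ht₁, j5, j6, j12, hfl, hflo, had, hado, hw, hwo⟩
    have e1 : s₁.nvar 1 = bs := by rw [hf₁.nvar 1 (by decide), hL.nvar_one]
    have e14 : s₁.nvar 14 = g * 2 ^ bs := by rw [hf₁.nvar 14 (by decide), i14]
    have e15 : s₁.nvar 15 = g * bs := by rw [hf₁.nvar 15 (by decide), i15]
    have e4 : s₁.narr 4 = s'.narr 4 := hf₁.narr 4 (by decide)
    rw [halts_seq]
    refine (rebuild_halts e1 e14 e15).mono ?_
    rintro t₂ s₂ hf₂ ⟨ht₂, hin, hout⟩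
    have k0 : s₂.nvar 0 = n := by
      rw [hf₂.nvar 0 (by decide), hf₁.nvar 0 (by decide), hL.nvar_zero]
    have k1 : s₂.nvar 1 = bs := by rw [hf₂.nvar 1 (by decide), e1]
    have k2 : s₂.nvar 2 = 2 ^ bs := by
      rw [hf₂.nvar 2 (by decide), hf₁.nvar 2 (by decide), hL.nvar_two]
    have k5 : s₂.nvar 5 = (g + 1) * bs / n := by rw [hf₂.nvar 5 (by decide), j5]
    have k6 : s₂.nvar 6 = (g + 1) * bs % n := by rw [hf₂.nvar 6 (by decide), j6]
    have k12 : s₂.nvar 12 = (g + 1) * bs * n := by rw [hf₂.nvar 12 (by decide), j12]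
    have k13 : s₂.nvar 13 = g * n := by
      rw [hf₂.nvar 13 (by decide), hf₁.nvar 13 (by decide), i13]
    have k14 : s₂.nvar 14 = g * 2 ^ bs := by rw [hf₂.nvar 14 (by decide), e14]
    have k15 : s₂.nvar 15 = g * bs := by rw [hf₂.nvar 15 (by decide), e15]
    have k16 : s₂.nvar 16 = g := by
      rw [hf₂.nvar 16 (by decide), hf₁.nvar 16 (by decide), hL.nvar_blocks]
    have k20 : s₂.nvar 20 = bs * n := by
      rw [hf₂.nvar 20 (by decide), hf₁.nvar 20 (by decide), hL.nvar_flags]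
    have m1 : s₂.narr 1 = s₁.narr 1 := hf₂.narr 1 (by decide)
    have m2 : s₂.narr 2 = s₁.narr 2 := hf₂.narr 2 (by decide)
    have m3 : s₂.narr 3 = s₁.narr 3 := hf₂.narr 3 (by decide)
    have m5 : s₂.narr 5 = s'.narr 5 := (hf₂.narr 5 (by decide)).trans (hf₁.narr 5 (by decide))
    have hs : (g + 1) * bs = g * bs + bs := Nat.succ_mul _ _
    simp only [halts_seq, halts_setN, NExpr.eval]
    refine ⟨⟨g + 1, by omega, ?_, by simp [k5], by simp [k6], by simp [k12], ?_, ?_, ?_,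
      ⟨by simp [k0], by simp [k1], by simp [k2], by simp [k16], by simp [k20], ?_, ?_⟩,
      ⟨?_, ?_, ?_⟩⟩, ?_⟩
    · rw [Nat.succ_mul]
      have : t₁ + t₂ + 20 ≤ blockTime n bs := by unfold blockTime; omega
      omega
    · simp [k13, k0]; ring
    · simp [k14, k2]; ring
    · simp [k15, k1]; ring
    · intro e he l hl
      simp only [Mem.narr_setN, m1]
      by_cases h : e < g * bs
      · have hlt : e * n + l < g * bs * n := by
          calc e * n + l < (e + 1) * n := by rw [Nat.succ_mul]; omega
            _ ≤ _ := Nat.mul_le_mul_right _ h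
        rw [hflo _ hlt]
        exact hL.flag e h l hl
      · obtain ⟨r, rfl⟩ := Nat.exists_eq_add_of_le (not_lt.1 h)
        exact hfl r (by omega) l hl
    · intro g' hg' l hl
      simp only [Mem.narr_setN, m2]
      rcases Nat.lt_succ_iff_lt_or_eq.1 hg' with h | rfl
      · have hlt : g' * n + l < g * n := by
          calc g' * n + l < (g' + 1) * n := by rw [Nat.succ_mul]; omega
            _ ≤ _ := Nat.mul_le_mul_right _ h
        rw [hado _ hlt]
        exact hL.addr g' h l hl
      · exact had l hl
    · intro e he
      simp only [Mem.narr_setN, m3]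
      by_cases h : e < g * bs
      · rw [hwo e h]; exact hR.weight e h
      · obtain ⟨r, rfl⟩ := Nat.exists_eq_add_of_le (not_lt.1 h)
        rw [hw r (by omega), hload, pow_zero]
    · intro g' hg' v hv
      simp only [Mem.narr_setN]
      rcases Nat.lt_succ_iff_lt_or_eq.1 hg' with h | rfl
      · have hlt : g' * 2 ^ bs + v < g * 2 ^ bs := by
          calc g' * 2 ^ bs + v < (g' + 1) * 2 ^ bs := by rw [Nat.succ_mul]; omega
            _ ≤ _ := Nat.mul_le_mul_right _ h
        rw [hout _ (Or.inl hlt), e4]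
        exact hR.table g' h v hv
      · rw [hin v hv]
        exact tableSum_congr (fun r hr => by rw [hw r hr, hload, pow_zero]) v
    · intro l hl
      simp only [Mem.narr_setN, m5]
      exact hR.mult l hl
    · simp [k15, k1, i15]
      omega
  · rintro t s' hf ⟨g, hg, ht, i5, i6, i12, i13, i14, i15, hL, hR⟩ hb
    simp only [BExpr.holds, NExpr.eval, i5, hL.nvar_zero, not_lt] at hb
    exact ⟨g, (Nat.le_div_iff_mul_le (by omega)).1 hb, hg, by omega, hL, hR⟩

end Program

namespace Program

variable {n : ℕ} {F : WeightedObjects n}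

/-! ### The multiplicative weights loop -/

/-- Raise object `7` as long as its cost is below the threshold. -/
def raiseLoop : Cmd :=
  .seq check <|
  .loop (.realLt (.mul (.ofNat (.var 17)) (.var 0)) (.mul (.ofNat (.var 18)) (.arr 0 (.var 7)))) <|
    .seq raise check

/-- All phases of the multiplicative weights method. -/
def mwu : Cmd :=
  .seq (.setN 18 (.const 1)) <|
  .for 19 4 <|
    .seq (.for 7 0 raiseLoop) (.setN 18 (.add (.var 18) (.var 18)))

/-- A bound for the time spent on raising and checking object `l` once. -/
noncomputable def raiseCheckTime (F : WeightedObjects n) (bs G l : ℕ) : ℕ :=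
  raiseTime F bs G l + (6 * G + 7) + 2

/-- A bound for the time spent on raising the objects to the multiplicities `x`. -/
noncomputable def totalRaiseTime (F : WeightedObjects n) (bs G : ℕ) (x : ℕ → ℕ) : ℕ :=
  ∑ l ∈ Finset.range n, x l * raiseCheckTime F bs G l

theorem totalRaiseTime_raised (bs G : ℕ) (x : ℕ → ℕ) {l : ℕ} (hl : l < n) :
    totalRaiseTime F bs G (WeightedObjects.raised x l) =
      totalRaiseTime F bs G x + raiseCheckTime F bs G l := by
  have hm : l ∈ Finset.range n := Finset.mem_range.2 hl
  rw [totalRaiseTime, totalRaiseTime, ← Finset.add_sum_erase _ _ hm,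
    ← Finset.add_sum_erase (a := l) _ _ hm]
  have : ∑ i ∈ (Finset.range n).erase l, WeightedObjects.raised x l i * raiseCheckTime F bs G i =
      ∑ i ∈ (Finset.range n).erase l, x i * raiseCheckTime F bs G i := by
    refine Finset.sum_congr rfl fun i hi => ?_
    rw [WeightedObjects.raised, Function.update_of_ne (Finset.ne_of_mem_erase hi)]
  rw [this, WeightedObjects.raised, Function.update_self]
  ring

/-- The state of the multiplicative weights method in phase `k`. -/
structure MwuState (F : WeightedObjects n) (bs G k : ℕ) (wmax : ℝ) (x : ℕ → ℕ) (s : Mem) :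
    Prop where
  layout : Layout F bs G s
  represents : Represents F bs G x s
  invariant : F.MwuInvariant (G * bs) k wmax x
  rvar_max : s.rvar 0 = wmax
  rarr_weight : s.rarr 0 = F.weightAt
  threshold : s.nvar 18 = 2 ^ k

/-- One pass over the objects completes a phase, since raising never lowers a cost and finished
objects stay finished. The loop ends because the multiplicity of `l` is at most the load of its own
row, hence at most `k`. -/
theorem raiseLoop_halts {s : Mem} {bs G k l : ℕ} {wmax : ℝ} {x : ℕ → ℕ}
    (hS : MwuState F bs G k wmax x s) (hM : n * n ≤ G * bs)
    (hw : ∀ j < n, F.weightAt j ≤ wmax) (h7 : s.nvar 7 = l) (hl : l < n)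
    (hdone : ∀ j < l, 2 ^ k * F.weightAt j ≤ F.cost (G * bs) x j * wmax) :
    Halts F raiseLoop s fun t s' => ∃ x', MwuState F bs G k wmax x' s' ∧
      (∀ j < l + 1, 2 ^ k * F.weightAt j ≤ F.cost (G * bs) x' j * wmax) ∧
      t + totalRaiseTime F bs G x ≤ totalRaiseTime F bs G x' + (6 * G + 10) := by
  unfold raiseLoop
  rw [halts_seq]
  refine (check_halts hS.layout hS.represents h7 hl).mono ?_
  rintro t₀ s₀ hf₀ ⟨ht₀, h17⟩
  refine Halts.loop (fun t s' => ∃ x', MwuState F bs G k wmax x' s' ∧ s'.nvar 7 = l ∧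
    s'.nvar 17 = F.cost (G * bs) x' l ∧
    (∀ j < l, 2 ^ k * F.weightAt j ≤ F.cost (G * bs) x' j * wmax) ∧
    t + totalRaiseTime F bs G x ≤ totalRaiseTime F bs G x') (fun s' => k - s'.narr 5 l) ?_ ?_ ?_
  · refine ⟨x, ⟨?_, ?_, hS.invariant, ?_, ?_, ?_⟩, ?_, h17, hdone, by omega⟩
    · exact hS.layout.frame hf₀ (by decide) (by decide) (by decide) (by decide) (by decide)
        (by decide) (by decide)
    · exact hS.represents.congr (hf₀.narr 3 (by decide)) (hf₀.narr 4 (by decide))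
        (hf₀.narr 5 (by decide))
    · rw [hf₀.rvar 0 (by decide), hS.rvar_max]
    · rw [hf₀.rarr 0 (by decide), hS.rarr_weight]
    · rw [hf₀.nvar 18 (by decide), hS.threshold]
    · rw [hf₀.nvar 7 (by decide), h7]
  · rintro t s' - ⟨x', hS', e7, e17, hdone', ht⟩ hb
    simp only [BExpr.holds, RExpr.eval, NExpr.eval, e17, e7, hS'.rvar_max, hS'.rarr_weight,
      hS'.threshold] at hb
    push_cast at hb
    have hinv := hS'.invariant.raised hw hl hb
    rw [halts_seq]
    refine (raise_halts hS'.layout hS'.represents e7 hl).mono ?_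
    rintro t₁ s₁ hf₁ ⟨ht₁, hR₁⟩
    have hL₁ : Layout F bs G s₁ := hS'.layout.frame hf₁ (by decide) (by decide) (by decide)
      (by decide) (by decide) (by decide) (by decide)
    have f7 : s₁.nvar 7 = l := by rw [hf₁.nvar 7 (by decide), e7]
    refine (check_halts hL₁ hR₁ f7 hl).mono ?_
    rintro t₂ s₂ hf₂ ⟨ht₂, g17⟩
    have g5 : s₂.narr 5 = s₁.narr 5 := hf₂.narr 5 (by decide)
    refine ⟨⟨WeightedObjects.raised x' l, ⟨?_, ?_, hinv, ?_, ?_, ?_⟩, ?_, g17, ?_, ?_⟩, ?_⟩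
    · exact hL₁.frame hf₂ (by decide) (by decide) (by decide) (by decide) (by decide)
        (by decide) (by decide)
    · exact hR₁.congr (hf₂.narr 3 (by decide)) (hf₂.narr 4 (by decide)) g5
    · rw [hf₂.rvar 0 (by decide), hf₁.rvar 0 (by decide), hS'.rvar_max]
    · rw [hf₂.rarr 0 (by decide), hf₁.rarr 0 (by decide), hS'.rarr_weight]
    · rw [hf₂.nvar 18 (by decide), hf₁.nvar 18 (by decide), hS'.threshold]
    · rw [hf₂.nvar 7 (by decide), f7]
    · intro j hj
      have hwm : 0 ≤ wmax := (F.weightAt_pos hl).le.trans (hw l hl)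
      refine (hdone' j hj).trans (mul_le_mul_of_nonneg_right ?_ hwm)
      exact_mod_cast WeightedObjects.cost_le_cost_raised _ _ _ _
    · rw [totalRaiseTime_raised _ _ _ hl, raiseCheckTime]
      omega
    · have h1 := WeightedObjects.le_load (x := WeightedObjects.raised x' l)
        (WeightedObjects.rowMem_diag (F := F) hl)
      have h2 := hinv.load_le _ ((WeightedObjects.diag_lt hl).trans_le hM)
      rw [g5, hR₁.mult l hl, hS'.represents.mult l hl]
      have h3 : WeightedObjects.raised x' l l = x' l + 1 := by simp [WeightedObjects.raised]
      omega
  · rintro t s' - ⟨x', hS', e7, e17, hdone', ht⟩ hb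
    simp only [BExpr.holds, RExpr.eval, NExpr.eval, e17, e7, hS'.rvar_max, hS'.rarr_weight,
      hS'.threshold, not_lt] at hb
    push_cast at hb
    refine ⟨x', hS', fun j hj => ?_, by omega⟩
    rcases Nat.lt_succ_iff_lt_or_eq.1 hj with h | rfl
    · exact hdone' j h
    · exact hb

/-- The time is compared with `totalRaiseTime` of the current multiplicities, which acts as a
potential: all raises are estimated together at the end, from the final loads, and not phase by
phase. -/
theorem mwu_halts {s : Mem} {bs G N : ℕ} {wmax : ℝ} (hL : Layout F bs G s)
    (hR : Represents F bs G (fun _ => 0) s) (hM : n * n ≤ G * bs)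
    (hw : ∀ j < n, F.weightAt j ≤ wmax) (hwm : s.rvar 0 = wmax) (hwt : s.rarr 0 = F.weightAt)
    (h4 : s.nvar 4 = N) :
    Halts F mwu s fun t s' => ∃ x, F.MwuInvariant (G * bs) N wmax x ∧ (∀ l < n, s'.narr 5 l = x l) ∧
      t ≤ N * (n * (6 * G + 13) + 10) + 10 + totalRaiseTime F bs G x := by
  unfold mwu
  rw [halts_seq, halts_setN]
  simp only [NExpr.eval]
  refine Halts.for_time (by decide) (by decide) (by decide)
    (fun k t s' => ∃ x, MwuState F bs G k wmax x s' ∧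
      t ≤ k * (n * (6 * G + 13) + 10) + totalRaiseTime F bs G x) ?_ ?_ ?_
  · refine ⟨fun _ => 0, ⟨?_, ?_, .zero hM hw, by simp [hwm], by simp [hwt], by simp⟩, by simp⟩
    · exact ⟨by simp [hL.nvar_zero], by simp [hL.nvar_one], by simp [hL.nvar_two],
        by simp [hL.nvar_blocks], by simp [hL.nvar_flags], by simpa using hL.flag,
        by simpa using hL.addr⟩
    · exact hR.congr (by simp) (by simp) (by simp)
  · rintro k t s' hk - - ⟨x, hS, ht⟩
    rw [halts_seq]
    refine Halts.for_time (by decide) (by decide) (by decide)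
      (fun l t' s'' => ∃ x', MwuState F bs G k wmax x' s'' ∧
        (∀ j < l, 2 ^ k * F.weightAt j ≤ F.cost (G * bs) x' j * wmax) ∧
        t' + totalRaiseTime F bs G x ≤ l * (6 * G + 13) + totalRaiseTime F bs G x') ?_ ?_ ?_
    · refine ⟨x, ⟨?_, hS.represents.congr (by simp) (by simp) (by simp), hS.invariant,
        by simp [hS.rvar_max], by simp [hS.rarr_weight], by simp [hS.threshold]⟩, by simp, by simp⟩
      have hL' := hS.layout
      exact ⟨by simp [hL'.nvar_zero], by simp [hL'.nvar_one], by simp [hL'.nvar_two],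
        by simp [hL'.nvar_blocks], by simp [hL'.nvar_flags], by simpa using hL'.flag,
        by simpa using hL'.addr⟩
    · rintro l t' s'' hl h7 - ⟨x', hS', hdone, ht'⟩
      rw [hS.layout.nvar_zero] at hl
      refine (raiseLoop_halts hS' hM hw h7 hl hdone).mono ?_
      rintro t₁ s₁ - ⟨x₁, hS₁, hdone₁, ht₁⟩
      refine ⟨x₁, ⟨?_, hS₁.represents.congr (by simp) (by simp) (by simp), hS₁.invariant,
        by simp [hS₁.rvar_max], by simp [hS₁.rarr_weight], by simp [hS₁.threshold]⟩, hdone₁, ?_⟩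
      · have hL' := hS₁.layout
        exact ⟨by simp [hL'.nvar_zero], by simp [hL'.nvar_one], by simp [hL'.nvar_two],
          by simp [hL'.nvar_blocks], by simp [hL'.nvar_flags], by simpa using hL'.flag,
          by simpa using hL'.addr⟩
      · rw [Nat.succ_mul]
        omega
    · rintro t' s'' - - ⟨x', hS', hdone, ht'⟩
      rw [hS.layout.nvar_zero] at hdone ht'
      rw [halts_setN]
      simp only [NExpr.eval]
      refine ⟨x', ⟨?_, hS'.represents.congr (by simp) (by simp) (by simp),
        hS'.invariant.next hdone, by simp [hS'.rvar_max], by simp [hS'.rarr_weight], ?_⟩, ?_⟩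
      · have hL' := hS'.layout
        exact ⟨by simp [hL'.nvar_zero], by simp [hL'.nvar_one], by simp [hL'.nvar_two],
          by simp [hL'.nvar_blocks], by simp [hL'.nvar_flags], by simpa using hL'.flag,
          by simpa using hL'.addr⟩
      · simp [hS'.threshold, pow_succ]
        omega
      · rw [Nat.succ_mul]
        omega
  · rintro t s' - - ⟨x, hS, ht⟩
    have e4 : (s.setN 18 1).nvar 4 = N := by simp [h4]
    rw [e4] at hS ht
    exact ⟨x, hS.invariant, hS.represents.mult, by omega⟩

theorem touched_le (F : WeightedObjects n) (bs G l : ℕ) [DecidablePred fun e => F.RowMem e l] :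
    touched F bs G l ≤ ∑ e ∈ Finset.range (G * bs), if F.RowMem e l then 1 else 0 := by
  classical
  rw [sum_range_mul]
  refine Finset.sum_le_sum fun g _ => ?_
  split_ifs with h
  · obtain ⟨r, hr, hrow⟩ := h
    have := Finset.single_le_sum
      (f := fun r => if F.RowMem (g * bs + r) l then 1 else 0)
      (fun _ _ => Nat.zero_le _) (Finset.mem_range.2 hr)
    simp only [hrow, if_true] at this
    exact this
  · exact Nat.zero_le _

/-- The total time for raising, for multiplicities with bounded loads. -/
theorem totalRaiseTime_le {bs G N : ℕ} {x : ℕ → ℕ} (hM : n * n ≤ G * bs)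
    (hload : ∀ e < G * bs, F.load x e ≤ N) :
    totalRaiseTime F bs G x ≤
      n * N * (26 * G + 29) + G * bs * N * (bs * 8 + 8 + rebuildTime bs) := by
  classical
  set Z := bs * 8 + 8 + rebuildTime bs
  have hx : ∀ l ∈ Finset.range n, x l ≤ N := fun l hl => by
    have hl' := Finset.mem_range.1 hl
    exact (WeightedObjects.le_load (WeightedObjects.rowMem_diag (F := F) hl')).trans
      (hload _ ((WeightedObjects.diag_lt hl').trans_le hM))
  have h1 : ∑ l ∈ Finset.range n, x l * (26 * G + 29) ≤ n * N * (26 * G + 29) := by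
    rw [← Finset.sum_mul]
    refine Nat.mul_le_mul_right _ ((Finset.sum_le_sum hx).trans ?_)
    simp
  -- Amortization: an object touches at most as many blocks as it has rows, and its rows, counted
  -- with multiplicity and summed over all objects, give the sum of the loads.
  have h2 : ∑ l ∈ Finset.range n, x l * touched F bs G l ≤ G * bs * N := by
    calc ∑ l ∈ Finset.range n, x l * touched F bs G l
        ≤ ∑ l ∈ Finset.range n, ∑ e ∈ Finset.range (G * bs), if F.RowMem e l then x l else 0 := by
          refine Finset.sum_le_sum fun l _ => ?_
          refine (Nat.mul_le_mul_left _ (touched_le F bs G l)).trans (le_of_eq ?_)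
          rw [Finset.mul_sum]
          refine Finset.sum_congr rfl fun e _ => ?_
          split_ifs <;> simp
      _ = ∑ e ∈ Finset.range (G * bs), F.load x e := Finset.sum_comm
      _ ≤ ∑ _e ∈ Finset.range (G * bs), N :=
          Finset.sum_le_sum fun e he => hload e (Finset.mem_range.1 he)
      _ = G * bs * N := by simp
  calc totalRaiseTime F bs G x
      = ∑ l ∈ Finset.range n, (x l * (26 * G + 29) + x l * touched F bs G l * Z) := by
        refine Finset.sum_congr rfl fun l _ => ?_
        simp only [raiseCheckTime, raiseTime]
        ring
    _ = ∑ l ∈ Finset.range n, x l * (26 * G + 29) +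
        (∑ l ∈ Finset.range n, x l * touched F bs G l) * Z := by
        rw [Finset.sum_add_distrib, Finset.sum_mul]
    _ ≤ _ := Nat.add_le_add h1 (Nat.mul_le_mul_right _ h2)

end Program

/-! ### Intersections and ranks in terms of natural-number indices -/

namespace WeightedObjects

variable {n : ℕ} (F : WeightedObjects n)

/-- The objects with indices `i` and `j` intersect. -/
def Meets (i j : ℕ) : Prop :=
  ∃ (hi : i < n) (hj : j < n), (F.obj ⟨i, hi⟩ ∩ F.obj ⟨j, hj⟩).Nonempty

variable {F}

theorem meets_coe {i j : Fin n} : F.Meets i j ↔ (F.obj i ∩ F.obj j).Nonempty := by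
  simp [Meets]

theorem Meets.symm {i j : ℕ} (h : F.Meets i j) : F.Meets j i := by
  obtain ⟨hi, hj, h⟩ := h
  exact ⟨hj, hi, by rwa [Set.inter_comm]⟩

open Classical in
/-- The sum of the multiplicities of the objects without a rank that intersect object `i`. -/
noncomputable def unrankedResistance (F : WeightedObjects n) (x rk : ℕ → ℕ) (i : ℕ) : ℕ :=
  ∑ j ∈ Finset.range n, if rk j = 0 ∧ j ≠ i ∧ F.Meets i j then x j else 0

end WeightedObjects

/-- In an order given by the positive ranks, where objects of rank `0` come last, `i` is ranked and
comes before `j`. -/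
def RankedBefore (rk : ℕ → ℕ) (i j : ℕ) : Prop := 0 < rk i ∧ (rk j = 0 ∨ rk i < rk j)

/-- The object `b` already came after all ranked objects, so its new rank adds only the relations to
the objects that stay unranked. -/
theorem rankedBefore_update {rk : ℕ → ℕ} {n k b : ℕ} (hb : b < n) (hrk : ∀ i < n, rk i ≤ k)
    (hb0 : rk b = 0) {i j : ℕ} (hi : i < n) (hj : j < n) :
    RankedBefore (Function.update rk b (k + 1)) i j ↔
      RankedBefore rk i j ∨ (i = b ∧ rk j = 0 ∧ j ≠ b) := by
  have h1 := hrk i hi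
  have h2 := hrk j hj
  unfold RankedBefore
  by_cases hib : i = b <;> by_cases hjb : j = b
  · subst hib; subst hjb; simp [hb0]
  · subst hib
    simp only [Function.update_self, Function.update_of_ne hjb, hb0]
    simp [hjb]; omega
  · subst hjb
    simp only [Function.update_self, Function.update_of_ne hib, hb0]
    simp; omega
  · simp [Function.update_of_ne hjb, hib]

namespace Program

variable {n : ℕ} {F : WeightedObjects n}

/-! ### Extraction in resistance order -/

/-- Compute the resistance of object `5` among the objects that remain. -/
def resist : Cmd :=
  .seq (.setN 24 (.const 0)) <|
  .for 6 0 <|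
    .ite (.and (.natLt (.arr 7 (.var 6)) (.const 1))
        (.and (.not (eqTest (.var 6) (.var 5))) (.intersects (.var 5) (.var 6))))
      (.setN 24 (.add (.var 24) (.arr 5 (.var 6)))) .skip

theorem resist_halts {s : Mem} {x rk : ℕ → ℕ} {i : ℕ} (h0 : s.nvar 0 = n) (h5 : s.nvar 5 = i)
    (hx : ∀ l < n, s.narr 5 l = x l) (hrk : s.narr 7 = rk) :
    Halts F resist s fun t s' => t ≤ 5 * n + 5 ∧ s'.nvar 24 = F.unrankedResistance x rk i := by
  classical
  unfold resist
  simp only [halts_seq, halts_setN, NExpr.eval]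
  refine Halts.for (by decide) (by decide) (by decide) 2 (fun k s' => s'.nvar 24 =
    ∑ j ∈ Finset.range k, if rk j = 0 ∧ j ≠ i ∧ F.Meets i j then x j else 0) ?_ ?_ ?_
  · simp
  · intro k s' hk hk6 hf hI
    have hk : k < n := by simpa [h0] using hk
    have e5 : s'.nvar 5 = i := by rw [hf.nvar 5 (by decide)]; simp [h5]
    have ex : s'.narr 5 = s.narr 5 := by rw [hf.narr 5 (by decide)]; simp
    have er : s'.narr 7 = rk := by rw [hf.narr 7 (by decide)]; simp [hrk]
    rw [halts_ite]
    simp only [BExpr.holds, holds_eqTest, NExpr.eval, hk6, e5, er, Nat.lt_one_iff]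
    have hc : (rk k = 0 ∧ ¬k = i ∧ ∃ (hi : i < n) (hj : k < n),
        (F.obj ⟨i, hi⟩ ∩ F.obj ⟨k, hj⟩).Nonempty) ↔ (rk k = 0 ∧ k ≠ i ∧ F.Meets i k) := Iff.rfl
    rw [hc]
    refine ⟨fun h => ?_, fun h => ?_⟩
    · simp only [halts_setN, NExpr.eval]
      refine ⟨by omega, ?_⟩
      rw [Finset.sum_range_succ, if_pos h]
      simp [hk6, ex, hI, hx k hk]
    · simp only [halts_skip]
      refine ⟨by omega, ?_⟩
      rw [Finset.sum_range_succ, if_neg h]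
      simp [hI]
  · intro t s' ht _ _ hI
    simp [h0] at ht hI
    exact ⟨by omega, hI⟩

/-- Find an object of minimum resistance among the objects that remain. -/
def selectMin : Cmd :=
  .seq (.setN 22 (.var 0)) <|
  .for 5 0 <|
    .ite (.natLt (.arr 7 (.var 5)) (.const 1))
      (.seq resist <|
        .ite (orTest (.not (.natLt (.var 22) (.var 0))) (.natLt (.var 24) (.var 23)))
          (.seq (.setN 22 (.var 5)) (.setN 23 (.var 24))) .skip)
      .skip

/-- The value `n` of variable `22`, which is no index, marks that no remaining object has been seen;
the first one is then accepted whatever variable `23` holds. -/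
theorem selectMin_halts {s : Mem} {x rk : ℕ → ℕ} (h0 : s.nvar 0 = n)
    (hx : ∀ l < n, s.narr 5 l = x l) (hrk : s.narr 7 = rk) (hex : ∃ i < n, rk i = 0) :
    Halts F selectMin s fun t s' => t ≤ n * (5 * n + 15) + 5 ∧ ∃ b < n, s'.nvar 22 = b ∧
      rk b = 0 ∧ ∀ i < n, rk i = 0 →
        F.unrankedResistance x rk b ≤ F.unrankedResistance x rk i := by
  unfold selectMin
  simp only [halts_seq, halts_setN, NExpr.eval]
  refine Halts.for (by decide) (by decide) (by decide) (5 * n + 12) (fun k s' =>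
    (s'.nvar 22 = n ∧ ∀ i < k, rk i ≠ 0) ∨ ∃ b < n, s'.nvar 22 = b ∧ rk b = 0 ∧
      s'.nvar 23 = F.unrankedResistance x rk b ∧ ∀ i < k, rk i = 0 →
        F.unrankedResistance x rk b ≤ F.unrankedResistance x rk i) ?_ ?_ ?_
  · exact Or.inl ⟨by simp [h0], by simp⟩
  · intro k s' hk hk5 hf hI
    have hk : k < n := by simpa [h0] using hk
    have e0 : s'.nvar 0 = n := by rw [hf.nvar 0 (by decide)]; simp [h0]
    have ex : ∀ l < n, s'.narr 5 l = x l := by rw [hf.narr 5 (by decide)]; simpa using hx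
    have er : s'.narr 7 = rk := by rw [hf.narr 7 (by decide)]; simp [hrk]
    rw [halts_ite]
    simp only [BExpr.holds, NExpr.eval, hk5, er, Nat.lt_one_iff]
    refine ⟨fun hk0 => ?_, fun hk0 => ?_⟩
    · rw [halts_seq]
      refine (resist_halts e0 hk5 ex er).mono ?_
      rintro t₁ s₁ hf₁ ⟨ht₁, h24⟩
      have f0 : s₁.nvar 0 = n := by rw [hf₁.nvar 0 (by decide), e0]
      have f5 : s₁.nvar 5 = k := by rw [hf₁.nvar 5 (by decide), hk5]
      have f22 : s₁.nvar 22 = s'.nvar 22 := hf₁.nvar 22 (by decide)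
      have f23 : s₁.nvar 23 = s'.nvar 23 := hf₁.nvar 23 (by decide)
      rw [halts_ite]
      simp only [holds_orTest, BExpr.holds, NExpr.eval, f0, f22, f23, h24, not_lt]
      refine ⟨fun hb => ?_, fun hb => ?_⟩
      · simp only [halts_seq, halts_setN, NExpr.eval]
        refine ⟨by omega, Or.inr ⟨k, hk, by simp [f5], hk0, by simp [h24], ?_⟩⟩
        intro i hi hi0
        rcases Nat.lt_succ_iff_lt_or_eq.1 hi with h | rfl
        · rcases hI with ⟨_, hI⟩ | ⟨b, hbn, hb22, _, hb23, hmin⟩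
          · exact absurd hi0 (hI i h)
          · have := hmin i h hi0
            omega
        · exact le_rfl
      · simp only [halts_skip]
        refine ⟨by omega, ?_⟩
        rcases hI with ⟨hI, _⟩ | ⟨b, hbn, hb22, hb0, hb23, hmin⟩
        · omega
        · refine Or.inr ⟨b, hbn, by simp [f22, hb22], hb0, by simp [f23, hb23], ?_⟩
          intro i hi hi0
          rcases Nat.lt_succ_iff_lt_or_eq.1 hi with h | rfl
          · exact hmin i h hi0
          · omega
    · simp only [halts_skip]
      refine ⟨by omega, ?_⟩
      have hne : ∀ i, i < k + 1 → rk i = 0 → i < k := fun i hi hi0 => by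
        rcases Nat.lt_succ_iff_lt_or_eq.1 hi with h | rfl
        · exact h
        · exact absurd hi0 hk0
      rcases hI with ⟨hI, hI'⟩ | ⟨b, hbn, hb22, hb0, hb23, hmin⟩
      · exact Or.inl ⟨by simp [hI], fun i hi hi0 => hI' i (hne i hi hi0) hi0⟩
      · exact Or.inr ⟨b, hbn, by simp [hb22], hb0, by simp [hb23],
          fun i hi hi0 => hmin i (hne i hi hi0) hi0⟩
  · intro t s' ht _ _ hI
    have he : 5 * n + 12 + 3 = 5 * n + 15 := rfl
    simp only [Mem.nvar_setN, if_neg (show (0 : ℕ) ≠ 22 by decide), h0, he] at ht hI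
    refine ⟨by omega, ?_⟩
    rcases hI with ⟨_, hI⟩ | ⟨b, hbn, hb22, hb0, _, hmin⟩
    · obtain ⟨i, hi, hi0⟩ := hex
      exact absurd hi0 (hI i hi)
    · exact ⟨b, hbn, hb22, hb0, hmin⟩

/-- Subtract the remaining weight of object `22` from the remaining weights of the objects that
remain and intersect it. -/
def reduce : Cmd :=
  .for 6 0 <|
    .ite (.and (.natLt (.arr 7 (.var 6)) (.const 1)) (.intersects (.var 22) (.var 6)))
      (.storeR 1 (.var 6) (.sub (.arr 1 (.var 6)) (.arr 1 (.var 22)))) .skip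

open Classical in
-- As `b` is ranked before this runs, the entry that is being subtracted is never overwritten.
theorem reduce_halts {s : Mem} {rk : ℕ → ℕ} {b : ℕ} (h0 : s.nvar 0 = n) (h22 : s.nvar 22 = b)
    (hrk : s.narr 7 = rk) (hb : 0 < rk b) :
    Halts F reduce s fun t s' => t ≤ 5 * n + 3 ∧ ∀ j < n, s'.rarr 1 j =
      s.rarr 1 j - if rk j = 0 ∧ F.Meets b j then s.rarr 1 b else 0 := by
  unfold reduce
  refine Halts.for (by decide) (by decide) (by decide) 2 (fun k s' => ∀ j, s'.rarr 1 j =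
      s.rarr 1 j - if j < k ∧ rk j = 0 ∧ F.Meets b j then s.rarr 1 b else 0) ?_ ?_ ?_
  · simp
  · intro k s' hk hk6 hf hI
    have e22 : s'.nvar 22 = b := by rw [hf.nvar 22 (by decide), h22]
    have er : s'.narr 7 = rk := by rw [hf.narr 7 (by decide), hrk]
    have eb : s'.rarr 1 b = s.rarr 1 b := by
      rw [hI b, if_neg (fun h => by omega), sub_zero]
    rw [halts_ite]
    simp only [BExpr.holds, NExpr.eval, hk6, e22, er, Nat.lt_one_iff]
    have hc : (rk k = 0 ∧ ∃ (hi : b < n) (hj : k < n),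
        (F.obj ⟨b, hi⟩ ∩ F.obj ⟨k, hj⟩).Nonempty) ↔ (rk k = 0 ∧ F.Meets b k) := Iff.rfl
    rw [hc]
    have hne : ∀ j, j ≠ k → (j < k + 1 ↔ j < k) := fun j hj => by omega
    refine ⟨fun h => ?_, fun h => ?_⟩
    · simp only [halts_storeR, NExpr.eval, RExpr.eval, hk6, e22, eb]
      refine ⟨by omega, fun j => ?_⟩
      simp only [Mem.rarr_setN, Mem.rarr_storeR, if_true]
      by_cases hj : j = k
      · subst hj
        rw [Function.update_self, hI, if_neg (by simp), if_pos ⟨by omega, h⟩, sub_zero]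
      · rw [Function.update_of_ne hj, hI]
        simp only [hne j hj]
    · simp only [halts_skip]
      refine ⟨by omega, fun j => ?_⟩
      simp only [Mem.rarr_setN]
      by_cases hj : j = k
      · subst hj
        rw [hI, if_neg (by simp), if_neg (fun h' => h h'.2)]
      · rw [hI]
        simp only [hne j hj]
  · intro t s' ht _ _ hI
    rw [h0] at ht hI
    refine ⟨by omega, fun j hj => ?_⟩
    rw [hI j]
    simp only [hj, true_and]

/-- Extract the objects in resistance order. The remaining weight of an object that is extracted is
subtracted from those of its remaining neighbours, if it is positive. -/
def extract : Cmd :=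
  .for 19 0 <|
    .seq selectMin <|
    .seq (.storeN 7 (.var 22) (.add (.var 19) (.const 1))) <|
    .seq (.storeN 8 (.var 19) (.var 22))
      (.ite (.realLt (.const 0) (.arr 1 (.var 22))) reduce .skip)

open Classical in
/-- The state after the extraction of `k` objects with resistance at most `R`. -/
structure Extracted (F : WeightedObjects n) (x : ℕ → ℕ) (R : ℝ) (k : ℕ) (rk ord : ℕ → ℕ)
    (rw : ℕ → ℝ) : Prop where
  rank_le : ∀ i < n, rk i ≤ k
  rank_order : ∀ m < k, ord m < n ∧ rk (ord m) = m + 1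
  order_rank : ∀ i < n, 0 < rk i → ord (rk i - 1) = i
  remaining : ∀ j < n, rw j = F.weightAt j -
    ∑ i ∈ Finset.range n, if RankedBefore rk i j ∧ F.Meets i j then max (rw i) 0 else 0
  resistance : ∀ i < n, 0 < rk i →
    ((∑ j ∈ Finset.range n, if RankedBefore rk i j ∧ F.Meets i j then x j else 0 : ℕ) : ℝ) ≤ R

/-- Pigeonhole: otherwise the ranks would be distinct positive numbers up to `k < n`. -/
theorem Extracted.exists_unranked {x rk ord : ℕ → ℕ} {R : ℝ} {k : ℕ} {rw : ℕ → ℝ}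
    (h : Extracted F x R k rk ord rw) (hk : k < n) : ∃ i < n, rk i = 0 := by
  by_contra! hcon
  have hcard := Finset.card_le_card_of_injOn (s := Finset.range n) (t := Finset.range k)
    (fun i => rk i - 1) (fun i hi => by
      have hi := Finset.mem_range.1 (Finset.mem_coe.1 hi)
      have h1 := hcon i hi
      have h2 := h.rank_le i hi
      simp only [Finset.coe_range, Set.mem_Iio]
      omega) (fun i hi j hj hij => by
      have hi := Finset.mem_range.1 (Finset.mem_coe.1 hi)
      have hj := Finset.mem_range.1 (Finset.mem_coe.1 hj)
      rw [← h.order_rank i hi (by have := hcon i hi; omega),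
        ← h.order_rank j hj (by have := hcon j hj; omega)]
      exact congrArg ord hij)
  rw [Finset.card_range, Finset.card_range] at hcard
  omega

/-- After `n` extractions the order is an injection of `Fin n` into itself, hence onto, and every
object has a rank. -/
theorem Extracted.rank_pos {x rk ord : ℕ → ℕ} {R : ℝ} {rw : ℕ → ℝ}
    (h : Extracted F x R n rk ord rw) {i : ℕ} (hi : i < n) : 0 < rk i := by
  let f : Fin n → Fin n := fun m => ⟨ord m, (h.rank_order m m.2).1⟩
  have hinj : Function.Injective f := fun a b hab => by
    have h1 := (h.rank_order a a.2).2
    have h2 := (h.rank_order b b.2).2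
    have h3 : ord a = ord b := congrArg Fin.val hab
    rw [h3, h2] at h1
    exact Fin.ext (by omega)
  obtain ⟨m, hm⟩ := (Finite.injective_iff_surjective.1 hinj) ⟨i, hi⟩
  have h1 : ord m = i := congrArg Fin.val hm
  rw [← h1, (h.rank_order m m.2).2]
  omega

open Classical in
theorem Extracted.succ {x rk ord : ℕ → ℕ} {R : ℝ} {k b : ℕ} {rw rw' : ℕ → ℝ}
    (h : Extracted F x R k rk ord rw) (hb : b < n) (hb0 : rk b = 0)
    (hR : (F.unrankedResistance x rk b : ℝ) ≤ R)
    (hrw : ∀ j < n, rw' j =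
      rw j - if (rk j = 0 ∧ j ≠ b) ∧ F.Meets b j then max (rw b) 0 else 0) :
    Extracted F x R (k + 1) (Function.update rk b (k + 1)) (Function.update ord k b) rw' where
  rank_le i hi := by
    by_cases hib : i = b
    · rw [hib, Function.update_self]
    · rw [Function.update_of_ne hib]
      exact (h.rank_le i hi).trans (Nat.le_succ k)
  rank_order m hm := by
    rcases Nat.lt_succ_iff_lt_or_eq.1 hm with hm | rfl
    · rw [Function.update_of_ne hm.ne]
      obtain ⟨h1, h2⟩ := h.rank_order m hm
      refine ⟨h1, ?_⟩
      rw [Function.update_of_ne (fun heq => by rw [heq] at h2; omega), h2]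
    · simp [hb]
  order_rank i hi hpos := by
    by_cases hib : i = b
    · rw [hib, Function.update_self]
      simp
    · rw [Function.update_of_ne hib] at hpos ⊢
      have := h.rank_le i hi
      rw [Function.update_of_ne (by omega)]
      exact h.order_rank i hi hpos
  remaining j hj := by
    -- The entries of ranked objects and of `b` are frozen from now on, so the terms of the
    -- predecessor sums keep their values.
    have hsame : ∀ i < n, 0 < rk i ∨ i = b → rw' i = rw i := fun i hi hib => by
      rw [hrw i hi, if_neg (fun h' => by rcases hib with hib | hib; omega; exact h'.1.2 hib),
        sub_zero]
    have hsum : ∑ i ∈ Finset.range n,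
        (if RankedBefore (Function.update rk b (k + 1)) i j ∧ F.Meets i j then max (rw' i) 0
          else 0) =
        (∑ i ∈ Finset.range n, if RankedBefore rk i j ∧ F.Meets i j then max (rw i) 0 else 0) +
        if (rk j = 0 ∧ j ≠ b) ∧ F.Meets b j then max (rw b) 0 else 0 := by
      have hdelta : (if (rk j = 0 ∧ j ≠ b) ∧ F.Meets b j then max (rw b) 0 else 0) =
          ∑ i ∈ Finset.range n, if i = b then
            (if (rk j = 0 ∧ j ≠ b) ∧ F.Meets b j then max (rw b) 0 else 0) else 0 := by
        rw [Finset.sum_ite_eq' (Finset.range n) b, if_pos (Finset.mem_range.2 hb)]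
      rw [hdelta, ← Finset.sum_add_distrib]
      refine Finset.sum_congr rfl fun i hi => ?_
      have hi := Finset.mem_range.1 hi
      rw [rankedBefore_update hb h.rank_le hb0 hi hj]
      by_cases hib : i = b
      · subst hib
        have hnot : ¬ RankedBefore rk i j := fun h' => by have := h'.1; omega
        rw [hsame i hi (Or.inr rfl)]
        simp [hnot]
      · simp only [hib, false_and, or_false, if_false, add_zero]
        by_cases hbf : RankedBefore rk i j
        · rw [hsame i hi (Or.inl hbf.1)]
        · simp [hbf]
    rw [hsum, hrw j hj, h.remaining j hj]
    ring
  resistance i hi hpos := by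
    by_cases hib : i = b
    · subst hib
      refine le_trans (le_of_eq ?_) hR
      rw [WeightedObjects.unrankedResistance]
      congr 1
      refine Finset.sum_congr rfl fun j hj => ?_
      rw [rankedBefore_update hb h.rank_le hb0 hb (Finset.mem_range.1 hj)]
      have hnot : ¬ RankedBefore rk i j := fun h' => by have := h'.1; omega
      simp [hnot, and_assoc]
    · rw [Function.update_of_ne hib] at hpos
      refine le_trans (le_of_eq ?_) (h.resistance i hi hpos)
      congr 1
      refine Finset.sum_congr rfl fun j hj => ?_
      rw [rankedBefore_update hb h.rank_le hb0 hi (Finset.mem_range.1 hj)]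
      simp [hib]

theorem extract_halts {s : Mem} {x : ℕ → ℕ} {R : ℝ} (h0 : s.nvar 0 = n)
    (hx : ∀ l < n, s.narr 5 l = x l) (hrk : s.narr 7 = fun _ => 0)
    (hrw : ∀ j < n, s.rarr 1 j = F.weightAt j)
    (hR : ∀ rk : ℕ → ℕ, (∃ i < n, rk i = 0) →
      ∃ i < n, rk i = 0 ∧ (F.unrankedResistance x rk i : ℝ) ≤ R) :
    Halts F extract s fun t s' => t ≤ n * (n * (5 * n + 20) + 25) + 3 ∧
      Extracted F x R n (s'.narr 7) (s'.narr 8) (s'.rarr 1) := by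
  classical
  unfold extract
  refine Halts.for (by decide) (by decide) (by decide) (n * (5 * n + 20) + 22)
    (fun k s' => Extracted F x R k (s'.narr 7) (s'.narr 8) (s'.rarr 1)) ?_ ?_ ?_
  · refine ⟨by simp [hrk], by simp, by simp [hrk], fun j hj => ?_, by simp [hrk]⟩
    simp [hrw j hj, hrk, RankedBefore]
  · intro k s' hk hk19 hf hI
    rw [h0] at hk
    have e0 : s'.nvar 0 = n := by rw [hf.nvar 0 (by decide), h0]
    have ex : ∀ l < n, s'.narr 5 l = x l := by rw [hf.narr 5 (by decide)]; exact hx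
    rw [halts_seq]
    refine (selectMin_halts e0 ex rfl (hI.exists_unranked hk)).mono ?_
    rintro t₁ s₁ hf₁ ⟨ht₁, b, hb, h22, hb0, hmin⟩
    have f0 : s₁.nvar 0 = n := by rw [hf₁.nvar 0 (by decide), e0]
    have f19 : s₁.nvar 19 = k := by rw [hf₁.nvar 19 (by decide), hk19]
    have f7 : s₁.narr 7 = s'.narr 7 := hf₁.narr 7 (by decide)
    have f8 : s₁.narr 8 = s'.narr 8 := hf₁.narr 8 (by decide)
    have fr : s₁.rarr 1 = s'.rarr 1 := hf₁.rarr 1 (by decide)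
    -- The selected minimum is no worse than the object of small resistance that `hR` provides.
    have hRb : (F.unrankedResistance x (s'.narr 7) b : ℝ) ≤ R := by
      obtain ⟨i, hi, hi0, hiR⟩ := hR (s'.narr 7) ⟨b, hb, hb0⟩
      exact le_trans (by exact_mod_cast hmin i hi hi0) hiR
    simp only [halts_seq, halts_storeN, NExpr.eval, Mem.nvar_storeN, h22, f19]
    set s₂ := (s₁.storeN 7 b (k + 1)).storeN 8 k b with hs₂
    have g7 : s₂.narr 7 = Function.update (s'.narr 7) b (k + 1) := by simp [hs₂, f7]
    have g8 : s₂.narr 8 = Function.update (s'.narr 8) k b := by simp [hs₂, f8]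
    have gr : s₂.rarr 1 = s'.rarr 1 := by simp [hs₂, fr]
    have g0 : s₂.nvar 0 = n := by simp [hs₂, f0]
    have g22 : s₂.nvar 22 = b := by simp [hs₂, h22]
    have htime : t₁ + (5 * n + 3) ≤ n * (5 * n + 20) + 8 := by
      have : n * (5 * n + 20) = n * (5 * n + 15) + 5 * n := by ring
      omega
    rw [halts_ite]
    simp only [BExpr.holds, RExpr.eval, NExpr.eval, g22, gr, Rat.cast_zero]
    refine ⟨fun hpos => ?_, fun hpos => ?_⟩
    · refine (reduce_halts g0 g22 g7 (by simp)).mono ?_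
      rintro t₂ s₃ hf₃ ⟨ht₂, hred⟩
      refine ⟨by omega, ?_⟩
      simp only [Mem.narr_setN, Mem.rarr_setN, hf₃.narr 7 (by decide), hf₃.narr 8 (by decide),
        g7, g8]
      refine hI.succ hb hb0 hRb fun j hj => ?_
      rw [hred j hj, gr, max_eq_left hpos.le]
      congr 1
      by_cases hjb : j = b
      · simp [hjb]
      · simp [hjb]
    · rw [halts_skip]
      refine ⟨by omega, ?_⟩
      simp only [Mem.narr_setN, Mem.rarr_setN, g7, g8, gr]
      refine hI.succ hb hb0 hRb fun j hj => ?_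
      -- Here the positive part is zero, in agreement with the skipped subtraction.
      rw [max_eq_right (not_lt.1 hpos)]
      simp
  · intro t s' ht _ _ hI
    rw [h0] at ht hI
    have he : n * (5 * n + 20) + 22 + 3 = n * (5 * n + 20) + 25 := rfl
    rw [he] at ht
    exact ⟨ht, hI⟩

/-! ### Selection in reverse order -/

/-- Set the flag `24` if object `22` is disjoint from all objects selected so far. -/
def isFree : Cmd :=
  .seq (.setN 24 (.const 1)) <|
  .for 6 0 <|
    .ite (.and (.natLt (.const 0) (.arr 0 (.var 6))) (.intersects (.var 22) (.var 6)))
      (.setN 24 (.const 0)) .skip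

theorem isFree_halts {s : Mem} {b : ℕ} (h0 : s.nvar 0 = n) (h22 : s.nvar 22 = b) :
    Halts F isFree s fun t s' => t ≤ 5 * n + 5 ∧
      (0 < s'.nvar 24 ↔ ∀ j < n, 0 < s.narr 0 j → ¬ F.Meets b j) := by
  unfold isFree
  simp only [halts_seq, halts_setN, NExpr.eval]
  refine Halts.for (by decide) (by decide) (by decide) 2
    (fun k s' => 0 < s'.nvar 24 ↔ ∀ j < k, 0 < s.narr 0 j → ¬ F.Meets b j) ?_ ?_ ?_
  · simp
  · intro k s' hk hk6 hf hI
    have e22 : s'.nvar 22 = b := by rw [hf.nvar 22 (by decide)]; simp [h22]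
    have eo : s'.narr 0 = s.narr 0 := by rw [hf.narr 0 (by decide)]; simp
    rw [halts_ite]
    simp only [BExpr.holds, NExpr.eval, hk6, e22, eo]
    have hc : (0 < s.narr 0 k ∧ ∃ (hi : b < n) (hj : k < n),
        (F.obj ⟨b, hi⟩ ∩ F.obj ⟨k, hj⟩).Nonempty) ↔ (0 < s.narr 0 k ∧ F.Meets b k) := Iff.rfl
    rw [hc]
    refine ⟨fun h => ?_, fun h => ?_⟩
    · simp only [halts_setN, NExpr.eval]
      refine ⟨by omega, ?_⟩
      exact ⟨fun h' => absurd h' (by simp), fun h' => absurd h.2 (h' k (by omega) h.1)⟩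
    · simp only [halts_skip]
      refine ⟨by omega, ?_⟩
      rw [Mem.nvar_setN, if_neg (by decide), hI]
      refine ⟨fun h' j hj => ?_, fun h' j hj => h' j (by omega)⟩
      rcases Nat.lt_succ_iff_lt_or_eq.1 hj with hj | rfl
      · exact h' j hj
      · exact fun ho hm => h ⟨ho, hm⟩
  · intro t s' ht _ _ hI
    simp [h0] at ht hI
    exact ⟨by omega, hI⟩

/-- Scan the objects in reverse order of extraction and select those that have positive remaining
weight and are disjoint from all objects selected before. -/
def select : Cmd :=
  .for 19 0 <|
    .seq (.setN 22 (.arr 8 (.sub (.var 0) (.add (.var 19) (.const 1)))))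
      (.ite (.realLt (.const 0) (.arr 1 (.var 22)))
        (.seq isFree
          (.ite (.natLt (.const 0) (.var 24)) (.storeN 0 (.var 22) (.const 1)) .skip))
        .skip)

/-- The state of the selection after `k` objects have been scanned. -/
structure Selected (F : WeightedObjects n) (k : ℕ) (rk : ℕ → ℕ) (rw : ℕ → ℝ) (out : ℕ → ℕ) :
    Prop where
  disjoint : ∀ i < n, ∀ j < n, i ≠ j → 0 < out i → 0 < out j → ¬ F.Meets i j
  scanned : ∀ i < n, 0 < out i → 0 < rw i ∧ n < rk i + k
  blocked : ∀ i < n, n < rk i + k → 0 < rw i →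
    0 < out i ∨ ∃ j < n, 0 < out j ∧ rk i < rk j ∧ F.Meets i j

/-- Everything selected before has larger rank than `b`. Hence a selected object that blocks `b`
comes after it in the extraction order, as the local ratio argument requires. -/
theorem Selected.succ {rk out out' : ℕ → ℕ} {rw : ℕ → ℝ} {k b : ℕ}
    (h : Selected F k rk rw out) (hb : rk b + k = n)
    (hinj : ∀ i < n, rk i = rk b → i = b)
    (ho : ∀ i ≠ b, out' i = out i)
    (hob : 0 < out' b ↔ 0 < rw b ∧ ∀ j < n, 0 < out j → ¬ F.Meets b j) :
    Selected F (k + 1) rk rw out' where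
  disjoint i hi j hj hij hoi hoj hm := by
    by_cases hib : i = b
    · subst hib
      have hji : j ≠ i := fun h => hij h.symm
      rw [ho j hji] at hoj
      exact (hob.1 hoi).2 j hj hoj hm
    · rw [ho i hib] at hoi
      by_cases hjb : j = b
      · subst hjb
        exact (hob.1 hoj).2 i hi hoi hm.symm
      · rw [ho j hjb] at hoj
        exact h.disjoint i hi j hj hij hoi hoj hm
  scanned i hi hoi := by
    by_cases hib : i = b
    · subst hib
      exact ⟨(hob.1 hoi).1, by omega⟩
    · rw [ho i hib] at hoi
      have := h.scanned i hi hoi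
      exact ⟨this.1, by omega⟩
  blocked i hi hlt hpos := by
    have hmono : ∀ j < n, 0 < out j → 0 < out' j := fun j hj hoj => by
      have hjb : j ≠ b := by
        rintro rfl
        have := (h.scanned j hj hoj).2
        omega
      rwa [ho j hjb]
    by_cases hib : i = b
    · subst hib
      by_cases hfree : ∀ j < n, 0 < out j → ¬ F.Meets i j
      · exact Or.inl (hob.2 ⟨hpos, hfree⟩)
      · push Not at hfree
        obtain ⟨j, hj, hoj, hm⟩ := hfree
        have := (h.scanned j hj hoj).2
        exact Or.inr ⟨j, hj, hmono j hj hoj, by omega, hm⟩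
    · have hne : rk i ≠ rk b := fun heq => hib (hinj i hi heq)
      rcases h.blocked i hi (by omega) hpos with ho' | ⟨j, hj, hoj, hlt', hm⟩
      · exact Or.inl (hmono i hi ho')
      · exact Or.inr ⟨j, hj, hmono j hj hoj, hlt', hm⟩

theorem select_halts {s : Mem} {x : ℕ → ℕ} {R : ℝ} (h0 : s.nvar 0 = n)
    (hE : Extracted F x R n (s.narr 7) (s.narr 8) (s.rarr 1)) (ho : s.narr 0 = fun _ => 0) :
    Halts F select s fun t s' => t ≤ n * (5 * n + 20) + 3 ∧
      Selected F n (s.narr 7) (s.rarr 1) (s'.narr 0) := by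
  unfold select
  refine Halts.for (by decide) (by decide) (by decide) (5 * n + 17)
    (fun k s' => Selected F k (s.narr 7) (s.rarr 1) (s'.narr 0)) ?_ ?_ ?_
  · refine ⟨by simp [ho], by simp [ho], fun i hi hlt => ?_⟩
    have := hE.rank_le i hi
    omega
  · intro k s' hk hk19 hf hI
    rw [h0] at hk
    have e0 : s'.nvar 0 = n := by rw [hf.nvar 0 (by decide), h0]
    have e8 : s'.narr 8 = s.narr 8 := hf.narr 8 (by decide)
    have er : s'.rarr 1 = s.rarr 1 := hf.rarr 1 (by decide)
    -- Ranks start at 1, so the object scanned in step `k` has rank `n - k`.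
    obtain ⟨hb, hrb⟩ := hE.rank_order (n - (k + 1)) (by omega)
    set b := s.narr 8 (n - (k + 1)) with hbdef
    have hinj : ∀ i < n, s.narr 7 i = s.narr 7 b → i = b := fun i hi heq => by
      rw [← hE.order_rank i hi (hE.rank_pos hi), ← hE.order_rank b hb (hE.rank_pos hb), heq]
    rw [halts_seq, halts_setN]
    simp only [NExpr.eval, e0, hk19, e8, ← hbdef]
    rw [halts_ite]
    simp only [BExpr.holds, RExpr.eval, NExpr.eval, Mem.nvar_setN, Mem.rarr_setN, if_true, er,
      Rat.cast_zero]
    have hnot : ¬ 0 < s'.narr 0 b := fun h => by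
      have := (hI.scanned b hb h).2
      omega
    refine ⟨fun hpos => ?_, fun hpos => ?_⟩
    · rw [halts_seq]
      refine (isFree_halts (b := b) (by simp [e0]) (by simp)).mono ?_
      rintro t₁ s₁ hf₁ ⟨ht₁, hfree⟩
      have f22 : s₁.nvar 22 = b := by rw [hf₁.nvar 22 (by decide)]; simp
      have fo : s₁.narr 0 = s'.narr 0 := by rw [hf₁.narr 0 (by decide)]; simp
      simp only [Mem.narr_setN] at hfree
      rw [halts_ite]
      simp only [BExpr.holds, NExpr.eval, hfree]
      refine ⟨fun h => ?_, fun h => ?_⟩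
      · simp only [halts_storeN, NExpr.eval, f22]
        refine ⟨by omega, ?_⟩
        simp only [Mem.narr_setN, Mem.narr_storeN, if_true, fo]
        refine hI.succ (by omega) hinj (fun i hi => Function.update_of_ne hi _ _) ?_
        simp only [Function.update_self]
        exact ⟨fun _ => ⟨hpos, h⟩, fun _ => Nat.one_pos⟩
      · simp only [halts_skip]
        refine ⟨by omega, ?_⟩
        simp only [Mem.narr_setN, fo]
        exact hI.succ (by omega) hinj (fun _ _ => rfl)
          ⟨fun h' => absurd h' hnot, fun h' => absurd h'.2 h⟩
    · simp only [halts_skip]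
      refine ⟨by omega, ?_⟩
      simp only [Mem.narr_setN]
      exact hI.succ (by omega) hinj (fun _ _ => rfl)
        ⟨fun h' => absurd h' hnot, fun h' => absurd h'.1 hpos⟩
  · intro t s' ht _ _ hI
    rw [h0] at ht hI
    have he : 5 * n + 17 + 3 = 5 * n + 20 := rfl
    rw [he] at ht
    exact ⟨ht, hI⟩

/-- Initialize the remaining weights. -/
def initRemaining : Cmd := .for 5 0 (.storeR 1 (.var 5) (.arr 0 (.var 5)))

theorem initRemaining_halts {s : Mem} (h0 : s.nvar 0 = n) (hw : s.rarr 0 = F.weightAt) :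
    Halts F initRemaining s fun t s' => t ≤ 4 * n + 3 ∧ ∀ j < n, s'.rarr 1 j = F.weightAt j := by
  unfold initRemaining
  refine Halts.for (by decide) (by decide) (by decide) 1
    (fun k s' => ∀ j < k, s'.rarr 1 j = F.weightAt j) (by simp) ?_ ?_
  · intro k s' hk hk5 hf hI
    have ew : s'.rarr 0 = F.weightAt := by rw [hf.rarr 0 (by decide), hw]
    simp only [halts_storeR, NExpr.eval, RExpr.eval, hk5, ew]
    refine ⟨le_rfl, fun j hj => ?_⟩
    simp only [Mem.rarr_setN, Mem.rarr_storeR, if_true]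
    rcases Nat.lt_succ_iff_lt_or_eq.1 hj with hj | rfl
    · rw [Function.update_of_ne hj.ne, hI j hj]
    · rw [Function.update_self]
  · intro t s' ht _ _ hI
    rw [h0] at ht hI
    exact ⟨by omega, hI⟩

end Program

namespace Program

variable {n : ℕ} {F : WeightedObjects n}

/-! ### The quality of the output -/

/-- The averaging bound for the set of unranked objects, with `B = n` so that the same bound holds
at every extraction. The factor `N` undoes the scaling of the integer multiplicities. -/
theorem exists_unrankedResistance_le {c K : ℝ} {U : ℝ → ℝ} {x : ℕ → ℕ} {N : ℕ} (hn : 1 ≤ n)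
    (hU : WellBehaved c U) (hF : F.UnionComplexityLE K U) (hK : 0 < K) (hN : 0 < N)
    (hz : F.FractionalPacking fun i => (x i : ℝ) / N) {rk : ℕ → ℕ} (hrk : ∃ i < n, rk i = 0) :
    ∃ i < n, rk i = 0 ∧
      (F.unrankedResistance x rk i : ℝ) ≤
        N * (WeightedObjects.resistanceConst c K * (U n / n)) := by
  classical
  have hn' : (1 : ℝ) ≤ n := by exact_mod_cast hn
  have hN' : (0 : ℝ) < N := by exact_mod_cast hN
  obtain ⟨i₀, hi₀, h₀⟩ := hrk
  have hsum : ∑ i ∈ Finset.univ.filter (fun i : Fin n => rk i = 0), (x i : ℝ) / N ≤ n := by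
    calc ∑ i ∈ Finset.univ.filter (fun i : Fin n => rk i = 0), (x i : ℝ) / N
        ≤ ∑ i : Fin n, (1 : ℝ) :=
          (Finset.sum_le_sum fun i _ => hz.le_one i).trans
            (Finset.sum_le_sum_of_subset_of_nonneg (Finset.subset_univ _) fun _ _ _ => zero_le_one)
      _ = n := by simp
  obtain ⟨i, hi, hle⟩ := hz.exists_resistance_le hU hF hK
    (H := Finset.univ.filter fun i : Fin n => rk i = 0) ⟨⟨i₀, hi₀⟩, by simp [h₀]⟩ hn' hsum
  refine ⟨i, i.2, by simpa using hi, ?_⟩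
  rw [← div_le_iff₀' hN']
  refine le_trans (le_of_eq ?_) hle
  rw [WeightedObjects.unrankedResistance, WeightedObjects.resistance, Finset.filter_filter,
    Finset.sum_filter, Finset.sum_range, Nat.cast_sum, Finset.sum_div]
  refine Finset.sum_congr rfl fun j _ => ?_
  have hc : (rk j = 0 ∧ (j : ℕ) ≠ i ∧ F.Meets i j) ↔
      (rk j = 0 ∧ j ≠ i ∧ (F.obj i ∩ F.obj j).Nonempty) := by
    rw [WeightedObjects.meets_coe, Ne, Fin.val_inj]
  rw [if_congr hc rfl rfl]
  split_ifs <;> simp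

theorem independent_outputSet {rk : ℕ → ℕ} {rw : ℕ → ℝ} {s : Mem} {k : ℕ}
    (hS : Selected F k rk rw (s.narr 0)) (l : List Cmd) : F.Independent (outputSet n (l, s)) := by
  intro i hi j hj hij
  simp only [outputSet, Finset.mem_filter, Finset.mem_univ, true_and] at hi hj
  have := hS.disjoint i i.2 j j.2 (fun h => hij (Fin.ext h)) (Nat.pos_of_ne_zero hi)
    (Nat.pos_of_ne_zero hj)
  rwa [WeightedObjects.meets_coe, Set.not_nonempty_iff_eq_empty,
    ← Set.disjoint_iff_inter_eq_empty] at this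

/-- The local ratio bound with the ranks as times and with `α` the positive part of the remaining
weight, which no longer changes once an object is extracted. -/
theorem lpValue_le_outputSet {x rk ord : ℕ → ℕ} {rw : ℕ → ℝ} {s : Mem} {N : ℕ} {ρ : ℝ}
    (hN : 0 < N) (hz : F.FractionalPacking fun i => (x i : ℝ) / N)
    (hE : Extracted F x (N * ρ) n rk ord rw) (hS : Selected F n rk rw (s.narr 0))
    (l : List Cmd) :
    F.lpValue (fun i => (x i : ℝ) / N) ≤ (1 + ρ) * F.totalWeight (outputSet n (l, s)) := by
  classical
  have hN' : (0 : ℝ) < N := by exact_mod_cast hN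
  have hmem : ∀ i : Fin n, i ∈ outputSet n (l, s) ↔ 0 < s.narr 0 i := fun i => by
    simp [outputSet, Nat.pos_iff_ne_zero]
  have hbefore : ∀ i j : Fin n, RankedBefore rk i j ↔ rk i < rk j := fun i j => by
    have h1 := hE.rank_pos i.2
    have h2 := hE.rank_pos j.2
    unfold RankedBefore
    omega
  have hsum : ∀ j : Fin n, rw j = F.weight j -
      ∑ i ∈ Finset.univ.filter fun i : Fin n => rk i < rk j ∧ (F.obj j ∩ F.obj i).Nonempty,
        max (rw i) 0 := fun j => by
    rw [hE.remaining j j.2, F.weightAt_coe, Finset.sum_range, Finset.sum_filter]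
    congr 1
    refine Finset.sum_congr rfl fun i _ => if_congr ?_ rfl rfl
    rw [hbefore, WeightedObjects.meets_coe, Set.inter_comm]
  refine WeightedObjects.localRatio_le (t := fun i => rk i) (α := fun i => max (rw i) 0)
    (fun i => le_max_right _ _) (fun i => ?_) (fun i hi => ?_) (fun i hi => ?_) (fun i hi => ?_)
    hz.nonneg hz.le_one (fun i => ?_)
  · have := hsum i
    have := le_max_left (rw i) 0
    linarith
  · have hpos : 0 < rw i := by simpa using hi
    have := hsum i
    have := max_eq_left hpos.le
    linarith
  · exact lt_max_of_lt_left (hS.scanned i i.2 ((hmem i).1 hi)).1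
  · have hpos : 0 < rw i := by simpa using hi
    have := hE.rank_pos i.2
    rcases hS.blocked i i.2 (by omega) hpos with h | ⟨j, hj, ho, hlt, hm⟩
    · exact Or.inl ((hmem i).2 h)
    · exact Or.inr ⟨⟨j, hj⟩, (hmem _).2 ho, hlt, WeightedObjects.meets_coe.1 hm⟩
  · have h := hE.resistance i i.2 (hE.rank_pos i.2)
    rw [← div_le_iff₀' hN'] at h
    refine le_trans (le_of_eq ?_) h
    rw [Finset.sum_filter, Finset.sum_range, Nat.cast_sum, Finset.sum_div]
    refine Finset.sum_congr rfl fun j _ => ?_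
    have hc : (RankedBefore rk i j ∧ F.Meets i j) ↔
        (rk i < rk j ∧ (F.obj i ∩ F.obj j).Nonempty) := by
      rw [hbefore, WeightedObjects.meets_coe]
    rw [if_congr hc rfl rfl]
    split_ifs <;> simp

theorem multWeight_div (x : ℕ → ℕ) (N : ℕ) :
    F.multWeight x / N = F.lpValue fun i => (x i : ℝ) / N := by
  rw [WeightedObjects.multWeight, WeightedObjects.lpValue, Finset.sum_range, Finset.sum_div]
  refine Finset.sum_congr rfl fun i _ => ?_
  rw [F.weightAt_coe, mul_div_assoc]

/-! ### Running time -/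

theorem le_of_four_pow_le {bs : ℕ} (hbs : 1 ≤ bs) (h4 : 4 ^ bs ≤ 4 * n) : bs ≤ n := by
  obtain ⟨m, rfl⟩ := Nat.exists_eq_add_of_le' hbs
  have : m < 4 ^ m := Nat.lt_pow_self (by norm_num)
  rw [pow_succ] at h4
  omega

/-- The number of phases is chosen for this bound: there are at most `2 * n ^ 2` rows and `n < 4 ^
(bs + 1)`, so `8 * (bs + 2)` is at least twice the binary logarithm of the row count. -/
theorem blocks_sq_le {bs M : ℕ} (hbs : 1 ≤ bs) (h4 : 4 ^ bs ≤ 4 * n) (hn : n < 4 ^ (bs + 1))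
    (hM : M ≤ n * n + bs) : M ^ 2 ≤ 2 ^ (8 * (bs + 2)) := by
  have hle := le_of_four_pow_le hbs h4
  have h1 : M ≤ 2 * n ^ 2 := by nlinarith
  have h2 : (2 : ℕ) ^ (8 * (bs + 2)) = 256 * (4 ^ (bs + 1)) ^ 4 := by
    rw [show (256 : ℕ) = 2 ^ 8 by norm_num, show (4 : ℕ) = 2 ^ 2 by norm_num, ← pow_mul, ← pow_mul,
      ← pow_add]
    congr 1
    ring
  calc M ^ 2 ≤ (2 * n ^ 2) ^ 2 := Nat.pow_le_pow_left h1 2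
    _ = 4 * n ^ 4 := by ring
    _ ≤ 256 * (4 ^ (bs + 1)) ^ 4 :=
        Nat.mul_le_mul (by norm_num) (Nat.pow_le_pow_left hn.le 4)
    _ = _ := h2.symm

theorem rebuildTime_le {bs : ℕ} (hbs : 1 ≤ bs) : rebuildTime bs ≤ 12 * (bs * 2 ^ bs) := by
  have h2 : 2 ≤ 2 ^ bs := by
    calc 2 = 2 ^ 1 := rfl
      _ ≤ 2 ^ bs := Nat.pow_le_pow_right (by norm_num) hbs
  unfold rebuildTime
  nlinarith

/-- Tables of about `√n` entries leave room for two factors `bs`, one from the number of phases and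
one from `rebuild`. -/
theorem sq_mul_two_pow_le {bs : ℕ} (hbs : 1 ≤ bs) (h4 : 4 ^ bs ≤ 4 * n) :
    bs ^ 2 * 2 ^ bs ≤ 8 * n := by
  have h1 := sq_le_four_mul_two_pow bs
  have h2 : 2 ^ bs = 2 * 2 ^ (bs - 1) := by
    rw [← pow_succ', Nat.sub_add_cancel hbs]
  have h3 : 2 ^ bs * 2 ^ bs = 4 ^ bs := by rw [← mul_pow]; rfl
  calc bs ^ 2 * 2 ^ bs ≤ (2 * 2 ^ bs) * 2 ^ bs := Nat.mul_le_mul_right _ (by omega)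
    _ = 2 * 4 ^ bs := by rw [mul_assoc, h3]
    _ ≤ 8 * n := by omega

theorem build_time_le {bs G : ℕ} (hn : 1 ≤ n) (hbs : 1 ≤ bs) (h4 : 4 ^ bs ≤ 4 * n)
    (hM : G * bs ≤ n * n + bs) : G * blockTime n bs ≤ 400 * n ^ 3 := by
  have hle := le_of_four_pow_le hbs h4
  have hM2 : G * bs ≤ 2 * n ^ 2 := by nlinarith
  have hG : G ≤ 2 * n ^ 2 := (Nat.le_mul_of_pos_right G hbs).trans hM2
  have hr := rebuildTime_le hbs
  have hq := sq_mul_two_pow_le hbs h4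
  have hq' : bs * 2 ^ bs ≤ bs ^ 2 * 2 ^ bs :=
    Nat.mul_le_mul_right _ (by nlinarith)
  have hr' : rebuildTime bs ≤ 96 * n := by omega
  calc G * blockTime n bs = G * (4 * n + 30) + G * bs * (7 * n + 30) + G * rebuildTime bs := by
        unfold blockTime; ring
    _ ≤ 2 * n ^ 2 * (34 * n) + 2 * n ^ 2 * (37 * n) + 2 * n ^ 2 * (96 * n) :=
        Nat.add_le_add (Nat.add_le_add (Nat.mul_le_mul hG (by omega))
          (Nat.mul_le_mul hM2 (by omega))) (Nat.mul_le_mul hG hr')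
    _ = 334 * n ^ 3 := by ring
    _ ≤ _ := Nat.mul_le_mul_right _ (by norm_num)

/-- The logarithm cancels: O(`bs`) phases times O(`n ^ 2 / bs`) blocks are O(`n ^ 2`) lookups per
object. Rebuilding costs O(`bs * 2 ^ bs`) for each of O(`n ^ 2`) rows in each of O(`bs`) units of
load, which `sq_mul_two_pow_le` keeps cubic. -/
theorem mwu_time_le {bs G N : ℕ} (hn : 1 ≤ n) (hbs : 1 ≤ bs) (h4 : 4 ^ bs ≤ 4 * n)
    (hM : G * bs ≤ n * n + bs) (hN : N = 8 * (bs + 2) + 1) :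
    N * (n * (6 * G + 13) + 10) + 10 +
      (n * N * (26 * G + 29) + G * bs * N * (bs * 8 + 8 + rebuildTime bs)) ≤ 12000 * n ^ 3 := by
  have hle := le_of_four_pow_le hbs h4
  have hM2 : G * bs ≤ 2 * n ^ 2 := by nlinarith
  have hr := rebuildTime_le hbs
  have hq := sq_mul_two_pow_le hbs h4
  have h2 : 2 ≤ 2 ^ bs := by
    calc 2 = 2 ^ 1 := rfl
      _ ≤ 2 ^ bs := Nat.pow_le_pow_right (by norm_num) hbs
  have hN' : N ≤ 25 * bs := by omega
  have hN2 : N ≤ 25 * n := by omega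
  have hGN : G * N ≤ 50 * n ^ 2 := by
    calc G * N ≤ G * (25 * bs) := Nat.mul_le_mul_left _ hN'
      _ = 25 * (G * bs) := by ring
      _ ≤ 25 * (2 * n ^ 2) := Nat.mul_le_mul_left _ hM2
      _ = _ := by ring
  have hZ : bs * 8 + 8 + rebuildTime bs ≤ 20 * (bs * 2 ^ bs) := by nlinarith
  have hNZ : N * (bs * 8 + 8 + rebuildTime bs) ≤ 4000 * n := by
    calc N * (bs * 8 + 8 + rebuildTime bs) ≤ 25 * bs * (20 * (bs * 2 ^ bs)) :=
          Nat.mul_le_mul hN' hZ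
      _ = 500 * (bs ^ 2 * 2 ^ bs) := by ring
      _ ≤ 500 * (8 * n) := Nat.mul_le_mul_left _ hq
      _ = _ := by ring
  have hn2 : n ≤ n ^ 3 := Nat.le_self_pow (by norm_num) n
  have hn3 : n ^ 2 ≤ n ^ 3 := Nat.pow_le_pow_right hn (by norm_num)
  calc N * (n * (6 * G + 13) + 10) + 10 +
        (n * N * (26 * G + 29) + G * bs * N * (bs * 8 + 8 + rebuildTime bs))
      = 32 * n * (G * N) + (42 * n + 10) * N + 10 +
        G * bs * (N * (bs * 8 + 8 + rebuildTime bs)) := by ring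
    _ ≤ 32 * n * (50 * n ^ 2) + (42 * n + 10) * (25 * n) + 10 + 2 * n ^ 2 * (4000 * n) := by
        gcongr
    _ = 9600 * n ^ 3 + 1050 * n ^ 2 + 250 * n + 10 := by ring
    _ ≤ _ := by omega

/-! ### The whole program -/

/-- The program: compute a near-optimal fractional packing by the multiplicative weights method,
extract the objects in resistance order with local ratio steps, and select in reverse order. -/
def main : Cmd :=
  .seq setSizes <| .seq setMaxWeight <| .seq build <| .seq mwu <| .seq initRemaining <|
    .seq extract select

theorem main_deterministic : main.Deterministic := by
  simp [main, setSizes, setMaxWeight, build, mwu, initRemaining, extract, select, addBlock,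
    initAddr, addRow, rebuild, raiseLoop, check, raise, doubleRows, selectMin, resist, reduce,
    isFree, Cmd.for, Cmd.Deterministic]

/-- Since `1 ≤ ρ * u`, the local ratio factor `1 + ρ * u` is at most `2 * (ρ * u)`; the factor 16
lost in the fractional solution makes it 32. -/
theorem le_of_opt_le {ρ K u opt W lp : ℝ} (hρ : 0 < ρ) (hKρ : K ≤ ρ) (hu : 0 < u)
    (hKu : 1 ≤ K * u) (hW : 0 ≤ W) (hopt : opt ≤ 16 * lp) (hlp : lp ≤ (1 + ρ * u) * W) :
    1 / (32 * ρ) * (u⁻¹ * opt) ≤ W := by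
  have h1 : 1 ≤ ρ * u := hKu.trans (mul_le_mul_of_nonneg_right hKρ hu.le)
  have h2 : opt ≤ 32 * ρ * u * W := by nlinarith
  calc 1 / (32 * ρ) * (u⁻¹ * opt) ≤ 1 / (32 * ρ) * (u⁻¹ * (32 * ρ * u * W)) := by gcongr
    _ = W := by field_simp

theorem main_halts {c K : ℝ} {U : ℝ → ℝ} (hn : 1 ≤ n) (hU : WellBehaved c U)
    (hF : F.UnionComplexityLE K U) (hK : 0 < K) :
    Halts F main (initMem F) fun t s => t ≤ 13000 * n ^ 3 ∧ F.Independent (outputSet n ([], s)) ∧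
      1 / (32 * WeightedObjects.resistanceConst c K) * (n / U n * F.opt) ≤
        F.totalWeight (outputSet n ([], s)) := by
  have hw : (initMem F).rarr 0 = F.weightAt := by
    funext i
    simp [initMem, WeightedObjects.weightAt]
  have hz : ∀ x ≠ 0, (initMem F).nvar x = 0 := fun x hx => by simp [initMem, hx]
  have h0 : (initMem F).nvar 0 = n := by simp [initMem]
  unfold main
  rw [halts_seq]
  refine (setSizes_halts hn h0).mono ?_
  rintro t₁ s₁ hf₁ ⟨bs, hbs, h4, hn4, ht₁, a1, a2, a4, a20⟩
  have a0 : s₁.nvar 0 = n := by rw [hf₁.nvar 0 (by decide), h0]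
  have aw : s₁.rarr 0 = F.weightAt := by rw [hf₁.rarr 0 (by decide), hw]
  have ar : s₁.rvar 0 = 0 := by rw [hf₁.rvar 0 (by decide)]; rfl
  rw [halts_seq]
  refine (setMaxWeight_halts hn a0 ar aw).mono ?_
  rintro t₂ s₂ hf₂ ⟨ht₂, hmax, j, hj, hjmax⟩
  have b0 : s₂.nvar 0 = n := by rw [hf₂.nvar 0 (by decide), a0]
  have b4 : s₂.nvar 4 = 8 * (bs + 2) + 1 := by rw [hf₂.nvar 4 (by decide), a4]
  have bw : s₂.rarr 0 = F.weightAt := by rw [hf₂.rarr 0 (by decide), aw]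
  have bz : ∀ x, x ≠ 0 → x ∉ setSizes.modN → x ∉ setMaxWeight.modN → s₂.nvar x = 0 :=
    fun x hx h₁ h₂ => by rw [hf₂.nvar x h₂, hf₁.nvar x h₁, hz x hx]
  have ba : ∀ a, s₂.narr a = fun _ => 0 := fun a => by
    rw [hf₂.narr a (by simp [setMaxWeight, Cmd.for, Cmd.modNA]),
      hf₁.narr a (by simp [setSizes, Cmd.for, Cmd.modNA])]
    rfl
  rw [halts_seq]
  refine (build_halts hn hbs b0 (by rw [hf₂.nvar 1 (by decide), a1])
    (by rw [hf₂.nvar 2 (by decide), a2]) (by rw [hf₂.nvar 20 (by decide), a20])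
    (bz 12 (by decide) (by decide) (by decide)) (bz 13 (by decide) (by decide) (by decide))
    (bz 14 (by decide) (by decide) (by decide)) (bz 15 (by decide) (by decide) (by decide))
    (bz 16 (by decide) (by decide) (by decide)) (ba 5)).mono ?_
  rintro t₃ s₃ hf₃ ⟨G, hG, hG', ht₃, hL, hR⟩
  have c4 : s₃.nvar 4 = 8 * (bs + 2) + 1 := by rw [hf₃.nvar 4 (by decide), b4]
  have cw : s₃.rarr 0 = F.weightAt := by rw [hf₃.rarr 0 (by decide), bw]
  rw [halts_seq]
  refine (mwu_halts hL hR hG hmax (hf₃.rvar 0 (by decide)) cw c4).mono ?_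
  rintro t₄ s₄ hf₄ ⟨x, hx, hx5, ht₄⟩
  have d0 : s₄.nvar 0 = n := by rw [hf₄.nvar 0 (by decide), hL.nvar_zero]
  have dw : s₄.rarr 0 = F.weightAt := by rw [hf₄.rarr 0 (by decide), cw]
  rw [halts_seq]
  refine (initRemaining_halts d0 dw).mono ?_
  rintro t₅ s₅ hf₅ ⟨ht₅, hrem⟩
  have e0 : s₅.nvar 0 = n := by rw [hf₅.nvar 0 (by decide), d0]
  have e5 : ∀ l < n, s₅.narr 5 l = x l := by rw [hf₅.narr 5 (by decide)]; exact hx5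
  have ez : ∀ a, a ∉ build.modNA → a ∉ mwu.modNA → a ∉ initRemaining.modNA →
      s₅.narr a = fun _ => 0 := fun a h₁ h₂ h₃ => by
    rw [hf₅.narr a h₃, hf₄.narr a h₂, hf₃.narr a h₁, ba]
  have hNpos : 0 < 8 * (bs + 2) + 1 := Nat.succ_pos _
  have hpack := WeightedObjects.fractionalPacking_of_load_le (F := F) hNpos
    fun e he => hx.load_le e (he.trans_le hG)
  rw [halts_seq]
  refine (extract_halts e0 e5 (ez 7 (by decide) (by decide) (by decide)) hrem
    fun rk hrk => exists_unrankedResistance_le hn hU hF hK hNpos hpack hrk).mono ?_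
  rintro t₆ s₆ hf₆ ⟨ht₆, hE⟩
  have g0 : s₆.nvar 0 = n := by rw [hf₆.nvar 0 (by decide), e0]
  have go : s₆.narr 0 = fun _ => 0 := by
    rw [hf₆.narr 0 (by decide), ez 0 (by decide) (by decide) (by decide)]
  refine (select_halts g0 hE go).mono ?_
  rintro t₇ s₇ - ⟨ht₇, hS⟩
  have hMpos : 0 < G * bs := (Nat.mul_pos hn hn).trans_le hG
  refine ⟨?_, independent_outputSet hS [], ?_⟩
  · have h1 := build_time_le hn hbs h4 hG'
    have h2 := mwu_time_le hn hbs h4 hG' rfl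
    have h3 := totalRaiseTime_le (F := F) hG hx.load_le
    have h5 := le_of_four_pow_le hbs h4
    have hn2 : n ≤ n ^ 3 := Nat.le_self_pow (by norm_num) n
    have hn3 : n ^ 2 ≤ n ^ 3 := Nat.pow_le_pow_right hn (by norm_num)
    have h6 : n * (n * (5 * n + 20) + 25) = 5 * n ^ 3 + 20 * n ^ 2 + 25 * n := by ring
    have h7 : n * (5 * n + 20) = 5 * n ^ 2 + 20 * n := by ring
    omega
  · have hlp := lpValue_le_outputSet hNpos hpack hE hS []
    have hopt := hx.opt_le hj hjmax (blocks_sq_le hbs h4 hn4 hG') hMpos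
    rw [← multWeight_div] at hlp
    have hKu := hF.ratio_ge hU (⟨0, hn⟩ : Fin n) hK (r := n) (by exact_mod_cast hn)
    have hu : 0 < U n / n := (mul_pos_iff_of_pos_left hK).1 (zero_lt_one.trans_le hKu)
    rw [← inv_div (U n)]
    refine le_of_opt_le (WeightedObjects.resistanceConst_pos c hK)
      (WeightedObjects.le_resistanceConst c hK) hu hKu
      (Finset.sum_nonneg fun i _ => (F.weight_pos i).le) ?_ hlp
    have hTpos : (0 : ℝ) < ((8 * (bs + 2) + 1 : ℕ) : ℝ) := by positivity
    have hopt0 : 0 < F.opt := (F.weight_pos ⟨0, hn⟩).trans_le (F.weight_le_opt ⟨0, hn⟩)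
    rw [← mul_div_assoc, le_div_iff₀ hTpos]
    -- `MwuInvariant.opt_le` speaks of `T = 8 * (bs + 2)`, whereas the packing is scaled by `T + 1`.
    -- As `T ≥ 1`, this turns the constant 8 into 16.
    have hT1 : (1 : ℝ) ≤ ((8 * (bs + 2) : ℕ) : ℝ) := by exact_mod_cast (by omega)
    rw [Nat.cast_succ]
    nlinarith

end Program

/-! ### Assembly of the theorem -/

theorem expectedOutput_of_execute_eq {n : ℕ} {F : WeightedObjects n} {P : Cmd} {t : ℕ}
    {cfg : Config} (h : execute P F t = PMF.pure cfg) :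
    expectedOutput P F t = F.totalWeight (outputSet n cfg) := by
  classical
  rw [expectedOutput, h, PMF.pure_map, Finset.sum_eq_single (outputSet n cfg)]
  · simp
  · intro S _ hS
    simp [PMF.pure_apply, hS]
  · simp


theorem mainTheorem1 :
    ∃ (randAlg detAlg : Cmd) (d : ℕ), detAlg.Deterministic ∧
      ∀ (c K : ℝ), 0 < K → ∃ (A δ : ℝ), 0 < A ∧ 0 < δ ∧
        ∀ U : ℝ → ℝ, WellBehaved c U → ∃ C : ℕ,
          ∀ (n : ℕ), 1 ≤ n → ∀ F : WeightedObjects n, F.UnionComplexityLE K U →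
            -- the LP is a relaxation, and rounding an optimal LP solution is good in expectation
            (∀ x : Fin n → ℝ, F.LPOptimal x →
              F.opt ≤ F.lpValue x ∧
              ∀ π : Equiv.Perm (Fin n), F.ResistanceOrder x π →
                ∀ τ : ℝ, τ = A * (U (∑ i, x i) / ∑ i, x i) →
                  (∀ i, 0 ≤ x i / τ ∧ x i / τ ≤ 1) ∧
                  (∀ S, F.Independent (F.greedy π S)) ∧
                  δ * (n / U n * F.lpValue x) ≤ F.expectedRounding π (fun i => x i / τ)) ∧
            -- the randomized algorithm runs in time `O(n ^ 3)`
            (ComputesIndependentSet randAlg F (C * n ^ 3) ∧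
              δ * (n / U n * F.opt) ≤ expectedOutput randAlg F (C * n ^ 3)) ∧
            -- the deterministic algorithm runs in polynomial time
            (ComputesIndependentSet detAlg F (C * n ^ d) ∧
              ∀ cfg ∈ (execute detAlg F (C * n ^ d)).support,
                δ * (n / U n * F.opt) ≤ F.totalWeight (outputSet n cfg)) := by
  -- One program serves as both algorithms: without coin flips its expected output is its output,
  -- and its time is already cubic.
  refine ⟨Program.main, Program.main, 3, Program.main_deterministic, fun c K hK => ?_⟩
  have hρ := WeightedObjects.resistanceConst_pos c hK
  -- This `A` makes `τ / 2` the bound on the resistances. The rounding would allow `δ = 1 / (4 *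
  -- ρ)`, with `ρ` the resistance constant; the program dictates the smaller value.
  refine ⟨2 * WeightedObjects.resistanceConst c K, 1 / (32 * WeightedObjects.resistanceConst c K),
    by positivity, by positivity, fun U hU => ⟨13000, fun n hn F hF => ?_⟩⟩
  obtain ⟨t, s, hexec, ht, hind, hval⟩ := Program.main_halts hn hU hF hK
  have hrun := hexec.execute_eq ht
  have hcomp : ComputesIndependentSet Program.main F (13000 * n ^ 3) := fun cfg hcfg => by
    rw [hrun, PMF.support_pure, Set.mem_singleton_iff] at hcfg
    subst hcfg
    exact ⟨rfl, hind⟩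
  refine ⟨fun x hx => ⟨hx.opt_le, fun π hπ τ hτ => ?_⟩, ⟨hcomp, ?_⟩, hcomp, fun cfg hcfg => ?_⟩
  · obtain ⟨h1, h2⟩ := hx.rounding hn hU hF hK hπ hτ
    refine ⟨h1, F.independent_greedy π, le_trans ?_ h2⟩
    have hKu := hF.ratio_ge hU (⟨0, hn⟩ : Fin n) hK (r := n) (by exact_mod_cast hn)
    have hu : 0 < U n / n := (mul_pos_iff_of_pos_left hK).1 (zero_lt_one.trans_le hKu)
    have hlp : 0 ≤ F.lpValue x :=
      Finset.sum_nonneg fun i _ => mul_nonneg (F.weight_pos i).le (hx.1.nonneg i)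
    rw [← inv_div (U n)]
    refine mul_le_mul_of_nonneg_right ?_ (by positivity)
    exact one_div_le_one_div_of_le (by positivity) (by linarith)
  · rw [expectedOutput_of_execute_eq hrun]
    exact hval
  · rw [hrun, PMF.support_pure, Set.mem_singleton_iff] at hcfg
    subst hcfg
    exact hval
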